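/- **Definitions.** For functions that are positive on some half line $[A,\infty)$, write $f(x)\sim g(x)$ if $\lim_{x\to\infty} f(x)/g(x)=1$. A nonnegative measurable function $g$ on $\mathbb R$ is in $\mathbf L$ (long-tailed) if $g(x+a)\sim g(x)$ for every $a\in\mathbb R$. A probability density function $g$ on $\mathbb R$ is in $\mathcal L_d$ if $g\in\mathbf L$, and in $\mathcal S_d$ if moreover $g\otimes g(x)\sim 2g(x)$, where $g\otimes g(x)=\int_{\mathbb R} g(x-u)g(u)\,du$. A distribution (probability measure) $\rho$ on $\mathbb R$ is in $\mathcal L_{loc}$ if, for every $c>0$, the function $x\mapsto\rho((x,x+c])$ is in $\mathbf L$; it is in $\mathcal S_{loc}$ if moreover $(\rho*\rho)((x,x+c])\sim 2\rho((x,x+c])$ for every $c>0$. **Proposition 1.1.** Let $\mu$ be an absolutely continuous infinitely divisible distribution on $\mathbb R_+=[0,\infty)$ with density $p$ and with Lévy measure $\nu$ and zero drift; that is, $\nu$ is a measure on $\mathbb R_+$ with $\nu(\{0\})=0$ and $\int_0^\infty(1\wedge x)\,\nu(dx)<\infty$, and $$\int_{\mathbb R} e^{izx}\mu(dx)=\exp\Big(\int_0^\infty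 (e^{izx}-1)\,\nu(dx)\Big)\qquad (z\in\mathbb R).$$ Assume that $\nu((c,\infty))>0$ for all $c>0$, and let $\nu_{(1)}(dx)=1_{(1,\infty)}(x)\,\nu(dx)/\nu((1,\infty))$. Then: (i) If $p\in\mathcal L_d$, then $p\in\mathcal S_d$ if and only if $\nu_{(1)}\in\mathcal S_{loc}$. (ii) The following are equivalent: (a) $p\in\mathcal S_d$; (b) $\nu_{(1)}\in\mathcal L_{loc}$ and $p(x)\sim\nu((x,x+1])$; (c) $\nu_{(1)}\in\mathcal L_{loc}$ and there is $C\in(0,\infty)$ such that $p(x)\sim C\,\nu((x,x+1])$. -/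

import Mathlib

open MeasureTheory Filter Topology

noncomputable section

namespace SubexpDensity

/-! ### Asymptotic equivalence and long-tailed functions -/

/-- `f ∼ g` for functions that are positive on some half line `[A, ∞)`:
`f x / g x → 1` as `x → ∞`. -/
def AsympEquiv (f g : ℝ → ℝ) : Prop :=
  (∃ A : ℝ, ∀ x, A ≤ x → 0 < f x ∧ 0 < g x) ∧
    Tendsto (fun x => f x / g x) atTop (𝓝 1)

/-- The class `𝐋` of long-tailed functions: nonnegative measurable `g` on `ℝ` with
`g (x + a) ∼ g x` for every real `a`. -/
structure LongTailed (g : ℝ → ℝ) : Prop where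
  measurable : Measurable g
  nonneg : ∀ x, 0 ≤ g x
  shift : ∀ a : ℝ, AsympEquiv (fun x => g (x + a)) g

/-! ### Densities -/

/-- Probability density functions on `ℝ` (with respect to Lebesgue measure). -/
structure IsProbDensity (g : ℝ → ℝ) : Prop where
  measurable : Measurable g
  nonneg : ∀ x, 0 ≤ g x
  lintegral_eq_one : ∫⁻ x, ENNReal.ofReal (g x) = 1

/-- `p` is a density of the distribution `μ`, i.e. `μ(dx) = p(x) dx`. -/
structure IsDensityOf (p : ℝ → ℝ) (μ : Measure ℝ) : Prop where
  isProbDensity : IsProbDensity p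
  eq_withDensity : μ = volume.withDensity (fun x => ENNReal.ofReal (p x))

/-- The convolution `f ⊗ g (x) = ∫ f(x - u) g(u) du` of two densities. Where the integral is
infinite the value is `0`; this cannot satisfy the positivity required by `AsympEquiv`. -/
def densityConv (f g : ℝ → ℝ) (x : ℝ) : ℝ := ∫ u, f (x - u) * g u

/-- The class `ℒ_d` of long-tailed densities. -/
def LongTailedDensity (g : ℝ → ℝ) : Prop := IsProbDensity g ∧ LongTailed g

/-- The class `𝒮_d` of subexponential densities. -/
def SubexpDensity (g : ℝ → ℝ) : Prop :=
  LongTailedDensity g ∧ AsympEquiv (densityConv g g) (fun x => 2 * g x)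

/-! ### Local classes of distributions -/

/-- The function `x ↦ ρ((x, x + c])`. -/
def intervalMass (ρ : Measure ℝ) (c x : ℝ) : ℝ := ρ.real (Set.Ioc x (x + c))

/-- The class `ℒ_Δ` of distributions on `ℝ`, with `Δ = (0, c]`. -/
def MemLDelta (c : ℝ) (ρ : Measure ℝ) : Prop :=
  IsProbabilityMeasure ρ ∧ LongTailed (intervalMass ρ c)

/-- The class `ℒ_loc`. -/
def MemLLoc (ρ : Measure ℝ) : Prop := ∀ c : ℝ, 0 < c → MemLDelta c ρ

/-- The class `𝒮_Δ` of distributions on `ℝ`, with `Δ = (0, c]`. -/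
def MemSDelta (c : ℝ) (ρ : Measure ℝ) : Prop :=
  MemLDelta c ρ ∧
    AsympEquiv (intervalMass (ρ.conv ρ) c) (fun x => 2 * intervalMass ρ c x)

/-- The class `𝒮_loc` of locally subexponential distributions. -/
def MemSLoc (ρ : Measure ℝ) : Prop := ∀ c : ℝ, 0 < c → MemSDelta c ρ

/-! ### Infinitely divisible distributions on the half line -/

/-- The `n`-th convolution power of a measure, with `ρ^{0*} = δ₀`. -/
def convPow (ρ : Measure ℝ) : ℕ → Measure ℝ
  | 0 => Measure.dirac 0
  | n + 1 => (convPow ρ n).conv ρ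

/-- `μ` is an infinitely divisible distribution on `ℝ`. -/
def InfinitelyDivisible (μ : Measure ℝ) : Prop :=
  IsProbabilityMeasure μ ∧
    ∀ n : ℕ, 0 < n → ∃ ρ : Measure ℝ, IsProbabilityMeasure ρ ∧ convPow ρ n = μ

/-- `ν` is a measure on `ℝ₊ = [0, ∞)` with `ν({0}) = 0` and `∫ (1 ∧ x) ν(dx) < ∞`. -/
structure IsLevyMeasure (ν : Measure ℝ) : Prop where
  neg_eq_zero : ν (Set.Iio 0) = 0
  zero_eq_zero : ν {0} = 0
  lintegral_lt_top : ∫⁻ x, ENNReal.ofReal (min 1 x) ∂ν < ⊤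

/-- `μ` is an infinitely divisible distribution on `ℝ₊` with drift `γ₀ ≥ 0` and Lévy measure `ν`:
its characteristic function is `exp (∫ (e^{izx} - 1) ν(dx) + i γ₀ z)`. -/
structure HasLevyRepresentation (μ : Measure ℝ) (γ₀ : ℝ) (ν : Measure ℝ) : Prop where
  infinitelyDivisible : InfinitelyDivisible μ
  neg_eq_zero : μ (Set.Iio 0) = 0
  drift_nonneg : 0 ≤ γ₀
  isLevyMeasure : IsLevyMeasure ν
  charFun_eq : ∀ z : ℝ, charFun μ z =
    Complex.exp ((∫ x, (Complex.exp (Complex.I * z * x) - 1) ∂ν) + Complex.I * γ₀ * z)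

/-- The normalized Lévy measure `ν₍₁₎(dx) = 1_{(1,∞)}(x) ν(dx) / ν((1,∞))`. -/
def normalizedLevy (ν : Measure ℝ) : Measure ℝ :=
  (ν (Set.Ioi 1))⁻¹ • ν.restrict (Set.Ioi 1)

end SubexpDensity

end

open scoped ENNReal NNReal

noncomputable section

namespace SubexpDensity

section

/-! ### Asymptotic comparison of `ℝ≥0∞`-valued functions -/

/-! All asymptotics are one-sided comparisons in `ℝ≥0∞` of cells `m((x, x + c])` with a long-tailed
reference function `P`. The engine is Steutel's identity `x μ(dx) = μ ∗ (x ν(dx))`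
(`HasLevyRepresentation.sb_eq`). Size-biasing gains a factor `x`, so convolution with the bounded
part of a size-biased measure is negligible against `x P(x)`. When subexponentiality is available,
mass where both factors are large is controlled by `SubexpRef.mid`. Thus `m₁ ∗ (x m₂(dx))` behaves
like `m₁(ℝ)` times `x m₂(dx)` (`SubexpRef.conv_sb_evLe`, `EvGe.conv`).

From `p ∈ 𝒮_d` to the Lévy measure: write `μ = μ' ∗ π` with `μ'` carrying the small jumps and `π`
compound Poisson. The convolution inverse of `π` is an explicit difference of two measures, each
dominated by a multiple of `π`. Applying it to Steutel's identity isolates `μ' ∗ (x ν(dx))`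
(`SubexpLevy.exists_smoothing`). By Markov's inequality `μ'` concentrates near `0` as the jump
threshold shrinks, so the smoothing can be removed, and `ν((x, x + c]) ∼ c p(x)` for every `c > 0`.
This gives both `ν₍₁₎ ∈ 𝒮_loc` and (b).

From `ν₍₁₎ ∈ 𝒮_loc` and `p ∈ ℒ_d` to `p(x) ∼ ν((x, x + 1])`: a bootstrap along the half line in
Steutel's identity shows that the cells of `μ` are `O(ν₍₁₎((x, x + 1]))`
(`SubexpRef.dominated_of_sb_eq`). The same identity then yields the exact constant
(`HasLevyRepresentation.asympEquiv_of_memSLoc`).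

From (c) to `p ∈ 𝒮_d`: no subexponentiality is assumed, but `p(x) ∼ C ν((x, x + 1])` allows
replacing one factor of `(x μ) ∗ μ` by `C (x ν)`, and `(x ν) ∗ μ = x μ`. Hence the cells of `μ ∗ μ`
are asymptotic to `2 C p` (`HasLevyRepresentation.cell_conv_self`). A heavy-tailed law cannot have a
lower limit above `2` here (`EvGe.le_two_of_conv`), so `C ≤ 1`. The resulting upper bound `2`
suffices for subexponentiality (`IsDensityOf.subexpDensity_iff`). -/

/-- `limsup u / P ≤ k` at infinity. -/
def EvLe (P u : ℝ → ℝ≥0∞) (k : ℝ≥0∞) : Prop :=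
  ∀ k', k < k' → ∀ᶠ x in atTop, u x ≤ k' * P x

/-- `liminf u / P ≥ k` at infinity. -/
def EvGe (P u : ℝ → ℝ≥0∞) (k : ℝ≥0∞) : Prop :=
  ∀ k', k' < k → ∀ᶠ x in atTop, k' * P x ≤ u x

variable {P u v : ℝ → ℝ≥0∞} {k l a b : ℝ≥0∞}

theorem EvLe.of_eventually (h : ∀ᶠ x in atTop, u x ≤ k * P x) : EvLe P u k := fun k' hk => by
  filter_upwards [h] with x hx
  exact hx.trans (by gcongr)

theorem EvGe.of_eventually (h : ∀ᶠ x in atTop, k * P x ≤ u x) : EvGe P u k := fun k' hk => by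
  filter_upwards [h] with x hx
  exact le_trans (by gcongr) hx

theorem EvLe.mono (h : EvLe P u k) (hv : ∀ᶠ x in atTop, v x ≤ u x) (hk : k ≤ l) : EvLe P v l :=
  fun k' hk' => by
    filter_upwards [h k' (hk.trans_lt hk'), hv] with x h1 h2 using h2.trans h1

theorem EvGe.mono (h : EvGe P u k) (hv : ∀ᶠ x in atTop, u x ≤ v x) (hk : l ≤ k) : EvGe P v l :=
  fun k' hk' => by
    filter_upwards [h k' (hk'.trans_le hk), hv] with x h1 h2 using h1.trans h2

theorem EvLe.of_forall_gt (h : ∀ k', k < k' → EvLe P u k') : EvLe P u k := fun k' hk => by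
  obtain ⟨l, h1, h2⟩ := exists_between hk
  exact h l h1 k' h2

theorem EvGe.of_forall_lt (h : ∀ k', k' < k → EvGe P u k') : EvGe P u k := fun k' hk => by
  obtain ⟨l, h1, h2⟩ := exists_between hk
  exact h l h2 k' h1

theorem EvLe.add (hu : EvLe P u a) (hv : EvLe P v b) : EvLe P (fun x => u x + v x) (a + b) := by
  intro k' hk'
  obtain ⟨r, hr, hlt⟩ := ENNReal.lt_iff_exists_add_pos_lt.1 hk'
  have hab : a + b ≠ ⊤ := (lt_top_of_lt hk').ne
  have ha : a ≠ ⊤ := fun h => hab (by simp [h])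
  have hb : b ≠ ⊤ := fun h => hab (by simp [h])
  have hr2 : (r / 2 : ℝ≥0∞) ≠ 0 := by simp [hr.ne']
  filter_upwards [hu (a + r / 2) (ENNReal.lt_add_right ha hr2),
    hv (b + r / 2) (ENNReal.lt_add_right hb hr2)] with x h1 h2
  calc u x + v x ≤ (a + r / 2) * P x + (b + r / 2) * P x := add_le_add h1 h2
    _ = (a + b + (r / 2 + r / 2)) * P x := by ring
    _ ≤ k' * P x := by rw [ENNReal.add_halves]; gcongr

theorem EvGe.add (hu : EvGe P u a) (hv : EvGe P v b) : EvGe P (fun x => u x + v x) (a + b) := by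
  intro k' hk'
  rcases eq_or_ne a 0 with rfl | ha
  · rw [zero_add] at hk'
    filter_upwards [hv k' hk'] with x h using h.trans le_add_self
  rcases eq_or_ne b 0 with rfl | hb
  · rw [add_zero] at hk'
    filter_upwards [hu k' hk'] with x h using h.trans le_self_add
  obtain ⟨y, hy, z, hz, hlt⟩ := ENNReal.exists_lt_add_of_lt_add hk' ha hb
  filter_upwards [hu y hy, hv z hz] with x h1 h2
  calc k' * P x ≤ (y + z) * P x := by gcongr
    _ = y * P x + z * P x := by ring
    _ ≤ _ := add_le_add h1 h2

theorem EvLe.const_mul (hu : EvLe P u k) {c : ℝ≥0∞} (hc : c ≠ ⊤) :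
    EvLe P (fun x => c * u x) (c * k) := by
  intro k' hk'
  rcases eq_or_ne c 0 with rfl | h0
  · simp
  have hkc : k < k' / c := by
    rw [ENNReal.lt_div_iff_mul_lt (Or.inl h0) (Or.inl hc), mul_comm]; exact hk'
  filter_upwards [hu _ hkc] with x hx
  calc c * u x ≤ c * (k' / c * P x) := by gcongr
    _ = (c * (k' / c)) * P x := by ring
    _ = k' * P x := by rw [ENNReal.mul_div_cancel h0 hc]

theorem EvGe.const_mul (hu : EvGe P u k) {c : ℝ≥0∞} (hc : c ≠ ⊤) :
    EvGe P (fun x => c * u x) (c * k) := by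
  intro k' hk'
  rcases eq_or_ne c 0 with rfl | h0
  · simp at hk'
  have hkc : k' / c < k := by
    rw [ENNReal.div_lt_iff (Or.inl h0) (Or.inl hc), mul_comm]; exact hk'
  filter_upwards [hu _ hkc] with x hx
  calc k' * P x = (c * (k' / c)) * P x := by rw [ENNReal.mul_div_cancel h0 hc]
    _ = c * (k' / c * P x) := by ring
    _ ≤ c * u x := by gcongr

/-- Subtraction of asymptotics requires the opposite one-sided bound on the removed summand. This is
how single pieces of a decomposed convolution are isolated without leaving `ℝ≥0∞`. -/
theorem EvLe.cancel_left (hP : ∀ x, P x ≠ ⊤) (ha : a ≠ ⊤) (h : EvLe P (fun x => u x + v x) (a + b))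
    (hu : EvGe P u a) : EvLe P v b := by
  intro k' hk'
  obtain ⟨r, hr, hlt⟩ := ENNReal.lt_iff_exists_add_pos_lt.1 hk'
  have hb : b ≠ ⊤ := (lt_top_of_lt hk').ne
  have hr2 : (r / 2 : ℝ≥0∞) ≠ 0 := by simp [hr.ne']
  have h1 : ∀ᶠ x in atTop, (a - r / 2) * P x ≤ u x := by
    rcases eq_or_ne a 0 with rfl | ha0
    · simp
    · exact hu _ (ENNReal.sub_lt_self ha ha0 hr2)
  filter_upwards [h1, h (a + b + r / 2) (ENNReal.lt_add_right (by simp [ha, hb]) hr2)]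
    with x h1 h2
  have hfin : (a - r / 2) * P x ≠ ⊤ :=
    ENNReal.mul_ne_top ((tsub_le_self.trans_lt ha.lt_top).ne) (hP x)
  refine (ENNReal.add_le_add_iff_left hfin).1 ?_
  calc (a - r / 2) * P x + v x ≤ u x + v x := by gcongr
    _ ≤ (a + b + r / 2) * P x := h2
    _ ≤ ((a - r / 2) + r / 2 + b + r / 2) * P x := by gcongr; exact le_tsub_add
    _ = (a - r / 2) * P x + (b + (r / 2 + r / 2)) * P x := by ring
    _ ≤ (a - r / 2) * P x + k' * P x := by rw [ENNReal.add_halves]; gcongr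

theorem EvGe.cancel_left (hP : ∀ x, P x ≠ ⊤) (ha : a ≠ ⊤) (h : EvGe P (fun x => u x + v x) (a + b))
    (hu : EvLe P u a) : EvGe P v b := by
  intro k' hk'
  obtain ⟨r, hr, hlt⟩ := ENNReal.lt_iff_exists_add_pos_lt.1 hk'
  have hr0 : (r : ℝ≥0∞) ≠ 0 := by simp [hr.ne']
  filter_upwards [hu (a + r) (ENNReal.lt_add_right ha hr0),
    h (a + (k' + r)) ((ENNReal.add_lt_add_iff_left ha).2 hlt)] with x h1 h2
  have hfin : (a + r) * P x ≠ ⊤ := ENNReal.mul_ne_top (by simp [ha]) (hP x)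
  refine (ENNReal.add_le_add_iff_left hfin).1 ?_
  calc (a + r) * P x + k' * P x = (a + (k' + r)) * P x := by ring
    _ ≤ u x + v x := h2
    _ ≤ _ := by gcongr

theorem EvLe.trans {R : ℝ → ℝ≥0∞} (h : EvLe P u a) (h' : EvLe R P b) (ha : a ≠ ⊤) (hb : b ≠ ⊤) :
    EvLe R u (a * b) := by
  intro k' hk'
  have h1 : Tendsto (fun e : ℝ≥0∞ => (a + e) * (b + e)) (𝓝[>] 0) (𝓝 ((a + 0) * (b + 0))) := by
    refine Tendsto.mono_left ?_ nhdsWithin_le_nhds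
    exact ENNReal.Tendsto.mul (tendsto_const_nhds.add tendsto_id) (by simp [hb])
      (tendsto_const_nhds.add tendsto_id) (by simp [ha])
  rw [add_zero, add_zero] at h1
  obtain ⟨e, he, hpos⟩ := ((h1.eventually_lt_const hk').and self_mem_nhdsWithin).exists
  have hpos : e ≠ 0 := (show 0 < e from hpos).ne'
  filter_upwards [h _ (ENNReal.lt_add_right ha hpos), h' _ (ENNReal.lt_add_right hb hpos)]
    with x h2 h3
  calc u x ≤ (a + e) * ((b + e) * R x) := h2.trans (by gcongr)
    _ = (a + e) * (b + e) * R x := by ring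
    _ ≤ _ := by gcongr

theorem EvGe.inv (h : EvGe P u k) : EvLe u P k⁻¹ := EvLe.of_forall_gt fun k₁ hk₁ k' hk' => by
  have h1 : k' ≠ 0 := (zero_le.trans_lt hk').ne'
  rcases eq_or_ne k' ⊤ with rfl | htop
  · filter_upwards [h k₁⁻¹ (ENNReal.inv_lt_iff_inv_lt.1 hk₁)] with x hx
    have h2 : k₁ ≠ 0 := (zero_le.trans_lt hk₁).ne'
    calc P x = k₁ * (k₁⁻¹ * P x) := by
          rw [← mul_assoc, ENNReal.mul_inv_cancel h2 hk'.ne, one_mul]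
      _ ≤ ⊤ * u x := by gcongr
  · filter_upwards [h k'⁻¹ (ENNReal.inv_lt_iff_inv_lt.1 (hk₁.trans hk'))] with x hx
    calc P x = k' * (k'⁻¹ * P x) := by
          rw [← mul_assoc, ENNReal.mul_inv_cancel h1 htop, one_mul]
      _ ≤ k' * u x := by gcongr

theorem EvLe.inv (h : EvLe P u k) : EvGe u P k⁻¹ := fun k' hk' => by
  rcases eq_or_ne k' 0 with rfl | h1
  · simp
  have htop : k' ≠ ⊤ := (lt_top_of_lt hk').ne
  filter_upwards [h k'⁻¹ (ENNReal.lt_inv_iff_lt_inv.1 hk')] with x hx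
  calc k' * u x ≤ k' * (k'⁻¹ * P x) := by gcongr
    _ = P x := by rw [← mul_assoc, ENNReal.mul_inv_cancel h1 htop, one_mul]

/-! ### Long-tailed reference functions -/

/-- Functions with `P (x + a) / P x → 1` locally uniformly in `a`. -/
structure LongTailRef (P : ℝ → ℝ≥0∞) : Prop where
  ne_top : ∀ x, P x ≠ ⊤
  pos : ∀ᶠ x in atTop, P x ≠ 0
  shift : ∀ (A : ℝ) (r : ℝ≥0∞), 1 < r → ∀ᶠ x in atTop, ∀ a, |a| ≤ A → P (x + a) ≤ r * P x

theorem LongTailRef.shift_ge (hP : LongTailRef P) (A : ℝ) {r : ℝ≥0∞} (hr : 1 < r) :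
    ∀ᶠ x in atTop, ∀ a, |a| ≤ A → P x ≤ r * P (x + a) := by
  obtain ⟨X, hX⟩ := eventually_atTop.1 (hP.shift A r hr)
  filter_upwards [eventually_ge_atTop (X + A)] with x hx a ha
  have := hX (x + a) (by linarith [neg_le_of_abs_le ha]) (-a) (by rwa [abs_neg])
  simpa using this

theorem tendsto_mul_one_nhdsGT (k : ℝ≥0∞) :
    Tendsto (fun r : ℝ≥0∞ => r * k) (𝓝[>] 1) (𝓝 k) := by
  have : Tendsto (fun r : ℝ≥0∞ => r * k) (𝓝 1) (𝓝 (1 * k)) :=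
    ENNReal.Tendsto.mul_const tendsto_id (Or.inl (by simp))
  rw [one_mul] at this
  exact this.mono_left nhdsWithin_le_nhds

theorem exists_one_lt_mul_lt (h : k < l) : ∃ r : ℝ≥0∞, 1 < r ∧ r ≠ ⊤ ∧ r * k < l := by
  have : (𝓝[>] (1 : ℝ≥0∞)).NeBot := nhdsGT_neBot_of_exists_gt ⟨⊤, by simp⟩
  have hm : ∀ᶠ r : ℝ≥0∞ in 𝓝[>] 1, 1 < r := self_mem_nhdsWithin
  have ht : ∀ᶠ r : ℝ≥0∞ in 𝓝[>] 1, r < ⊤ :=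
    nhdsWithin_le_nhds (Iio_mem_nhds (by simp : (1 : ℝ≥0∞) < ⊤))
  obtain ⟨r, h1, h2, h3⟩ :=
    (((tendsto_mul_one_nhdsGT k).eventually_lt_const h).and (hm.and ht)).exists
  exact ⟨r, h2, ne_of_lt h3, h1⟩

theorem EvLe.shift (hP : LongTailRef P) (h : EvLe P u k) (s : ℝ) :
    EvLe P (fun x => u (x + s)) k := by
  intro k' hk'
  obtain ⟨l, hl, hlk⟩ := exists_between hk'
  obtain ⟨r, hr, -, hrl⟩ := exists_one_lt_mul_lt hlk
  filter_upwards [hP.shift |s| r hr, (tendsto_atTop_add_const_right _ s tendsto_id).eventually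
    (h l hl)] with x h1 h2
  calc u (x + s) ≤ l * P (x + s) := h2
    _ ≤ l * (r * P x) := by gcongr; exact h1 s le_rfl
    _ = r * l * P x := by ring
    _ ≤ k' * P x := by gcongr

theorem EvGe.shift (hP : LongTailRef P) (h : EvGe P u k) (s : ℝ) :
    EvGe P (fun x => u (x + s)) k := by
  intro k' hk'
  obtain ⟨r, hr, -, hrl⟩ := exists_one_lt_mul_lt hk'
  filter_upwards [hP.shift_ge |s| hr, (tendsto_atTop_add_const_right _ s tendsto_id).eventually
    (h _ hrl)] with x h1 h2
  calc k' * P x ≤ k' * (r * P (x + s)) := by gcongr; exact h1 s le_rfl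
    _ = r * k' * P (x + s) := by ring
    _ ≤ _ := h2

/-! ### The uniform convergence theorem for long-tailed functions -/

theorem LongTailed.eventually_pos {g : ℝ → ℝ} (hg : LongTailed g) : ∀ᶠ x in atTop, 0 < g x := by
  obtain ⟨A, hA⟩ := (hg.shift 0).1
  filter_upwards [eventually_ge_atTop A] with x hx using (hA x hx).2

theorem LongTailed.eventually_le {g : ℝ → ℝ} (hg : LongTailed g) {t : ℝ} (ht : 1 < t) (s : ℝ) :
    ∀ᶠ x in atTop, g (x + s) ≤ t * g x := by
  filter_upwards [(hg.shift s).2.eventually_lt_const ht, hg.eventually_pos] with x h1 h2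
  exact ((div_lt_iff₀ h2).1 h1).le

theorem LongTailed.eventually_ge {g : ℝ → ℝ} (hg : LongTailed g) {t : ℝ} (ht : 1 < t) (s : ℝ) :
    ∀ᶠ x in atTop, g x ≤ t * g (x + s) := by
  have := (tendsto_atTop_add_const_right _ s tendsto_id).eventually
    (hg.eventually_le ht (-s))
  filter_upwards [this] with x hx
  simpa using hx

/-- The uniform convergence theorem by Steinhaus-type overlap. Along a bad sequence `(x n, a n)`,
the shifts that are good from index `n` on fill most of `[0, L]` by continuity of measure, both
around `x n` and around `x n + a n`. The two sets, placed on a common axis, must meet, and a common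
point links `g (x n + a n)` to `g (x n)` at the cost of `t` twice. -/
theorem LongTailed.uniform {g : ℝ → ℝ} (hg : LongTailed g) (A : ℝ) {t : ℝ} (ht : 1 < t) :
    ∀ᶠ x in atTop, ∀ a, |a| ≤ A → g (x + a) ≤ t * t * g x := by
  by_contra hcon
  rw [not_eventually] at hcon
  have hseq : ∀ n : ℕ, ∃ x a : ℝ, (n : ℝ) ≤ x ∧ |a| ≤ A ∧ t * t * g x < g (x + a) := fun n => by
    obtain ⟨x, hx, hn⟩ := (hcon.and_eventually (eventually_ge_atTop (n : ℝ))).exists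
    push Not at hx
    obtain ⟨a, ha, h⟩ := hx
    exact ⟨x, a, hn, ha, h⟩
  choose x a hx ha hlt using hseq
  have hA : 0 ≤ A := (abs_nonneg _).trans (ha 0)
  have hxt : Tendsto x atTop atTop := tendsto_atTop_mono hx tendsto_natCast_atTop_atTop
  have hxat : Tendsto (fun n => x n + a n) atTop atTop :=
    tendsto_atTop_mono (fun n => by linarith [neg_le_of_abs_le (ha n)])
      (tendsto_atTop_add_const_right _ (-A) hxt)
  -- Two sets of measure above `3 L / 4` inside an interval of length `L + 2 A` intersect as soon as
  -- `3 L / 2 ≥ L + 2 A`.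
  set L : ℝ := 4 * A + 4 with hL
  have hgm := hg.measurable
  let V : ℕ → Set ℝ := fun n => Set.Icc 0 L ∩ ⋂ k ≥ n, {s | g (x k + s) ≤ t * g (x k)}
  let W : ℕ → Set ℝ := fun n => Set.Icc 0 L ∩
    ⋂ k ≥ n, {s | g (x k + a k) ≤ t * g (x k + a k + s)}
  have key : ∀ (S : ℕ → Set ℝ), (∀ s, ∀ᶠ n in atTop, s ∈ S n) →
      ∀ᶠ n in atTop, ENNReal.ofReal (3 * L / 4) <
        volume (Set.Icc 0 L ∩ ⋂ k ≥ n, S k) := by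
    intro S hS
    have hmono : Monotone fun n => Set.Icc 0 L ∩ ⋂ k ≥ n, S k := by
      intro m n hmn
      refine Set.inter_subset_inter_right _ ?_
      exact Set.biInter_mono (fun k hk => le_trans hmn hk) (fun _ _ => le_rfl)
    have hU : ⋃ n, (Set.Icc 0 L ∩ ⋂ k ≥ n, S k) = Set.Icc 0 L := by
      rw [← Set.inter_iUnion]
      refine Set.inter_eq_left.2 fun s _ => ?_
      obtain ⟨n, hn⟩ := eventually_atTop.1 (hS s)
      exact Set.mem_iUnion.2 ⟨n, Set.mem_iInter₂.2 hn⟩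
    have := tendsto_measure_iUnion_atTop (μ := volume) hmono
    rw [hU, Real.volume_Icc, sub_zero] at this
    exact this.eventually_const_lt ((ENNReal.ofReal_lt_ofReal_iff (by linarith)).2 (by linarith))
  have hV := key (fun k => {s | g (x k + s) ≤ t * g (x k)})
    (fun s => hxt.eventually (hg.eventually_le ht s))
  have hW := key (fun k => {s | g (x k + a k) ≤ t * g (x k + a k + s)})
    (fun s => hxat.eventually (hg.eventually_ge ht s))
  obtain ⟨n, hVn, hWn⟩ := (hV.and hW).exists
  have hWmeas : MeasurableSet (W n) := by
    refine measurableSet_Icc.inter (MeasurableSet.iInter fun k => MeasurableSet.iInter fun _ => ?_)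
    exact measurableSet_le measurable_const (by fun_prop)
  let W' : Set ℝ := (fun s => s + -a n) ⁻¹' W n
  have hW'vol : volume W' = volume (W n) := measure_preimage_add_right _ _ _
  have hne : (V n ∩ W').Nonempty := by
    refine nonempty_inter_of_measure_lt_add volume (u := Set.Icc (-A) (L + A))
      (hWmeas.preimage (by fun_prop)) ?_ ?_ ?_
    · rintro s ⟨hs, -⟩
      exact ⟨by linarith [hs.1], by linarith [hs.2]⟩
    · rintro s ⟨hs, -⟩
      have h1 := abs_le.1 (ha n)
      exact ⟨by linarith [hs.1], by linarith [hs.2]⟩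
    · rw [hW'vol, Real.volume_Icc]
      refine lt_of_le_of_lt ?_ (ENNReal.add_lt_add hVn hWn)
      rw [← ENNReal.ofReal_add (by linarith) (by linarith)]
      exact ENNReal.ofReal_le_ofReal (by linarith)
  obtain ⟨s, ⟨-, hs1⟩, ⟨-, hs2⟩⟩ := hne
  have h1 : g (x n + s) ≤ t * g (x n) := Set.mem_iInter₂.1 hs1 n le_rfl
  have h2 : g (x n + a n) ≤ t * g (x n + a n + (s + -a n)) := Set.mem_iInter₂.1 hs2 n le_rfl
  rw [show x n + a n + (s + -a n) = x n + s by ring] at h2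
  have h3 : t * g (x n + s) ≤ t * (t * g (x n)) := by gcongr
  linarith [hlt n]

theorem LongTailed.longTailRef {g : ℝ → ℝ} (hg : LongTailed g) :
    LongTailRef (fun x => ENNReal.ofReal (g x)) where
  ne_top _ := ENNReal.ofReal_ne_top
  pos := by
    filter_upwards [hg.eventually_pos] with x hx
    simpa using hx
  shift A r hr := by
    obtain ⟨q, hq1, hqr⟩ := exists_between hr
    have hq : q ≠ ⊤ := (lt_top_of_lt hqr).ne
    have hq' : 1 < q.toReal := by
      rw [← ENNReal.toReal_one]; exact (ENNReal.toReal_lt_toReal (by simp) hq).2 hq1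
    filter_upwards [hg.uniform A (Real.lt_sqrt_of_sq_lt (by simpa using hq') : 1 < √q.toReal)]
      with x hx a ha
    have := hx a ha
    rw [Real.mul_self_sqrt (by linarith)] at this
    calc ENNReal.ofReal (g (x + a)) ≤ ENNReal.ofReal (q.toReal * g x) :=
          ENNReal.ofReal_le_ofReal this
      _ = q * ENNReal.ofReal (g x) := by
          rw [ENNReal.ofReal_mul (by linarith), ENNReal.ofReal_toReal hq]
      _ ≤ _ := by gcongr

/-- Multiplication by the identity preserves long-tailedness. -/
theorem LongTailRef.id_mul (hP : LongTailRef P) :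
    LongTailRef (fun x => ENNReal.ofReal x * P x) where
  ne_top x := ENNReal.mul_ne_top ENNReal.ofReal_ne_top (hP.ne_top x)
  pos := by
    filter_upwards [hP.pos, eventually_gt_atTop 0] with x hx h0
    exact mul_ne_zero (by simpa using h0) hx
  shift A r hr := by
    obtain ⟨q, hq1, -, hqr⟩ := exists_one_lt_mul_lt hr
    rw [mul_one] at hqr
    obtain ⟨q', hq1', -, hqr'⟩ := exists_one_lt_mul_lt hqr
    have hq : q ≠ ⊤ := (lt_top_of_lt hqr).ne
    have hq' : 1 < q.toReal := by
      rw [← ENNReal.toReal_one]; exact (ENNReal.toReal_lt_toReal (by simp) hq).2 hq1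
    filter_upwards [hP.shift A q' hq1', eventually_ge_atTop (A / (q.toReal - 1)),
      eventually_ge_atTop 0] with x h1 h2 h0 a ha
    have h3 : x + a ≤ q.toReal * x := by
      have := (div_le_iff₀ (by linarith)).1 h2
      nlinarith [le_of_abs_le ha]
    calc ENNReal.ofReal (x + a) * P (x + a) ≤ ENNReal.ofReal (q.toReal * x) * (q' * P x) := by
          gcongr; exact h1 a ha
      _ = (q' * q) * (ENNReal.ofReal x * P x) := by
          rw [ENNReal.ofReal_mul (by linarith), ENNReal.ofReal_toReal hq]; ring
      _ ≤ _ := by gcongr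

/-! ### Translation from and to `AsympEquiv` -/

theorem AsympEquiv.evLe {f g : ℝ → ℝ} (h : AsympEquiv f g) :
    EvLe (fun x => ENNReal.ofReal (g x)) (fun x => ENNReal.ofReal (f x)) 1 := by
  intro k' hk'
  obtain ⟨q, hq1, hqr⟩ := exists_between hk'
  have hq : q ≠ ⊤ := (lt_top_of_lt hqr).ne
  have hq' : 1 < q.toReal := by
    rw [← ENNReal.toReal_one]; exact (ENNReal.toReal_lt_toReal (by simp) hq).2 hq1
  obtain ⟨⟨A, hA⟩, ht⟩ := h
  filter_upwards [ht.eventually_lt_const hq', eventually_ge_atTop A] with x h1 h2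
  calc ENNReal.ofReal (f x) ≤ ENNReal.ofReal (q.toReal * g x) :=
        ENNReal.ofReal_le_ofReal ((div_lt_iff₀ (hA x h2).2).1 h1).le
    _ = q * ENNReal.ofReal (g x) := by
        rw [ENNReal.ofReal_mul (by linarith), ENNReal.ofReal_toReal hq]
    _ ≤ _ := by gcongr

theorem AsympEquiv.evGe {f g : ℝ → ℝ} (h : AsympEquiv f g) :
    EvGe (fun x => ENNReal.ofReal (g x)) (fun x => ENNReal.ofReal (f x)) 1 := by
  intro k' hk'
  have hq : k' ≠ ⊤ := (lt_top_of_lt hk').ne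
  have hq' : k'.toReal < 1 := by
    rw [← ENNReal.toReal_one]; exact (ENNReal.toReal_lt_toReal hq (by simp)).2 hk'
  obtain ⟨⟨A, hA⟩, ht⟩ := h
  filter_upwards [ht.eventually_const_lt hq', eventually_ge_atTop A] with x h1 h2
  calc k' * ENNReal.ofReal (g x) = ENNReal.ofReal (k'.toReal * g x) := by
        rw [ENNReal.ofReal_mul (by simp), ENNReal.ofReal_toReal hq]
    _ ≤ _ := ENNReal.ofReal_le_ofReal ((lt_div_iff₀ (hA x h2).2).1 h1).le

theorem AsympEquiv.of_ev {f g : ℝ → ℝ} (hf : ∀ x, 0 ≤ f x) (hg : ∀ᶠ x in atTop, 0 < g x)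
    (h1 : EvLe (fun x => ENNReal.ofReal (g x)) (fun x => ENNReal.ofReal (f x)) 1)
    (h2 : EvGe (fun x => ENNReal.ofReal (g x)) (fun x => ENNReal.ofReal (f x)) 1) :
    AsympEquiv f g := by
  have hle : ∀ t : ℝ, 1 < t → ∀ᶠ x in atTop, f x ≤ t * g x := fun t ht => by
    filter_upwards [h1 (ENNReal.ofReal t) (by simpa using ht), hg] with x hx h0
    rw [← ENNReal.ofReal_mul (by linarith)] at hx
    exact (ENNReal.ofReal_le_ofReal_iff (by positivity)).1 hx
  have hge : ∀ t : ℝ, 0 ≤ t → t < 1 → ∀ᶠ x in atTop, t * g x ≤ f x := fun t h0 ht => by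
    filter_upwards [h2 (ENNReal.ofReal t) (by simpa using ht)] with x hx
    rw [← ENNReal.ofReal_mul h0] at hx
    exact (ENNReal.ofReal_le_ofReal_iff (hf x)).1 hx
  refine ⟨?_, ?_⟩
  · obtain ⟨A, hA⟩ := eventually_atTop.1 ((hge (1 / 2) (by norm_num) (by norm_num)).and hg)
    refine ⟨A, fun x hx => ⟨?_, (hA x hx).2⟩⟩
    linarith [(hA x hx).1, (hA x hx).2]
  · rw [tendsto_order]
    refine ⟨fun t ht => ?_, fun t ht => ?_⟩
    · obtain ⟨s, hs1, hs2⟩ := exists_between (max_lt ht zero_lt_one)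
      filter_upwards [hge s (le_of_lt (lt_of_le_of_lt (le_max_right _ _) hs1)) hs2, hg]
        with x hx h0
      rw [lt_div_iff₀ h0]
      nlinarith [lt_of_le_of_lt (le_max_left _ _) hs1]
    · obtain ⟨s, hs1, hs2⟩ := exists_between ht
      filter_upwards [hle s hs1, hg] with x hx h0
      rw [div_lt_iff₀ h0]
      nlinarith

theorem AsympEquiv.of_common {f g : ℝ → ℝ} (hf : ∀ x, 0 ≤ f x) (hP : ∀ᶠ x in atTop, P x ≠ 0)
    (hk0 : k ≠ 0) (hk : k ≠ ⊤)
    (hf1 : EvLe P (fun x => ENNReal.ofReal (f x)) k)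
    (hf2 : EvGe P (fun x => ENNReal.ofReal (f x)) k)
    (hg1 : EvLe P (fun x => ENNReal.ofReal (g x)) k)
    (hg2 : EvGe P (fun x => ENNReal.ofReal (g x)) k) : AsympEquiv f g := by
  have hkk := ENNReal.mul_inv_cancel hk0 hk
  have hki : k⁻¹ ≠ ⊤ := by simpa using hk0
  refine AsympEquiv.of_ev hf ?_ ?_ ?_
  · obtain ⟨l, hl0, hl⟩ := exists_between (pos_iff_ne_zero.2 hk0)
    filter_upwards [hg2 l hl, hP] with x h1 h2
    have : 0 < l * P x := pos_iff_ne_zero.2 (mul_ne_zero hl0.ne' h2)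
    exact ENNReal.ofReal_pos.1 (this.trans_le h1)
  · exact hkk ▸ hf1.trans hg2.inv hk hki
  · have := (hg1.trans hf2.inv hk hki).inv
    rwa [hkk, inv_one] at this

end

section

/-! ### Cells, size-biasing and convolution -/

/-- The mass of `(x, x + c]`. -/
def cell (m : Measure ℝ) (c x : ℝ) : ℝ≥0∞ := m (Set.Ioc x (x + c))

/-- The measure `x m(dx)`, restricted to the positive half line. -/
def sb (m : Measure ℝ) : Measure ℝ := m.withDensity (fun x => ENNReal.ofReal x)

instance sb_sFinite (m : Measure ℝ) [SFinite m] : SFinite (sb m) := by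
  unfold sb; infer_instance

variable {m n m₀ m₁ m₂ σ : Measure ℝ}

theorem conv_apply' (m₁ m₂ : Measure ℝ) [SFinite m₂] {s : Set ℝ} (hs : MeasurableSet s) :
    (m₁ ∗ m₂) s = ∫⁻ y, m₂ ((fun z => y + z) ⁻¹' s) ∂m₁ := by
  rw [← lintegral_indicator_one hs, Measure.lintegral_conv (measurable_one.indicator hs)]
  refine lintegral_congr fun y => ?_
  rw [← lintegral_indicator_one (hs.preimage (measurable_const_add y))]
  rfl

theorem cell_conv (m₁ m₂ : Measure ℝ) [SFinite m₂] (c x : ℝ) :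
    cell (m₁ ∗ m₂) c x = ∫⁻ y, cell m₂ c (x - y) ∂m₁ := by
  rw [cell, conv_apply' _ _ measurableSet_Ioc]
  refine lintegral_congr fun y => ?_
  rw [cell]
  congr 1
  ext z
  simp only [Set.mem_preimage, Set.mem_Ioc]
  constructor <;> rintro ⟨h1, h2⟩ <;> constructor <;> linarith

theorem measurable_cell (m : Measure ℝ) [SFinite m] (c : ℝ) : Measurable (cell m c) := by
  have hs : MeasurableSet {q : ℝ × ℝ | q.1 < q.2 ∧ q.2 ≤ q.1 + c} :=
    (measurableSet_lt measurable_fst measurable_snd).inter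
      (measurableSet_le measurable_snd (measurable_fst.add_const c))
  exact measurable_measure_prodMk_left hs

theorem cell_add_measure (m n : Measure ℝ) (c x : ℝ) :
    cell (m + n) c x = cell m c x + cell n c x := rfl

theorem cell_smul (k : ℝ≥0∞) (m : Measure ℝ) (c x : ℝ) : cell (k • m) c x = k * cell m c x := rfl

theorem cell_mono_measure (h : m ≤ n) (c x : ℝ) : cell m c x ≤ cell n c x := h _

theorem cell_mono {c d x y : ℝ} (m : Measure ℝ) (h1 : y ≤ x) (h2 : x + c ≤ y + d) :
    cell m c x ≤ cell m d y := measure_mono (Set.Ioc_subset_Ioc h1 h2)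

theorem cell_add (m : Measure ℝ) {c d : ℝ} (hc : 0 ≤ c) (hd : 0 ≤ d) (x : ℝ) :
    cell m (c + d) x = cell m c x + cell m d (x + c) := by
  rw [cell, cell, cell, ← measure_union (Set.Ioc_disjoint_Ioc_of_le le_rfl) measurableSet_Ioc,
    Set.Ioc_union_Ioc_eq_Ioc (by linarith) (by linarith), add_assoc]

theorem cell_zero (m : Measure ℝ) (x : ℝ) : cell m 0 x = 0 := by simp [cell]

theorem cell_eq_sum (m : Measure ℝ) {c : ℝ} (hc : 0 ≤ c) (N : ℕ) (x : ℝ) :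
    cell m (N * c) x = ∑ j ∈ Finset.range N, cell m c (x + j * c) := by
  induction N with
  | zero => simp [cell_zero]
  | succ N ih =>
    rw [Finset.sum_range_succ, ← ih, Nat.cast_succ, add_mul, one_mul,
      cell_add m (by positivity) hc]

theorem add_conv' (m₁ m₂ n : Measure ℝ) [SFinite m₁] [SFinite m₂] [SFinite n] :
    (m₁ + m₂) ∗ n = m₁ ∗ n + m₂ ∗ n := Measure.add_conv _ _ _

theorem conv_split (m₁ m₂ : Measure ℝ) [SFinite m₁] [SFinite m₂] (A : ℝ) :
    m₁ ∗ m₂ = m₁.restrict (Set.Iic A) ∗ m₂ + m₁.restrict (Set.Ioi A) ∗ m₂ := by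
  rw [← Measure.add_conv, ← Set.compl_Iic, Measure.restrict_add_restrict_compl measurableSet_Iic]

theorem ae_nonneg (h : m (Set.Iio 0) = 0) : ∀ᵐ y ∂m, 0 ≤ y := by
  rw [ae_iff]; simpa [Set.Iio] using h

theorem conv_null_Iio [SFinite m₂] (h1 : m₁ (Set.Iio 0) = 0) (h2 : m₂ (Set.Iio 0) = 0) :
    (m₁ ∗ m₂) (Set.Iio 0) = 0 := by
  rw [conv_apply' _ _ measurableSet_Iio, lintegral_eq_zero_iff']
  · filter_upwards [ae_nonneg h1] with y hy
    refine measure_mono_null (fun z hz => ?_) h2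
    simp only [Set.mem_preimage, Set.mem_Iio] at hz ⊢
    linarith
  · have hs : MeasurableSet {q : ℝ × ℝ | q.1 + q.2 < 0} :=
      measurableSet_lt (by fun_prop) measurable_const
    exact (measurable_measure_prodMk_left hs).aemeasurable

theorem conv_mono [SFinite m₁] [SFinite m₂] [SFinite σ] (h : m₁ ≤ m₂) : m₁ ∗ σ ≤ m₂ ∗ σ := by
  refine Measure.le_iff.2 fun s hs => ?_
  rw [conv_apply' _ _ hs, conv_apply' _ _ hs]
  exact lintegral_mono' h le_rfl

theorem conv_univ [SFinite m₂] : (m₁ ∗ m₂) Set.univ = m₁ Set.univ * m₂ Set.univ := by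
  rw [conv_apply' _ _ MeasurableSet.univ]
  simp [mul_comm]

theorem lintegral_sb (m : Measure ℝ) {f : ℝ → ℝ≥0∞} (hf : Measurable f) :
    ∫⁻ x, f x ∂(sb m) = ∫⁻ x, ENNReal.ofReal x * f x ∂m :=
  lintegral_withDensity_eq_lintegral_mul _ ENNReal.measurable_ofReal hf

/-- Size-biasing is a derivation of the convolution algebra on the half line, because the weight of
`x + y` is the sum of the weights of `x` and `y` when both are nonnegative. -/
theorem sb_conv [SFinite m₁] [SFinite m₂] (h1 : m₁ (Set.Iio 0) = 0) (h2 : m₂ (Set.Iio 0) = 0) :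
    sb (m₁ ∗ m₂) = sb m₁ ∗ m₂ + m₁ ∗ sb m₂ := by
  refine Measure.ext_of_lintegral _ fun f hf => ?_
  have hof : Measurable ENNReal.ofReal := ENNReal.measurable_ofReal
  rw [lintegral_sb _ hf, Measure.lintegral_conv (by fun_prop), lintegral_add_measure,
    Measure.lintegral_conv hf, Measure.lintegral_conv hf, lintegral_sb _ (by fun_prop),
    ← lintegral_add_left (by fun_prop)]
  refine lintegral_congr_ae ?_
  filter_upwards [ae_nonneg h1] with x hx
  rw [lintegral_sb _ (by fun_prop), ← lintegral_const_mul _ (by fun_prop),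
    ← lintegral_add_left (by fun_prop)]
  refine lintegral_congr_ae ?_
  filter_upwards [ae_nonneg h2] with y hy
  rw [ENNReal.ofReal_add hx hy, add_mul]

theorem sb_restrict (m : Measure ℝ) {s : Set ℝ} (hs : MeasurableSet s) :
    (sb m).restrict s = sb (m.restrict s) := restrict_withDensity hs _

theorem sb_smul (k : ℝ≥0∞) (m : Measure ℝ) : sb (k • m) = k • sb m := withDensity_smul_measure _ _

theorem sb_apply (m : Measure ℝ) {s : Set ℝ} (hs : MeasurableSet s) :
    sb m s = ∫⁻ x in s, ENNReal.ofReal x ∂m := withDensity_apply _ hs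

theorem sb_null_Iio (m : Measure ℝ) : sb m (Set.Iio 0) = 0 := by
  rw [sb_apply _ measurableSet_Iio, setLIntegral_congr_fun (g := fun _ => 0) measurableSet_Iio]
  · simp
  · intro x hx
    exact ENNReal.ofReal_of_nonpos (le_of_lt hx)

theorem cell_sb_le (m : Measure ℝ) (c x : ℝ) :
    cell (sb m) c x ≤ ENNReal.ofReal (x + c) * cell m c x := by
  rw [cell, sb_apply _ measurableSet_Ioc, cell, ← setLIntegral_const]
  exact setLIntegral_mono measurable_const fun y hy => ENNReal.ofReal_le_ofReal hy.2

theorem le_cell_sb (m : Measure ℝ) (c x : ℝ) :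
    ENNReal.ofReal x * cell m c x ≤ cell (sb m) c x := by
  rw [cell, cell, sb_apply _ measurableSet_Ioc, ← setLIntegral_const]
  exact setLIntegral_mono ENNReal.measurable_ofReal fun y hy => ENNReal.ofReal_le_ofReal hy.1.le

theorem sb_Iic_ne_top (m : Measure ℝ) [IsFiniteMeasure m] (A : ℝ) : sb m (Set.Iic A) ≠ ⊤ := by
  rw [sb_apply _ measurableSet_Iic]
  have h : ∫⁻ x in Set.Iic A, ENNReal.ofReal x ∂m ≤ ∫⁻ _ in Set.Iic A, ENNReal.ofReal A ∂m :=
    setLIntegral_mono measurable_const fun y hy => ENNReal.ofReal_le_ofReal hy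
  refine (h.trans_lt ?_).ne
  rw [setLIntegral_const]
  exact ENNReal.mul_lt_top ENNReal.ofReal_lt_top (measure_lt_top _ _)

theorem cell_conv_sb_le [SFinite m₂] (h1 : m₁ (Set.Iio 0) = 0) (c x : ℝ) :
    cell (m₁ ∗ sb m₂) c x ≤ ENNReal.ofReal (x + c) * cell (m₁ ∗ m₂) c x := by
  have hmeas := measurable_cell m₂ c
  rw [cell_conv, cell_conv, ← lintegral_const_mul _ (by fun_prop)]
  refine lintegral_mono_ae ?_
  filter_upwards [ae_nonneg h1] with y hy
  refine (cell_sb_le _ _ _).trans ?_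
  gcongr
  linarith

/-! ### Transfer of bounds through convolutions -/

/-- A window of length `d` is covered by whole cells of length `c`, which overshoot by at most `c`;
hence the longer window on the right. -/
theorem cell_le_of_cell_le {c d : ℝ} (hc : 0 < c) (hd : 0 ≤ d) {K : ℝ≥0∞}
    (h : ∀ y, cell m c y ≤ K * cell n c y) (x : ℝ) : cell m d x ≤ K * cell n (d + c) x := by
  set N := ⌈d / c⌉₊
  have h1 : d ≤ N * c := (div_le_iff₀ hc).1 (Nat.le_ceil _)
  have h2 : N * c ≤ d + c := by
    have := (Nat.ceil_lt_add_one (div_nonneg hd hc.le)).le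
    calc N * c ≤ (d / c + 1) * c := by gcongr
      _ = d + c := by field_simp
  calc cell m d x ≤ cell m (N * c) x := cell_mono _ le_rfl (by linarith)
    _ ≤ K * cell n (N * c) x := by
        rw [cell_eq_sum _ hc.le, cell_eq_sum _ hc.le, Finset.mul_sum]
        exact Finset.sum_le_sum fun j _ => h _
    _ ≤ _ := by gcongr; exact cell_mono _ le_rfl (by linarith)

theorem cell_conv_le_of_cell_le [SFinite m] [SFinite n] [SFinite σ] {c d : ℝ} (hc : 0 < c)
    (hd : 0 ≤ d) {K : ℝ≥0∞} (h : ∀ y, cell m c y ≤ K * cell n c y) (x : ℝ) :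
    cell (m ∗ σ) d x ≤ K * cell (n ∗ σ) (d + c) x := by
  rw [Measure.conv_comm m, Measure.conv_comm n, cell_conv, cell_conv]
  have := measurable_cell n (d + c)
  rw [← lintegral_const_mul _ (by fun_prop)]
  exact lintegral_mono fun y => cell_le_of_cell_le hc hd h _

/-- Cells straddling `B` begin as far left as `B - c`, so the comparison measure must be kept on
that extra stretch. -/
theorem cell_restrict_le {c B : ℝ} {K : ℝ≥0∞} (h : ∀ y, B - c ≤ y → cell m c y ≤ K * cell n c y)
    (y : ℝ) : cell (m.restrict (Set.Ioi B)) c y ≤ K * cell (n.restrict (Set.Ioi (B - c))) c y := by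
  rcases le_or_gt (B - c) y with hy | hy
  · refine (cell_mono_measure Measure.restrict_le_self c y).trans ((h y hy).trans ?_)
    rw [cell, cell, Measure.restrict_eq_self]
    exact fun z hz => hy.trans_lt hz.1
  · rw [cell, Measure.restrict_apply measurableSet_Ioc]
    have : Set.Ioc y (y + c) ∩ Set.Ioi B = ∅ := by
      ext z; simp only [Set.mem_inter_iff, Set.mem_Ioc, Set.mem_Ioi, Set.mem_empty_iff_false,
        iff_false]
      rintro ⟨⟨-, h1⟩, h2⟩; linarith
    simp [this]

/-! ### Convolution with compactly supported measures -/

variable {P u v : ℝ → ℝ≥0∞} {k l a b : ℝ≥0∞}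

/-- Bounded shifts do not change `P` asymptotically, uniformly in the shift, so averaging over them
only contributes the total mass of `τ`. -/
theorem EvLe.lintegral_sub (hP : LongTailRef P) {τ : Measure ℝ} [IsFiniteMeasure τ] {A : ℝ}
    (hτ : ∀ᵐ y ∂τ, |y| ≤ A) (h : EvLe P u k) :
    EvLe P (fun x => ∫⁻ y, u (x - y) ∂τ) (τ Set.univ * k) := by
  intro k' hk'
  rcases eq_or_ne (τ Set.univ) 0 with h0 | h0
  · rw [Measure.measure_univ_eq_zero] at h0
    subst h0
    simp
  have hfin : τ Set.univ ≠ ⊤ := measure_ne_top _ _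
  have hkc : k < k' / τ Set.univ := by
    rw [ENNReal.lt_div_iff_mul_lt (Or.inl h0) (Or.inl hfin), mul_comm]; exact hk'
  obtain ⟨l, hl, hlk⟩ := exists_between hkc
  obtain ⟨r, hr, -, hrl⟩ := exists_one_lt_mul_lt hlk
  obtain ⟨X, hX⟩ := eventually_atTop.1 (h l hl)
  filter_upwards [hP.shift A r hr, eventually_ge_atTop (X + A)] with x h1 h2
  calc ∫⁻ y, u (x - y) ∂τ ≤ ∫⁻ _, r * l * P x ∂τ := by
        refine lintegral_mono_ae ?_
        filter_upwards [hτ] with y hy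
        calc u (x - y) ≤ l * P (x - y) := hX _ (by linarith [le_of_abs_le hy])
          _ ≤ l * (r * P x) := by
              gcongr; rw [sub_eq_add_neg]; exact h1 (-y) (by rwa [abs_neg])
          _ = r * l * P x := by ring
    _ = τ Set.univ * (r * l) * P x := by rw [lintegral_const]; ring
    _ ≤ τ Set.univ * (k' / τ Set.univ) * P x := by gcongr
    _ = k' * P x := by rw [ENNReal.mul_div_cancel h0 hfin]

theorem EvGe.lintegral_sub (hP : LongTailRef P) {τ : Measure ℝ} [IsFiniteMeasure τ] {A : ℝ}
    (hτ : ∀ᵐ y ∂τ, |y| ≤ A) (h : EvGe P u k) :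
    EvGe P (fun x => ∫⁻ y, u (x - y) ∂τ) (τ Set.univ * k) := by
  intro k' hk'
  rcases eq_or_ne (τ Set.univ) 0 with h0 | h0
  · simp [h0] at hk'
  have hfin : τ Set.univ ≠ ⊤ := measure_ne_top _ _
  have hkc : k' / τ Set.univ < k := by
    rw [ENNReal.div_lt_iff (Or.inl h0) (Or.inl hfin), mul_comm]; exact hk'
  obtain ⟨r, hr, -, hrl⟩ := exists_one_lt_mul_lt hkc
  obtain ⟨X, hX⟩ := eventually_atTop.1 (h _ hrl)
  filter_upwards [hP.shift_ge A hr, eventually_ge_atTop (X + A)] with x h1 h2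
  calc k' * P x = ∫⁻ _, k' / τ Set.univ * P x ∂τ := by
        rw [lintegral_const, mul_comm _ (τ Set.univ), ← mul_assoc,
          ENNReal.mul_div_cancel h0 hfin]
    _ ≤ ∫⁻ y, u (x - y) ∂τ := by
        refine lintegral_mono_ae ?_
        filter_upwards [hτ] with y hy
        calc k' / τ Set.univ * P x ≤ k' / τ Set.univ * (r * P (x - y)) := by
              gcongr; rw [sub_eq_add_neg]; exact h1 (-y) (by rwa [abs_neg])
          _ = r * (k' / τ Set.univ) * P (x - y) := by ring
          _ ≤ _ := hX _ (by linarith [le_of_abs_le hy])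

theorem EvLe.conv_of_bounded (hP : LongTailRef P) {τ : Measure ℝ} [IsFiniteMeasure τ] [SFinite m]
    {A c : ℝ} (hτ : ∀ᵐ y ∂τ, |y| ≤ A) (h : EvLe P (cell m c) k) :
    EvLe P (cell (τ ∗ m) c) (τ Set.univ * k) := by
  have := h.lintegral_sub hP hτ
  simp_rw [← cell_conv] at this
  exact this

theorem EvGe.conv_of_bounded (hP : LongTailRef P) {τ : Measure ℝ} [IsFiniteMeasure τ] [SFinite m]
    {A c : ℝ} (hτ : ∀ᵐ y ∂τ, |y| ≤ A) (h : EvGe P (cell m c) k) :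
    EvGe P (cell (τ ∗ m) c) (τ Set.univ * k) := by
  have := h.lintegral_sub hP hτ
  simp_rw [← cell_conv] at this
  exact this

theorem ae_abs_le_restrict {τ : Measure ℝ} (h : τ (Set.Iio 0) = 0) (A : ℝ) :
    ∀ᵐ y ∂(τ.restrict (Set.Iic A)), |y| ≤ A := by
  have h0 : ∀ᵐ y ∂(τ.restrict (Set.Iic A)), 0 ≤ y := ae_restrict_of_ae (ae_nonneg h)
  filter_upwards [h0, ae_restrict_mem measurableSet_Iic] with y h1 h2
  rw [abs_of_nonneg h1]; exact h2

/-- Lower bounds survive convolution without any subexponentiality: truncate `τ` to a bounded set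
carrying almost all its mass and discard the rest. Only upper bounds need control of large summands.
-/
theorem EvGe.conv (hP : LongTailRef P) {τ : Measure ℝ} [IsFiniteMeasure τ] [SFinite m]
    (hτ : τ (Set.Iio 0) = 0) {c : ℝ} (h : EvGe P (cell m c) k) :
    EvGe P (cell (τ ∗ m) c) (τ Set.univ * k) := by
  intro k' hk'
  have hk0 : k ≠ 0 := fun h0 => by simp [h0] at hk'
  have hlim : Tendsto (fun A : ℝ => τ (Set.Iic A) * k) atTop (𝓝 (τ Set.univ * k)) :=
    ENNReal.Tendsto.mul_const (tendsto_measure_Iic_atTop τ) (by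
      by_cases h0 : τ Set.univ = 0
      · right
        rintro rfl
        simp [h0] at hk'
      · exact Or.inl h0)
  obtain ⟨A, hA⟩ := (hlim.eventually_const_lt hk').exists
  have := h.conv_of_bounded hP (ae_abs_le_restrict hτ A)
  rw [Measure.restrict_apply_univ] at this
  filter_upwards [this k' hA] with x hx
  rw [conv_split τ m A, cell_add_measure]
  exact hx.trans le_self_add

/-! ### Comparison of `m` and `x m(dx)` -/

theorem EvLe.cell_of_one (hP : LongTailRef P) (h : EvLe P (cell m 1) k) (N : ℕ) {c : ℝ}
    (hc : c ≤ N) : EvLe P (cell m c) (N * k) := by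
  have key : ∀ N : ℕ, EvLe P (cell m N) (N * k) := fun N => by
    induction N with
    | zero => exact EvLe.of_eventually (by simp [cell_zero])
    | succ N ih =>
      have h1 := ih.add (h.shift hP N)
      refine h1.mono (Eventually.of_forall fun x => ?_) (by push_cast; rw [add_mul, one_mul])
      rw [Nat.cast_succ, cell_add m (by positivity) zero_le_one]
  exact (key N).mono (Eventually.of_forall fun x => cell_mono _ le_rfl (by linarith)) le_rfl

/-- On `(x, x + c]` the weight lies between `x` and `x + c`, whose ratio tends to `1`; passing to
the size-biased measure and back therefore preserves the constant. -/
theorem EvLe.sizeBias {c : ℝ} (h : EvLe P (cell m c) k) :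
    EvLe (fun x => ENNReal.ofReal x * P x) (cell (sb m) c) k := by
  intro k' hk'
  obtain ⟨l, hl, hlk⟩ := exists_between hk'
  obtain ⟨q, hq1, hqt, hqr⟩ := exists_one_lt_mul_lt hlk
  have hq' : 1 < q.toReal := by
    rw [← ENNReal.toReal_one]; exact (ENNReal.toReal_lt_toReal (by simp) hqt).2 hq1
  filter_upwards [h l hl, eventually_ge_atTop (c / (q.toReal - 1))] with x h1 h2
  have h3 : x + c ≤ q.toReal * x := by
    have := (div_le_iff₀ (by linarith)).1 h2
    nlinarith
  calc cell (sb m) c x ≤ ENNReal.ofReal (q.toReal * x) * (l * P x) :=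
        (cell_sb_le _ _ _).trans (by gcongr)
    _ = q * l * (ENNReal.ofReal x * P x) := by
        rw [ENNReal.ofReal_mul (by linarith), ENNReal.ofReal_toReal hqt]; ring
    _ ≤ _ := by gcongr

theorem EvGe.sizeBias {c : ℝ} (h : EvGe P (cell m c) k) :
    EvGe (fun x => ENNReal.ofReal x * P x) (cell (sb m) c) k := by
  intro k' hk'
  filter_upwards [h k' hk'] with x h1
  calc k' * (ENNReal.ofReal x * P x) = ENNReal.ofReal x * (k' * P x) := by ring
    _ ≤ ENNReal.ofReal x * cell m c x := by gcongr
    _ ≤ _ := le_cell_sb _ _ _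

theorem EvLe.of_sb {c : ℝ} (h : EvLe (fun x => ENNReal.ofReal x * P x) (cell (sb m) c) k) :
    EvLe P (cell m c) k := by
  intro k' hk'
  filter_upwards [h k' hk', eventually_gt_atTop 0] with x h1 h2
  refine (ENNReal.mul_le_mul_iff_right (a := ENNReal.ofReal x) (by simpa using h2)
    ENNReal.ofReal_ne_top).1 ?_
  calc ENNReal.ofReal x * cell m c x ≤ cell (sb m) c x := le_cell_sb _ _ _
    _ ≤ _ := h1
    _ = _ := by ring

theorem EvGe.of_sb {c : ℝ} (h : EvGe (fun x => ENNReal.ofReal x * P x) (cell (sb m) c) k) :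
    EvGe P (cell m c) k := by
  intro k' hk'
  obtain ⟨q, hq1, hqt, hqr⟩ := exists_one_lt_mul_lt hk'
  have hq' : 1 < q.toReal := by
    rw [← ENNReal.toReal_one]; exact (ENNReal.toReal_lt_toReal (by simp) hqt).2 hq1
  filter_upwards [h _ hqr, eventually_ge_atTop (c / (q.toReal - 1)), eventually_gt_atTop 0]
    with x h1 h2 h0
  have h3 : x + c ≤ q.toReal * x := by
    have := (div_le_iff₀ (by linarith)).1 h2
    nlinarith
  have hne : ENNReal.ofReal (q.toReal * x) ≠ 0 := by
    exact (ENNReal.ofReal_pos.2 (by positivity)).ne'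
  refine (ENNReal.mul_le_mul_iff_right hne ENNReal.ofReal_ne_top).1 ?_
  calc ENNReal.ofReal (q.toReal * x) * (k' * P x) = q * k' * (ENNReal.ofReal x * P x) := by
        rw [ENNReal.ofReal_mul (by linarith), ENNReal.ofReal_toReal hqt]; ring
    _ ≤ _ := h1
    _ ≤ _ := (cell_sb_le _ _ _).trans (by gcongr)

/-- This is the gain from size-biasing: anything `O(P)` is `o(x P)`. -/
theorem EvLe.id_mul_zero (h : EvLe P u k) (hk : k ≠ ⊤) :
    EvLe (fun x => ENNReal.ofReal x * P x) u 0 := by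
  intro k' hk'
  have h1 := h (k + 1) (ENNReal.lt_add_right hk one_ne_zero)
  have h2 : ∀ᶠ x : ℝ in atTop, k + 1 ≤ k' * ENNReal.ofReal x := by
    have : Tendsto (fun x : ℝ => k' * ENNReal.ofReal x) atTop (𝓝 (k' * ⊤)) :=
      ENNReal.Tendsto.const_mul ENNReal.tendsto_ofReal_atTop (Or.inl (by simp))
    rw [ENNReal.mul_top hk'.ne'] at this
    exact this.eventually_const_le (by simp [hk.lt_top])
  filter_upwards [h1, h2] with x h1 h2
  calc u x ≤ (k + 1) * P x := h1
    _ ≤ k' * ENNReal.ofReal x * P x := by gcongr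
    _ = _ := by ring

end

section

/-! ### Negligibility of the middle part of a convolution -/

variable {m n m₀ m₁ m₂ σ : Measure ℝ} {P u v : ℝ → ℝ≥0∞} {k l a b : ℝ≥0∞}

/-- The cells of `m` are `O(P)`. -/
def Dominated (P : ℝ → ℝ≥0∞) (m : Measure ℝ) : Prop :=
  ∃ K : ℝ≥0∞, K ≠ ⊤ ∧ ∀ᶠ y in atTop, cell m 1 y ≤ K * P y

theorem EvLe.dominated (h : EvLe P (cell m 1) k) (hk : k ≠ ⊤) : Dominated P m :=
  ⟨k + 1, by simp [hk], h _ (ENNReal.lt_add_right hk one_ne_zero)⟩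

theorem Dominated.smul (h : Dominated P m) (hk : k ≠ ⊤) : Dominated P (k • m) := by
  obtain ⟨K, hK, h⟩ := h
  refine ⟨k * K, ENNReal.mul_ne_top hk hK, ?_⟩
  filter_upwards [h] with y hy
  rw [cell_smul, mul_assoc]
  gcongr

theorem Dominated.mono (h : Dominated P n) (hmn : m ≤ n) : Dominated P m := by
  obtain ⟨K, hK, h⟩ := h
  exact ⟨K, hK, h.mono fun y hy => (cell_mono_measure hmn _ _).trans hy⟩

/-- `P` is long-tailed and the part of `m₀ ∗ m₀` where both summands are large is negligible with
respect to `P`, while `P` is dominated by the cells of `m₀`. -/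
structure SubexpRef (P : ℝ → ℝ≥0∞) (m₀ : Measure ℝ) : Prop where
  longTail : LongTailRef P
  small : ∀ ε : ℝ≥0∞, ε ≠ 0 → ∃ A : ℝ, ∀ᶠ x in atTop,
    cell (m₀.restrict (Set.Ioi A) ∗ m₀.restrict (Set.Ioi A)) 1 x ≤ ε * P x
  lower : ∃ K : ℝ≥0∞, K ≠ ⊤ ∧ ∀ᶠ y in atTop, P y ≤ K * cell m₀ 1 y

theorem cell_le_of_forall_ge (hP : LongTailRef P) {A : ℝ} (c : ℝ) :
    ∃ N : ℕ, ∃ X : ℝ, ∀ K : ℝ≥0∞, ∀ m : Measure ℝ,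
      (∀ y, A ≤ y → cell m 1 y ≤ K * P y) →
      ∀ x, X ≤ x → ∀ y, |y| ≤ |A| + 1 → cell m c (x - y) ≤ K * N * P x := by
  set N := ⌈c⌉₊
  obtain ⟨X, hX⟩ := eventually_atTop.1 (hP.shift (N + |A| + 1) 2 (by norm_num))
  refine ⟨2 * N, max X (2 * |A| + 1), fun K m h x hx y hy => ?_⟩
  have hxX : X ≤ x := (le_max_left _ _).trans hx
  have hxA : 2 * |A| + 1 ≤ x := (le_max_right _ _).trans hx
  calc cell m c (x - y) ≤ cell m (N * 1) (x - y) :=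
        cell_mono _ le_rfl (by have := Nat.le_ceil c; linarith)
    _ = ∑ j ∈ Finset.range N, cell m 1 (x - y + j * 1) := cell_eq_sum _ zero_le_one _ _
    _ ≤ ∑ j ∈ Finset.range N, K * (2 * P x) := by
        refine Finset.sum_le_sum fun j hj => ?_
        have hj' : (j : ℝ) ≤ N := by exact_mod_cast (Finset.mem_range.1 hj).le
        have h0 : (0 : ℝ) ≤ j := by positivity
        have h1 := abs_le.1 hy
        have h2 := le_abs_self A
        refine (h _ (by linarith)).trans ?_
        gcongr
        rw [show x - y + (j : ℝ) * 1 = x + (j - y) by ring]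
        exact hX x hxX (j - y) (by rw [abs_le]; constructor <;> linarith [abs_nonneg A])
    _ = K * (2 * N : ℕ) * P x := by
        rw [Finset.sum_const, Finset.card_range, nsmul_eq_mul]; push_cast; ring

/-- Split `m₂` at `A`. Where both factors are large, the weight is at most `x + c` and cell
comparison reduces to the square of the tail of `m₀`; where the second factor is small, its weighted
mass is finite and the contribution is `O(P)`. The threshold `X` is chosen before `K` and `m₁`: the
bootstrap in `SubexpRef.dominated_of_sb_eq` applies the estimate to varying truncations and
constants at one fixed threshold. -/
theorem SubexpRef.mid (hS : SubexpRef P m₀) [SFinite m₀] [SFinite m₂] (h2 : Dominated P m₂)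
    (hfin : ∀ A, sb m₂ (Set.Iic A) ≠ ⊤) (c : ℝ) {ε : ℝ≥0∞} (hε : ε ≠ 0) :
    ∃ A₀ : ℝ, ∀ A, A₀ ≤ A → ∃ X : ℝ, ∀ K : ℝ≥0∞, ∀ m₁ : Measure ℝ, SFinite m₁ →
      (∀ y, A - 1 ≤ y → cell m₁ 1 y ≤ K * P y) → ∀ x, X ≤ x →
      cell (m₁.restrict (Set.Ioi A) ∗ sb m₂) c x ≤ K * ε * (ENNReal.ofReal x * P x) := by
  wlog hc : 0 ≤ c generalizing c
  · obtain ⟨A₀, h⟩ := this 0 le_rfl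
    refine ⟨A₀, fun A hA => ?_⟩
    obtain ⟨X, h⟩ := h A hA
    refine ⟨X, fun K m₁ _ hm x hx => ?_⟩
    exact (cell_mono _ le_rfl (by linarith)).trans (h K m₁ ‹_› hm x hx)
  have hP := hS.longTail
  obtain ⟨K₀, hK₀, hlow⟩ := hS.lower
  obtain ⟨K₂, hK₂, h2⟩ := h2
  obtain ⟨Y, hY⟩ := eventually_atTop.1 (hlow.and h2)
  -- Replacing each of the two factors by a multiple of `m₀` on unit cells lengthens the window by
  -- `1`, whence `c + 2`.
  set N := ⌈c + 2⌉₊ with hN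
  have hNc : c + 2 ≤ N := Nat.le_ceil _
  -- The factor `2` absorbs `x + c ≤ 2 x`, the factors `K₀` and `K₂ * K₀` come from the two cell
  -- comparisons, and `N + 1` from covering the window by unit cells with some slack.
  set D : ℝ≥0∞ := 2 * (K₀ * (K₂ * K₀) * (N + 1)) with hD
  have hDtop : D ≠ ⊤ := by
    simp only [hD]
    finiteness
  obtain ⟨ε', hε'0, hε'top, hε'⟩ : ∃ ε' : ℝ≥0∞, ε' ≠ 0 ∧ ε' ≠ ⊤ ∧ D * ε' ≤ ε / 2 := by
    have hlim : Tendsto (fun e : ℝ≥0∞ => D * e) (𝓝[>] 0) (𝓝 (D * 0)) :=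
      (ENNReal.Tendsto.const_mul tendsto_id (Or.inr hDtop)).mono_left nhdsWithin_le_nhds
    rw [mul_zero] at hlim
    have hpos : 0 < ε / 2 := ENNReal.div_pos hε (by simp)
    have h3 : ∀ᶠ e : ℝ≥0∞ in 𝓝[>] 0, e < ⊤ := nhdsWithin_le_nhds (Iio_mem_nhds (by simp))
    obtain ⟨e, h1, h2, h3⟩ :=
      ((hlim.eventually_le_const hpos).and (eventually_mem_nhdsWithin.and h3)).exists
    exact ⟨e, (show 0 < e from h2).ne', h3.ne, h1⟩
  obtain ⟨A₁, hA₁⟩ := hS.small ε' hε'0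
  refine ⟨max (A₁ + 1) (max (Y + 1) 0), fun A hA => ?_⟩
  have hAA₁ : A₁ ≤ A - 1 := by linarith [(le_max_left _ _).trans hA]
  have hAY : Y ≤ A - 1 := by
    linarith [(le_max_left _ _).trans ((le_max_right (A₁ + 1) (max (Y + 1) 0)).trans hA)]
  have hA0 : 0 ≤ A := (le_max_right _ _).trans ((le_max_right (A₁ + 1) (max (Y + 1) 0)).trans hA)
  set n₀ := m₀.restrict (Set.Ioi (A - 1)) with hn₀
  have hsmall : EvLe P (cell (n₀ ∗ n₀) (c + 2)) (N * ε') := by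
    refine EvLe.cell_of_one hP (EvLe.of_eventually ?_) N hNc
    have hle : n₀ ≤ m₀.restrict (Set.Ioi A₁) :=
      Measure.restrict_mono_set _ (Set.Ioi_subset_Ioi hAA₁)
    filter_upwards [hA₁] with x hx
    refine le_trans (cell_mono_measure ?_ 1 x) hx
    refine (conv_mono hle).trans ?_
    rw [Measure.conv_comm _ n₀]
    exact conv_mono hle
  have hsmall' := hsmall (N * ε' + ε') (ENNReal.lt_add_right (by finiteness) hε'0)
  obtain ⟨N', X', hN'⟩ := cell_le_of_forall_ge hP (A := A - 1) c
  have htail : ∀ᶠ x : ℝ in atTop, N' * sb m₂ (Set.Iic A) ≤ ε / 2 * ENNReal.ofReal x := by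
    have : Tendsto (fun x : ℝ => ε / 2 * ENNReal.ofReal x) atTop (𝓝 (ε / 2 * ⊤)) :=
      ENNReal.Tendsto.const_mul ENNReal.tendsto_ofReal_atTop (Or.inl (by simp))
    rw [ENNReal.mul_top (by simp [hε])] at this
    refine this.eventually_const_le (ENNReal.mul_lt_top (by simp) (hfin A).lt_top)
  obtain ⟨X, hX⟩ := eventually_atTop.1 (hsmall'.and (htail.and (eventually_ge_atTop c)))
  refine ⟨max X X', fun K m₁ _ hm x hx => ?_⟩
  obtain ⟨hx1, hx2, hx3⟩ := hX x ((le_max_left _ _).trans hx)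
  have hxX' := (le_max_right _ _).trans hx
  set n₁ := m₁.restrict (Set.Ioi A) with hn₁
  have hn₁0 : n₁ (Set.Iio 0) = 0 := by
    rw [hn₁, Measure.restrict_apply measurableSet_Iio]
    refine measure_mono_null (t := ∅) ?_ (by simp)
    rintro z ⟨h1, h2⟩
    simp only [Set.mem_Iio, Set.mem_Ioi] at h1 h2
    linarith
  have hsplit : cell (n₁ ∗ sb m₂) c x = cell (n₁ ∗ sb (m₂.restrict (Set.Ioi A))) c x
      + cell (n₁ ∗ (sb m₂).restrict (Set.Iic A)) c x := by
    rw [← cell_add_measure, ← Measure.conv_add, ← sb_restrict _ measurableSet_Ioi, add_comm,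
      ← Set.compl_Iic, Measure.restrict_add_restrict_compl measurableSet_Iic]
  have hcell₁ : ∀ y, cell n₁ 1 y ≤ K * K₀ * cell n₀ 1 y :=
    cell_restrict_le fun y hy => (hm y hy).trans (by
      rw [mul_assoc]; gcongr; exact (hY y (by linarith)).1)
  have hcell₂ : ∀ y, cell (m₂.restrict (Set.Ioi A)) 1 y ≤ K₂ * K₀ * cell n₀ 1 y :=
    cell_restrict_le fun y hy => ((hY y (by linarith)).2).trans (by
      rw [mul_assoc]; gcongr; exact (hY y (by linarith)).1)
  have hpart1 : cell (n₁ ∗ sb (m₂.restrict (Set.Ioi A))) c x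
      ≤ K * (ε / 2) * (ENNReal.ofReal x * P x) := by
    calc _ ≤ ENNReal.ofReal (x + c) * cell (n₁ ∗ m₂.restrict (Set.Ioi A)) c x :=
          cell_conv_sb_le hn₁0 _ _
      _ ≤ ENNReal.ofReal (2 * x) * (K * K₀ * (K₂ * K₀ * cell (n₀ ∗ n₀) (c + 1 + 1) x)) := by
          gcongr
          · linarith
          · refine (cell_conv_le_of_cell_le one_pos hc hcell₁ x).trans ?_
            gcongr
            rw [Measure.conv_comm n₀]
            exact cell_conv_le_of_cell_le one_pos (by linarith) hcell₂ x
      _ ≤ ENNReal.ofReal (2 * x) * (K * K₀ * (K₂ * K₀ * ((N * ε' + ε') * P x))) := by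
          gcongr
          rw [show c + 1 + 1 = c + 2 by ring]
          exact hx1
      _ = K * (D * ε') * (ENNReal.ofReal x * P x) := by
          rw [ENNReal.ofReal_mul (by norm_num), hD]
          simp only [ENNReal.ofReal_ofNat]
          ring
      _ ≤ _ := by gcongr
  have hpart2 : cell (n₁ ∗ (sb m₂).restrict (Set.Iic A)) c x
      ≤ K * (ε / 2) * (ENNReal.ofReal x * P x) := by
    rw [Measure.conv_comm, cell_conv]
    calc ∫⁻ y, cell n₁ c (x - y) ∂((sb m₂).restrict (Set.Iic A))
        ≤ ∫⁻ _, K * N' * P x ∂((sb m₂).restrict (Set.Iic A)) := by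
          refine lintegral_mono_ae ?_
          filter_upwards [ae_abs_le_restrict (sb_null_Iio m₂) A] with y hy
          refine (cell_mono_measure Measure.restrict_le_self _ _).trans
            (hN' K m₁ hm x hxX' y (hy.trans ?_))
          linarith [le_abs_self (A - 1)]
      _ = K * (N' * sb m₂ (Set.Iic A)) * P x := by
          rw [lintegral_const, Measure.restrict_apply_univ]; ring
      _ ≤ K * (ε / 2 * ENNReal.ofReal x) * P x := by gcongr
      _ = _ := by ring
  rw [hsplit]
  calc _ ≤ K * (ε / 2) * (ENNReal.ofReal x * P x) + K * (ε / 2) * (ENNReal.ofReal x * P x) :=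
        add_le_add hpart1 hpart2
    _ = K * (ε / 2 + ε / 2) * (ENNReal.ofReal x * P x) := by ring
    _ = _ := by rw [ENNReal.add_halves]

/-- The upper counterpart of `EvGe.conv`: the bounded part of `m₁` contributes its mass times `b`,
and the part beyond `A` is negligible by `SubexpRef.mid`. -/
theorem SubexpRef.conv_sb_evLe (hS : SubexpRef P m₀) [SFinite m₀] [IsFiniteMeasure m₁]
    [SFinite m₂] (h1 : Dominated P m₁) (h1' : m₁ (Set.Iio 0) = 0) (h2 : Dominated P m₂)
    (hfin : ∀ A, sb m₂ (Set.Iic A) ≠ ⊤) {c : ℝ} (hb : b ≠ ⊤)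
    (h : EvLe (fun x => ENNReal.ofReal x * P x) (cell (sb m₂) c) b) :
    EvLe (fun x => ENNReal.ofReal x * P x) (cell (m₁ ∗ sb m₂) c) (m₁ Set.univ * b) := by
  intro k' hk'
  obtain ⟨K, hK, h1⟩ := h1
  have hQ := hS.longTail.id_mul
  obtain ⟨r, hr, hlt⟩ := ENNReal.lt_iff_exists_add_pos_lt.1 hk'
  have hr2 : (r / 2 : ℝ≥0∞) ≠ 0 := by simp [hr.ne']
  set ε : ℝ≥0∞ := r / 2 / (K + 1) with hε
  have hε0 : ε ≠ 0 := by
    rw [hε]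
    exact (ENNReal.div_pos hr2 (by finiteness)).ne'
  have hKε : K * ε ≤ r / 2 := by
    calc K * ε ≤ (K + 1) * ε := by gcongr; exact le_self_add
      _ = r / 2 := ENNReal.mul_div_cancel (by simp) (by finiteness)
  obtain ⟨A₀, hA₀⟩ := hS.mid h2 hfin c hε0
  obtain ⟨Y, hY⟩ := eventually_atTop.1 h1
  obtain ⟨X, hX⟩ := hA₀ (max A₀ (Y + 1)) (le_max_left _ _)
  set A := max A₀ (Y + 1)
  have hAY : Y + 1 ≤ A := le_max_right _ _
  have hX' := hX K m₁ inferInstance fun y hy => hY y (by linarith)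
  have hlow := h.conv_of_bounded hQ (ae_abs_le_restrict h1' A)
  have hfin' : m₁ Set.univ * b ≠ ⊤ := ENNReal.mul_ne_top (measure_ne_top _ _) hb
  have hlt' : (m₁.restrict (Set.Iic A)) Set.univ * b < m₁ Set.univ * b + r / 2 := by
    refine lt_of_le_of_lt ?_ (ENNReal.lt_add_right hfin' hr2)
    gcongr
    exact Measure.restrict_le_self
  filter_upwards [hlow _ hlt', eventually_ge_atTop X] with x hx1 hx2
  rw [conv_split m₁ _ A, cell_add_measure]
  calc _ ≤ (m₁ Set.univ * b + r / 2) * (ENNReal.ofReal x * P x)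
        + K * ε * (ENNReal.ofReal x * P x) := add_le_add hx1 (hX' x hx2)
    _ = (m₁ Set.univ * b + (r / 2 + K * ε)) * (ENNReal.ofReal x * P x) := by ring
    _ ≤ (m₁ Set.univ * b + (r / 2 + r / 2)) * (ENNReal.ofReal x * P x) := by gcongr
    _ ≤ _ := by rw [ENNReal.add_halves]; gcongr

end

section

/-! ### Power series of a finite measure in the convolution algebra -/

variable {τ : Measure ℝ}

instance convPow_isFiniteMeasure (τ : Measure ℝ) [IsFiniteMeasure τ] (n : ℕ) :
    IsFiniteMeasure (convPow τ n) := by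
  induction n with
  | zero => rw [convPow]; infer_instance
  | succ n ih => rw [convPow]; infer_instance

theorem convPow_univ (τ : Measure ℝ) [IsFiniteMeasure τ] (n : ℕ) :
    convPow τ n Set.univ = τ Set.univ ^ n := by
  induction n with
  | zero => simp [convPow]
  | succ n ih => rw [convPow, conv_univ, ih, pow_succ]

theorem convPow_null_Iio [IsFiniteMeasure τ] (h : τ (Set.Iio 0) = 0) (n : ℕ) :
    convPow τ n (Set.Iio 0) = 0 := by
  induction n with
  | zero => simp [convPow]
  | succ n ih => rw [convPow]; exact conv_null_Iio ih h

theorem charFun_convPow (τ : Measure ℝ) [IsFiniteMeasure τ] (n : ℕ) (t : ℝ) :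
    charFun (convPow τ n) t = charFun τ t ^ n := by
  induction n with
  | zero => simp [convPow, charFun_dirac]
  | succ n ih => rw [convPow, charFun_conv, ih, pow_succ]

theorem sb_dirac_zero : sb (Measure.dirac 0) = 0 := by
  rw [← Measure.measure_univ_eq_zero, sb_apply _ MeasurableSet.univ]
  simp

/-- The power rule for the derivation of `sb_conv`. -/
theorem sb_convPow_succ [IsFiniteMeasure τ] (h : τ (Set.Iio 0) = 0) (n : ℕ) :
    sb (convPow τ (n + 1)) = ((n + 1 : ℕ) : ℝ≥0∞) • (convPow τ n ∗ sb τ) := by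
  induction n with
  | zero =>
    change sb (convPow τ 0 ∗ τ) = _
    rw [sb_conv (convPow_null_Iio h 0) h, convPow, sb_dirac_zero, Measure.zero_conv]
    simp
  | succ n ih =>
    change sb (convPow τ (n + 1) ∗ τ) = _
    rw [sb_conv (convPow_null_Iio h _) h, ih, Measure.conv_smul_left,
      Measure.conv_assoc, Measure.conv_comm (sb τ) τ, ← Measure.conv_assoc]
    change _ • (convPow τ (n + 1) ∗ sb τ) + _ = _
    rw [Nat.cast_succ (n + 1), add_smul, one_smul]

/-- The measure `∑ aₙ τ^{n*}`. -/
def convSeries (a : ℕ → ℝ) (τ : Measure ℝ) : Measure ℝ :=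
  Measure.sum fun n => ENNReal.ofReal (a n) • convPow τ n

theorem convSeries_null_Iio [IsFiniteMeasure τ] (h : τ (Set.Iio 0) = 0) (a : ℕ → ℝ) :
    convSeries a τ (Set.Iio 0) = 0 := by
  rw [convSeries, Measure.sum_apply _ measurableSet_Iio]
  simp [convPow_null_Iio h]

theorem convSeries_univ [IsFiniteMeasure τ] {a : ℕ → ℝ} (ha : ∀ n, 0 ≤ a n)
    (hs : Summable fun n => a n * τ.real Set.univ ^ n) :
    convSeries a τ Set.univ = ENNReal.ofReal (∑' n, a n * τ.real Set.univ ^ n) := by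
  rw [convSeries, Measure.sum_apply _ MeasurableSet.univ,
    ENNReal.ofReal_tsum_of_nonneg (fun n => mul_nonneg (ha n) (by positivity)) hs]
  refine tsum_congr fun n => ?_
  rw [Measure.smul_apply, convPow_univ, smul_eq_mul, ENNReal.ofReal_mul (ha n),
    ENNReal.ofReal_pow measureReal_nonneg, ofReal_measureReal]

theorem convSeries_isFiniteMeasure [IsFiniteMeasure τ] {a : ℕ → ℝ} (ha : ∀ n, 0 ≤ a n)
    (hs : Summable fun n => a n * τ.real Set.univ ^ n) : IsFiniteMeasure (convSeries a τ) :=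
  ⟨by rw [convSeries_univ ha hs]; exact ENNReal.ofReal_lt_top⟩

theorem hasSum_charFun_convSeries [IsFiniteMeasure τ] {a : ℕ → ℝ} (ha : ∀ n, 0 ≤ a n)
    (hs : Summable fun n => a n * τ.real Set.univ ^ n) (t : ℝ) :
    HasSum (fun n => (a n : ℂ) * charFun τ t ^ n) (charFun (convSeries a τ) t) := by
  have := convSeries_isFiniteMeasure ha hs
  have hint : Integrable (fun x : ℝ => Complex.exp (t * x * Complex.I)) (convSeries a τ) := by
    refine Integrable.mono' (integrable_const (1 : ℝ)) (by fun_prop) ?_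
    filter_upwards with x
    rw [← Complex.ofReal_mul, Complex.norm_exp_ofReal_mul_I]
  have h := hasSum_integral_measure hint
  rw [charFun_apply_real (μ := convSeries a τ)]
  refine h.congr_fun fun n => ?_
  rw [integral_smul_measure, ← charFun_apply_real, charFun_convPow,
    ENNReal.toReal_ofReal (ha n), Complex.real_smul]

theorem convSeries_le {a b : ℕ → ℝ} {C : ℝ} (hC : 0 ≤ C) (h : ∀ n, a n ≤ C * b n)
    (τ : Measure ℝ) : convSeries a τ ≤ ENNReal.ofReal C • convSeries b τ := by
  refine Measure.le_iff.2 fun s hs => ?_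
  rw [Measure.smul_apply, convSeries, convSeries, Measure.sum_apply _ hs, Measure.sum_apply _ hs,
    smul_eq_mul, ← ENNReal.tsum_mul_left]
  refine ENNReal.tsum_le_tsum fun n => ?_
  rw [Measure.smul_apply, Measure.smul_apply, smul_eq_mul, smul_eq_mul, ← mul_assoc,
    ← ENNReal.ofReal_mul hC]
  gcongr
  exact h n

theorem dirac_le_convSeries {a : ℕ → ℝ} {C : ℝ} (hC : 0 ≤ C) (h : 1 ≤ C * a 0) (τ : Measure ℝ) :
    Measure.dirac 0 ≤ ENNReal.ofReal C • convSeries a τ := by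
  refine Measure.le_iff.2 fun s hs => ?_
  rw [Measure.smul_apply, convSeries, Measure.sum_apply _ hs, smul_eq_mul]
  calc Measure.dirac 0 s ≤ ENNReal.ofReal (C * a 0) * Measure.dirac 0 s :=
        le_mul_of_one_le_left' (by simpa using h)
    _ = ENNReal.ofReal C * ((ENNReal.ofReal (a 0) • convPow τ 0) s) := by
        rw [ENNReal.ofReal_mul hC, mul_assoc]; rfl
    _ ≤ _ := by
        gcongr
        exact ENNReal.le_tsum 0

theorem sum_conv (m : ℕ → Measure ℝ) (σ : Measure ℝ) [SFinite σ] :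
    Measure.sum m ∗ σ = Measure.sum fun n => m n ∗ σ := by
  ext s hs
  rw [conv_apply' _ _ hs, lintegral_sum_measure, Measure.sum_apply _ hs]
  exact tsum_congr fun n => (conv_apply' _ _ hs).symm

/-! ### Compound Poisson distributions -/

/-- The coefficients of the compound Poisson distribution with total jump rate `M`. -/
def poissonCoeff (M : ℝ) (n : ℕ) : ℝ := Real.exp (-M) * (n.factorial : ℝ)⁻¹

theorem poissonCoeff_nonneg (M : ℝ) (n : ℕ) : 0 ≤ poissonCoeff M n := by
  unfold poissonCoeff; positivity

theorem summable_poissonCoeff_mul (M R : ℝ) : Summable fun n => poissonCoeff M n * R ^ n := by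
  refine ((Real.summable_pow_div_factorial R).mul_left (Real.exp (-M))).congr fun n => ?_
  rw [poissonCoeff]; ring

/-- The compound Poisson distribution with Lévy measure `τ`. -/
def compoundPoisson (τ : Measure ℝ) : Measure ℝ := convSeries (poissonCoeff (τ.real Set.univ)) τ

theorem charFun_compoundPoisson (τ : Measure ℝ) [IsFiniteMeasure τ] (t : ℝ) :
    charFun (compoundPoisson τ) t = Complex.exp (charFun τ t - τ.real Set.univ) := by
  have h1 := hasSum_charFun_convSeries (τ := τ) (poissonCoeff_nonneg (τ.real Set.univ))
    (summable_poissonCoeff_mul _ _) t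
  have h2 := (NormedSpace.expSeries_div_hasSum_exp (charFun τ t)).mul_left
    (Complex.exp (-(τ.real Set.univ)))
  rw [← Complex.exp_eq_exp_ℂ, ← Complex.exp_add] at h2
  rw [sub_eq_neg_add]
  refine h1.unique (h2.congr_fun fun n => ?_)
  rw [poissonCoeff]
  push_cast
  ring

instance compoundPoisson_isProbabilityMeasure (τ : Measure ℝ) [IsFiniteMeasure τ] :
    IsProbabilityMeasure (compoundPoisson τ) := by
  have : IsFiniteMeasure (compoundPoisson τ) :=
    convSeries_isFiniteMeasure (poissonCoeff_nonneg _) (summable_poissonCoeff_mul _ _)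
  have h := charFun_compoundPoisson τ 0
  rw [charFun_zero, charFun_zero, sub_self, Complex.exp_zero] at h
  have h' : (compoundPoisson τ).real Set.univ = 1 := by exact_mod_cast h
  refine ⟨?_⟩
  rw [← ofReal_measureReal, h', ENNReal.ofReal_one]

/-- Differentiation of the exponential series term by term: the constant term dies, and the factor
`n + 1` from the power rule turns `1 / (n + 1)!` into `1 / n!`. -/
theorem sb_compoundPoisson [IsFiniteMeasure τ] (h : τ (Set.Iio 0) = 0) :
    sb (compoundPoisson τ) = compoundPoisson τ ∗ sb τ := by
  rw [compoundPoisson, convSeries, sum_conv]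
  ext s hs
  rw [sb, withDensity_sum, Measure.sum_apply _ hs, Measure.sum_apply _ hs,
    tsum_eq_zero_add' ENNReal.summable]
  have h0 : (ENNReal.ofReal (poissonCoeff (τ.real Set.univ) 0) • convPow τ 0).withDensity
      (fun x => ENNReal.ofReal x) s = 0 := by
    change sb _ s = 0
    rw [sb_smul, convPow, sb_dirac_zero]
    simp
  rw [h0, zero_add]
  refine tsum_congr fun n => ?_
  change sb _ s = _
  rw [sb_smul, sb_convPow_succ h, Measure.conv_smul_left, Measure.smul_apply, Measure.smul_apply,
    Measure.smul_apply, smul_eq_mul, smul_eq_mul, smul_eq_mul, ← mul_assoc]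
  congr 1
  rw [← ENNReal.ofReal_natCast, ← ENNReal.ofReal_mul (poissonCoeff_nonneg _ _)]
  congr 1
  rw [poissonCoeff, poissonCoeff, Nat.factorial_succ]
  push_cast
  field_simp

/-- The inverse of a compound Poisson distribution in the convolution algebra of signed measures,
written as a difference of two measures. -/
theorem exists_compoundPoisson_inverse (τ : Measure ℝ) [IsFiniteMeasure τ] :
    ∃ (κ₁ κ₂ : Measure ℝ) (C : ℝ≥0∞), C ≠ ⊤ ∧ IsFiniteMeasure κ₁ ∧ IsFiniteMeasure κ₂ ∧
      κ₁ ∗ compoundPoisson τ = κ₂ ∗ compoundPoisson τ + Measure.dirac 0 ∧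
      κ₁ ≤ C • compoundPoisson τ ∧ κ₂ ≤ C • compoundPoisson τ ∧
      Measure.dirac 0 ≤ C • compoundPoisson τ := by
  set M := τ.real Set.univ with hM
  have hM0 : 0 ≤ M := measureReal_nonneg
  -- The inverse of `exp (τ - M)` is `exp (M - τ)`; its even terms are positive and its odd terms
  -- negative, so they give the two measures.
  let a₁ : ℕ → ℝ := fun n => if Even n then Real.exp M * (n.factorial : ℝ)⁻¹ else 0
  let a₂ : ℕ → ℝ := fun n => if Even n then 0 else Real.exp M * (n.factorial : ℝ)⁻¹
  have hb : ∀ n : ℕ, 0 ≤ Real.exp M * (n.factorial : ℝ)⁻¹ := fun n => by positivity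
  have h10 : ∀ n, 0 ≤ a₁ n := fun n => by
    simp only [a₁]; split_ifs; exacts [hb n, le_rfl]
  have h20 : ∀ n, 0 ≤ a₂ n := fun n => by
    simp only [a₂]; split_ifs; exacts [le_rfl, hb n]
  -- Coefficientwise, the inverse differs from the compound Poisson series only by signs and the
  -- factor `exp (2 * M)`, which yields all the domination claims.
  have hC : ∀ n : ℕ, Real.exp (2 * M) * poissonCoeff M n = Real.exp M * (n.factorial : ℝ)⁻¹ :=
    fun n => by
      rw [poissonCoeff, ← mul_assoc, ← Real.exp_add]
      congr 2
      ring
  have h1 : ∀ n, a₁ n ≤ Real.exp (2 * M) * poissonCoeff M n := fun n => by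
    rw [hC]; simp only [a₁]; split_ifs; exacts [le_rfl, hb n]
  have h2 : ∀ n, a₂ n ≤ Real.exp (2 * M) * poissonCoeff M n := fun n => by
    rw [hC]; simp only [a₂]; split_ifs; exacts [hb n, le_rfl]
  have hs := (summable_poissonCoeff_mul M M).mul_left (Real.exp (2 * M))
  have hs1 : Summable fun n => a₁ n * M ^ n := hs.of_nonneg_of_le
    (fun n => mul_nonneg (h10 n) (by positivity))
    (fun n => by rw [← mul_assoc]; gcongr; exact h1 n)
  have hs2 : Summable fun n => a₂ n * M ^ n := hs.of_nonneg_of_le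
    (fun n => mul_nonneg (h20 n) (by positivity))
    (fun n => by rw [← mul_assoc]; gcongr; exact h2 n)
  have hf1 := convSeries_isFiniteMeasure h10 hs1
  have hf2 := convSeries_isFiniteMeasure h20 hs2
  refine ⟨convSeries a₁ τ, convSeries a₂ τ, ENNReal.ofReal (Real.exp (2 * M)),
    ENNReal.ofReal_ne_top, hf1, hf2, ?_, convSeries_le (by positivity) h1 τ,
    convSeries_le (by positivity) h2 τ, dirac_le_convSeries (by positivity) ?_ τ⟩
  · refine Measure.ext_of_charFun (funext fun t => ?_)
    have hdiff : charFun (convSeries a₁ τ) t - charFun (convSeries a₂ τ) t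
        = Complex.exp (M - charFun τ t) := by
      have h3 := (hasSum_charFun_convSeries h10 hs1 t).sub (hasSum_charFun_convSeries h20 hs2 t)
      have h4 := (NormedSpace.expSeries_div_hasSum_exp (-charFun τ t)).mul_left (Complex.exp M)
      rw [← Complex.exp_eq_exp_ℂ, ← Complex.exp_add, ← sub_eq_add_neg] at h4
      refine h3.unique (h4.congr_fun fun n => ?_)
      simp only [a₁, a₂]
      rcases Nat.even_or_odd n with hn | hn
      · rw [if_pos hn, if_pos hn, hn.neg_pow]
        push_cast
        ring
      · rw [if_neg (Nat.not_even_iff_odd.2 hn), if_neg (Nat.not_even_iff_odd.2 hn), hn.neg_pow]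
        push_cast
        ring
    have hone : charFun (convSeries a₁ τ) t * charFun (compoundPoisson τ) t
        - charFun (convSeries a₂ τ) t * charFun (compoundPoisson τ) t = 1 := by
      rw [← sub_mul, hdiff, charFun_compoundPoisson, ← Complex.exp_add, ← hM]
      simp
    have hadd : charFun (convSeries a₂ τ ∗ compoundPoisson τ + Measure.dirac 0) t
        = charFun (convSeries a₂ τ ∗ compoundPoisson τ) t + 1 := by
      rw [charFun_apply_real, integral_add_measure, ← charFun_apply_real, ← charFun_apply_real,
        charFun_dirac]
      · simp
      · refine Integrable.mono' (integrable_const (1 : ℝ)) (by fun_prop) ?_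
        filter_upwards with x
        rw [← Complex.ofReal_mul, Complex.norm_exp_ofReal_mul_I]
      · refine Integrable.mono' (integrable_const (1 : ℝ)) (by fun_prop) ?_
        filter_upwards with x
        rw [← Complex.ofReal_mul, Complex.norm_exp_ofReal_mul_I]
    rw [hadd, charFun_conv, charFun_conv, ← hone]
    ring
  · rw [hC]
    simpa using hM0

end

section

/-! ### Lévy measures on the half line -/

variable {μ ν : Measure ℝ}

theorem IsLevyMeasure.Iic_zero (h : IsLevyMeasure ν) : ν (Set.Iic 0) = 0 := by
  rw [← Set.Iio_union_right]
  exact measure_union_null h.neg_eq_zero h.zero_eq_zero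

theorem IsLevyMeasure.Ioi_lt_top (h : IsLevyMeasure ν) {a : ℝ} (ha : 0 < a) :
    ν (Set.Ioi a) < ⊤ := by
  have h1 := mul_meas_ge_le_lintegral (μ := ν) (f := fun x => ENNReal.ofReal (min 1 x))
    (by fun_prop) (ENNReal.ofReal (min 1 a))
  have h2 := h1.trans_lt h.lintegral_lt_top
  have h3 : ν {x | ENNReal.ofReal (min 1 a) ≤ ENNReal.ofReal (min 1 x)} < ⊤ := by
    refine lt_of_not_ge fun h4 => ?_
    rw [top_le_iff.1 h4, ENNReal.mul_top] at h2
    · exact lt_irrefl _ h2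
    · simpa using ha
  refine (measure_mono fun x hx => ?_).trans_lt h3
  exact ENNReal.ofReal_le_ofReal (min_le_min le_rfl (le_of_lt hx))

theorem IsLevyMeasure.sigmaFinite (h : IsLevyMeasure ν) : SigmaFinite ν := by
  refine Measure.sigmaFinite_of_countable
    (S := insert (Set.Iic 0) (Set.range fun n : ℕ => Set.Ioi (1 / ((n : ℝ) + 1))))
    ((Set.countable_range _).insert _) ?_ ?_
  · rintro s (rfl | ⟨n, rfl⟩)
    · rw [h.Iic_zero]; exact ENNReal.zero_lt_top
    · exact h.Ioi_lt_top (by positivity)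
  · refine Set.eq_univ_of_forall fun x => ?_
    rcases le_or_gt x 0 with hx | hx
    · exact ⟨_, Set.mem_insert _ _, hx⟩
    · obtain ⟨n, hn⟩ := exists_nat_one_div_lt hx
      exact ⟨_, Set.mem_insert_of_mem _ ⟨n, rfl⟩, hn⟩

theorem IsLevyMeasure.ae_pos (h : IsLevyMeasure ν) : ∀ᵐ x ∂ν, 0 < x := by
  rw [ae_iff]
  simpa [Set.Iic] using h.Iic_zero

theorem IsLevyMeasure.sb_Iic_ne_top (h : IsLevyMeasure ν) (A : ℝ) : sb ν (Set.Iic A) ≠ ⊤ := by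
  rw [sb_apply _ measurableSet_Iic]
  have h1 : ∫⁻ x in Set.Iic A, ENNReal.ofReal x ∂ν
      ≤ ∫⁻ x in Set.Iic A, ENNReal.ofReal (max 1 A) * ENNReal.ofReal (min 1 x) ∂ν := by
    refine setLIntegral_mono_ae (by fun_prop) ?_
    filter_upwards [h.ae_pos] with x h0 hx
    rw [← ENNReal.ofReal_mul (by positivity)]
    refine ENNReal.ofReal_le_ofReal ?_
    rcases le_total 1 x with h1 | h1
    · rw [min_eq_left h1, mul_one]
      exact le_trans hx (le_max_right _ _)
    · rw [min_eq_right h1]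
      exact le_mul_of_one_le_left h0.le (le_max_left _ _)
  refine (h1.trans_lt ?_).ne
  rw [lintegral_const_mul _ (by fun_prop)]
  exact ENNReal.mul_lt_top ENNReal.ofReal_lt_top
    ((setLIntegral_le_lintegral _ _).trans_lt h.lintegral_lt_top)

theorem IsLevyMeasure.sb_Iic_tendsto (h : IsLevyMeasure ν) :
    Tendsto (fun n : ℕ => sb ν (Set.Iic (1 / ((n : ℝ) + 1)))) atTop (𝓝 0) := by
  have hanti : Antitone fun n : ℕ => Set.Iic (1 / ((n : ℝ) + 1)) := fun m n hmn =>
    Set.Iic_subset_Iic.2 (Nat.one_div_le_one_div hmn)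
  have h1 := tendsto_measure_iInter_atTop (μ := sb ν) (fun n => measurableSet_Iic.nullMeasurableSet)
    hanti ⟨0, h.sb_Iic_ne_top _⟩
  have h0 : sb ν (⋂ n : ℕ, Set.Iic (1 / ((n : ℝ) + 1))) = 0 := by
    refine measure_mono_null (t := Set.Iic 0) (fun x hx => ?_)
      (withDensity_absolutelyContinuous _ _ h.Iic_zero)
    refine le_of_forall_pos_le_add (α := ℝ) fun e he => ?_
    obtain ⟨n, hn⟩ := exists_nat_one_div_lt he
    have := Set.mem_iInter.1 hx n
    simp only [Set.mem_Iic] at this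
    linarith
  rwa [h0] at h1

theorem norm_exp_sub_one_le (z : ℝ) {x : ℝ} (hx : 0 ≤ x) :
    ‖Complex.exp (Complex.I * z * x) - 1‖ ≤ (|z| + 2) * min 1 x := by
  have h1 : ‖Complex.exp (Complex.I * z * x) - 1‖ ≤ |z| * x := by
    have := Real.norm_exp_I_mul_ofReal_sub_one_le (x := z * x)
    rw [Real.norm_eq_abs, abs_mul, abs_of_nonneg hx] at this
    rw [mul_assoc, ← Complex.ofReal_mul]
    exact this
  have h2 : ‖Complex.exp (Complex.I * z * x) - 1‖ ≤ 2 := by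
    refine (norm_sub_le _ _).trans ?_
    rw [mul_assoc, ← Complex.ofReal_mul, mul_comm, Complex.norm_exp_ofReal_mul_I]
    norm_num
  rcases le_total 1 x with h | h
  · rw [min_eq_left h]
    linarith [abs_nonneg z]
  · rw [min_eq_right h]
    nlinarith [abs_nonneg z]

theorem IsLevyMeasure.integrable (h : IsLevyMeasure ν) (z : ℝ) :
    Integrable (fun x : ℝ => Complex.exp (Complex.I * z * x) - 1) ν := by
  have h1 : Integrable (fun x : ℝ => min 1 x) ν := by
    refine ⟨by fun_prop, ?_⟩
    rw [hasFiniteIntegral_iff_ofReal]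
    · exact h.lintegral_lt_top
    · filter_upwards [h.ae_pos] with x hx
      exact le_min zero_le_one hx.le
  refine (h1.const_mul (|z| + 2)).mono' (by fun_prop) ?_
  filter_upwards [h.ae_pos] with x hx using norm_exp_sub_one_le z hx.le

/-- The Lévy–Khintchine exponent of the jumps in `s`. -/
def levyExponent (ν : Measure ℝ) (s : Set ℝ) (z : ℝ) : ℂ :=
  ∫ x in s, (Complex.exp (Complex.I * z * x) - 1) ∂ν

theorem charFun_compoundPoisson_restrict {s : Set ℝ} (hs : ν s < ⊤) (z : ℝ) :
    charFun (compoundPoisson (ν.restrict s)) z = Complex.exp (levyExponent ν s z) := by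
  have : IsFiniteMeasure (ν.restrict s) := ⟨by simpa using hs⟩
  rw [charFun_compoundPoisson, charFun_apply_real, levyExponent, integral_sub _ (by simp)]
  · simp only [integral_const, Complex.real_smul, mul_one, measureReal_restrict_apply_univ]
    congr 2
    refine integral_congr_ae (Eventually.of_forall fun x => ?_)
    dsimp only
    congr 1
    ring
  · refine Integrable.mono' (integrable_const (1 : ℝ)) (by fun_prop) ?_
    filter_upwards with x
    rw [mul_assoc, ← Complex.ofReal_mul, mul_comm, Complex.norm_exp_ofReal_mul_I]

/-- The infinitely divisible distribution of the sum of the jumps of size at most `δ`. -/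
theorem IsLevyMeasure.exists_smallJumps (h : IsLevyMeasure ν) (δ : ℝ) :
    ∃ μ' : Measure ℝ, IsProbabilityMeasure μ' ∧ μ' (Set.Iio 0) = 0 ∧
      sb μ' Set.univ ≤ sb ν (Set.Iic δ) ∧
      ∀ z, charFun μ' z = Complex.exp (levyExponent ν (Set.Iic δ) z) := by
  -- The jumps in `(0, δ]` may have infinite rate, so they are exhausted by finite-rate pieces,
  -- whose compound Poisson laws have uniformly bounded means and a weak limit point.
  let S : ℕ → Set ℝ := fun n => Set.Ioc (1 / ((n : ℝ) + 1)) δ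
  have hSfin : ∀ n, ν (S n) < ⊤ := fun n =>
    (measure_mono Set.Ioc_subset_Ioi_self).trans_lt (h.Ioi_lt_top (by positivity))
  have hfin : ∀ n, IsFiniteMeasure (ν.restrict (S n)) := fun n => ⟨by simpa using hSfin n⟩
  let m : ℕ → ProbabilityMeasure ℝ := fun n => ⟨compoundPoisson (ν.restrict (S n)), inferInstance⟩
  have hnull : ∀ n, (m n : Measure ℝ) (Set.Iio 0) = 0 := fun n =>
    convSeries_null_Iio (le_antisymm
      ((Measure.restrict_le_self _).trans h.neg_eq_zero.le) (by simp)) _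
  have hmean : ∀ n, sb (m n : Measure ℝ) Set.univ ≤ sb ν (Set.Iic δ) := fun n => by
    change sb (compoundPoisson (ν.restrict (S n))) _ ≤ _
    rw [sb_compoundPoisson, conv_univ, measure_univ, one_mul,
      ← sb_restrict _ measurableSet_Ioc, Measure.restrict_apply_univ]
    · exact measure_mono Set.Ioc_subset_Iic_self
    · exact le_antisymm ((Measure.restrict_le_self _).trans h.neg_eq_zero.le) (by simp)
  set B := sb ν (Set.Iic δ) with hB
  have hBtop : B ≠ ⊤ := h.sb_Iic_ne_top δ
  have htight : IsTightMeasureSet {((q : ProbabilityMeasure ℝ) : Measure ℝ) | q ∈ Set.range m} := by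
    rw [isTightMeasureSet_iff_exists_isCompact_measure_compl_le]
    intro ε hε
    have hlim : Tendsto (fun R : ℝ => B / ENNReal.ofReal R) atTop (𝓝 0) := by
      have := ENNReal.Tendsto.const_div (a := B) ENNReal.tendsto_ofReal_atTop (Or.inr hBtop)
      simpa using this
    obtain ⟨R, hR, hR0⟩ := ((hlim.eventually_le_const hε).and (eventually_gt_atTop 0)).exists
    refine ⟨Set.Icc 0 R, isCompact_Icc, ?_⟩
    rintro _ ⟨_, ⟨n, rfl⟩, rfl⟩
    have hsub : (Set.Icc 0 R)ᶜ ⊆ Set.Iio 0 ∪ {x | ENNReal.ofReal R ≤ ENNReal.ofReal x} := by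
      intro x hx
      rcases lt_or_ge x 0 with h0 | h0
      · exact Or.inl h0
      · refine Or.inr (ENNReal.ofReal_le_ofReal ?_)
        by_contra hcon
        exact hx ⟨h0, (not_le.1 hcon).le⟩
    refine (measure_mono hsub).trans ((measure_union_le _ _).trans ?_)
    rw [hnull n, zero_add]
    refine (meas_ge_le_lintegral_div (by fun_prop) (by simpa using hR0)
      ENNReal.ofReal_ne_top).trans (le_trans ?_ hR)
    have := hmean n
    rw [sb_apply _ MeasurableSet.univ, setLIntegral_univ] at this
    gcongr
  obtain ⟨q, -, φ, hφ, hlim⟩ := (isCompact_closure_of_isTightMeasureSet htight).tendsto_subseq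
    (fun n => subset_closure (Set.mem_range_self n) : ∀ n, m n ∈ closure (Set.range m))
  refine ⟨q, inferInstance, ?_, ?_, fun z => ?_⟩
  · have := ProbabilityMeasure.le_liminf_measure_open_of_tendsto hlim (isOpen_Iio (a := (0 : ℝ)))
    simpa [hnull] using this
  · rw [sb_apply _ MeasurableSet.univ, setLIntegral_univ]
    -- Weak convergence does not test the unbounded function `x`; the mean bound passes to the limit
    -- for each truncation `min x N` and then by monotone convergence.
    let F : ℕ → BoundedContinuousFunction ℝ ℝ≥0 := fun N =>
      BoundedContinuousFunction.mkOfBound ⟨fun x => min (Real.toNNReal x) N, by fun_prop⟩ N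
        (fun x y => by
          rw [NNReal.dist_eq, abs_le]
          have h1 : ((min (Real.toNNReal x) N : ℝ≥0) : ℝ) ≤ N := by
            exact_mod_cast min_le_right _ _
          have h2 : ((min (Real.toNNReal y) N : ℝ≥0) : ℝ) ≤ N := by
            exact_mod_cast min_le_right _ _
          have h3 := (min (Real.toNNReal x) (N : ℝ≥0)).coe_nonneg
          have h4 := (min (Real.toNNReal y) (N : ℝ≥0)).coe_nonneg
          constructor <;> simp only [ContinuousMap.coe_mk] <;> linarith)
    have hFle : ∀ N, ∫⁻ x, F N x ∂(q : Measure ℝ) ≤ B := fun N => by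
      refine le_of_tendsto (ProbabilityMeasure.tendsto_iff_forall_lintegral_tendsto.1 hlim (F N))
        (Eventually.of_forall fun n => le_trans ?_ (hmean (φ n)))
      rw [sb_apply _ MeasurableSet.univ, setLIntegral_univ]
      refine lintegral_mono fun x => ?_
      rw [ENNReal.ofReal]
      exact ENNReal.coe_le_coe.2 (min_le_left _ _)
    have hsup : ∀ x : ℝ, ENNReal.ofReal x = ⨆ N : ℕ, (F N x : ℝ≥0∞) := fun x => by
      refine le_antisymm ?_ (iSup_le fun N => ENNReal.coe_le_coe.2 (min_le_left _ _))
      obtain ⟨N, hN⟩ := exists_nat_ge (Real.toNNReal x)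
      refine le_iSup_of_le N (ENNReal.coe_le_coe.2 ?_)
      exact le_min le_rfl hN
    rw [lintegral_congr hsup, lintegral_iSup (fun N => by fun_prop)]
    · exact iSup_le hFle
    · intro N N' hN x
      exact ENNReal.coe_le_coe.2 (min_le_min le_rfl (by exact_mod_cast hN))
  · rw [ProbabilityMeasure.tendsto_iff_tendsto_charFun] at hlim
    refine tendsto_nhds_unique (hlim z) ?_
    have hS : Tendsto (fun n => levyExponent ν (S n) z) atTop
        (𝓝 (levyExponent ν (⋃ n, S n) z)) := by
      refine tendsto_setIntegral_of_monotone (fun n => measurableSet_Ioc) ?_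
        (h.integrable z).integrableOn
      intro a b hab
      exact Set.Ioc_subset_Ioc_left (Nat.one_div_le_one_div hab)
    have hU : levyExponent ν (⋃ n, S n) z = levyExponent ν (Set.Iic δ) z := by
      refine setIntegral_congr_set ?_
      rw [ae_eq_set]
      constructor
      · rw [Set.sdiff_eq_empty.2 (Set.iUnion_subset fun n => Set.Ioc_subset_Iic_self)]
        exact measure_empty
      · refine measure_mono_null (fun x hx => ?_) h.Iic_zero
        by_contra h0
        obtain ⟨n, hn⟩ := exists_nat_one_div_lt (not_le.1 (by simpa using h0) : (0 : ℝ) < x)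
        exact hx.2 (Set.mem_iUnion.2 ⟨n, hn, hx.1⟩)
    rw [← hU]
    have := (Complex.continuous_exp.tendsto _).comp (hS.comp hφ.tendsto_atTop)
    refine this.congr fun n => ?_
    exact (charFun_compoundPoisson_restrict (hSfin _) z).symm

/-- Decomposition of `μ` into its small and large jumps. -/
theorem HasLevyRepresentation.exists_decomposition (hμ : HasLevyRepresentation μ 0 ν) {δ : ℝ}
    (hδ : 0 < δ) :
    ∃ (μ' π κ₁ κ₂ : Measure ℝ) (C : ℝ≥0∞), C ≠ ⊤ ∧ IsProbabilityMeasure μ' ∧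
      IsProbabilityMeasure π ∧ IsFiniteMeasure κ₁ ∧ IsFiniteMeasure κ₂ ∧
      μ' (Set.Iio 0) = 0 ∧ π (Set.Iio 0) = 0 ∧ sb μ' Set.univ ≤ sb ν (Set.Iic δ) ∧
      μ = μ' ∗ π ∧ sb π = π ∗ sb (ν.restrict (Set.Ioi δ)) ∧
      κ₁ ∗ π = κ₂ ∗ π + Measure.dirac 0 ∧ κ₁ ≤ C • π ∧ κ₂ ≤ C • π ∧
      Measure.dirac 0 ≤ C • π := by
  have h := hμ.isLevyMeasure
  have := hμ.infinitelyDivisible.1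
  obtain ⟨μ', hμ'1, hμ'2, hμ'3, hμ'4⟩ := h.exists_smallJumps δ
  have hfin := h.Ioi_lt_top hδ
  have : IsFiniteMeasure (ν.restrict (Set.Ioi δ)) := ⟨by simpa using hfin⟩
  have hnull : (ν.restrict (Set.Ioi δ)) (Set.Iio 0) = 0 :=
    le_antisymm ((Measure.restrict_le_self _).trans h.neg_eq_zero.le) (by simp)
  obtain ⟨κ₁, κ₂, C, hC, hκ₁, hκ₂, hinv, hle₁, hle₂, hle⟩ :=
    exists_compoundPoisson_inverse (ν.restrict (Set.Ioi δ))
  refine ⟨μ', compoundPoisson (ν.restrict (Set.Ioi δ)), κ₁, κ₂, C, hC, hμ'1, inferInstance, hκ₁,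
    hκ₂, hμ'2, convSeries_null_Iio hnull _, hμ'3, ?_, sb_compoundPoisson hnull, hinv, hle₁, hle₂,
    hle⟩
  refine Measure.ext_of_charFun (funext fun z => ?_)
  rw [charFun_conv, hμ'4, charFun_compoundPoisson_restrict hfin, ← Complex.exp_add, hμ.charFun_eq,
    levyExponent, levyExponent, ← Set.compl_Iic,
    integral_add_compl measurableSet_Iic (h.integrable z)]
  simp

/-- Steutel's identity `x μ(dx) = μ ∗ (x ν(dx))`. -/
theorem HasLevyRepresentation.sb_eq (hμ : HasLevyRepresentation μ 0 ν) : sb μ = μ ∗ sb ν := by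
  have h := hμ.isLevyMeasure
  have := hμ.infinitelyDivisible.1
  have := h.sigmaFinite
  let d : ℕ → ℝ := fun n => 1 / ((n : ℝ) + 1)
  have hd : ∀ n, 0 < d n := fun n => by positivity
  -- The derivation rule on `μ' ∗ π` gives the identity for jumps above `d n`. The defect `ρ` has
  -- the mean of the small jumps as its mass, which vanishes in the limit.
  have key : ∀ n, ∃ ρ : Measure ℝ, ρ Set.univ ≤ sb ν (Set.Iic (d n)) ∧
      sb μ = ρ + (sb ν).restrict (Set.Ioi (d n)) ∗ μ := fun n => by
    obtain ⟨μ', π, κ₁, κ₂, C, -, _, _, -, -, h1, h2, h3, h4, h5, -⟩ :=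
      hμ.exists_decomposition (hd n)
    refine ⟨sb μ' ∗ π, ?_, ?_⟩
    · rw [conv_univ, measure_univ (μ := π), mul_one]
      exact h3
    · rw [h4, sb_conv h1 h2, h5, ← Measure.conv_assoc, ← h4, sb_restrict _ measurableSet_Ioi,
        Measure.conv_comm μ]
  choose ρ hρ hsb using key
  rw [Measure.conv_comm]
  ext s hs
  set g : ℝ → ℝ≥0∞ := fun y => μ ((fun z => y + z) ⁻¹' s) with hg
  have hconv : ∀ n, ((sb ν).restrict (Set.Ioi (d n)) ∗ μ) s = (sb ν).withDensity g (Set.Ioi (d n)) :=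
    fun n => by
      rw [conv_apply' _ _ hs, withDensity_apply _ measurableSet_Ioi]
  have hconv' : (sb ν ∗ μ) s = (sb ν).withDensity g (⋃ n, Set.Ioi (d n)) := by
    rw [conv_apply' _ _ hs, withDensity_apply _ (MeasurableSet.iUnion fun n => measurableSet_Ioi),
      Measure.restrict_eq_self_of_ae_mem]
    filter_upwards [(withDensity_absolutelyContinuous _ _ : sb ν ≪ ν).ae_le h.ae_pos] with x hx
    obtain ⟨n, hn⟩ := exists_nat_one_div_lt hx
    exact Set.mem_iUnion.2 ⟨n, hn⟩
  have hlim : Tendsto (fun n => ((sb ν).restrict (Set.Ioi (d n)) ∗ μ) s) atTop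
      (𝓝 ((sb ν ∗ μ) s)) := by
    simp_rw [hconv, hconv']
    refine tendsto_measure_iUnion_atTop fun a b hab => ?_
    exact Set.Ioi_subset_Ioi (Nat.one_div_le_one_div hab)
  have hρ0 : Tendsto (fun n => ρ n s) atTop (𝓝 0) :=
    tendsto_of_tendsto_of_tendsto_of_le_of_le tendsto_const_nhds h.sb_Iic_tendsto
      (fun n => by simp) (fun n => (measure_mono (Set.subset_univ s)).trans (hρ n))
  have := hρ0.add hlim
  rw [zero_add] at this
  refine tendsto_nhds_unique ?_ this
  refine tendsto_const_nhds.congr fun n => ?_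
  conv_lhs => rw [hsb n]
  rfl

end

section

/-! ### Subexponentiality of densities in terms of cells -/

variable {m μ ν : Measure ℝ} {P u v : ℝ → ℝ≥0∞} {k l a b : ℝ≥0∞} {p : ℝ → ℝ}

theorem measure_Iic_add_Ioi (m : Measure ℝ) (A : ℝ) :
    m (Set.Iic A) + m (Set.Ioi A) = m Set.univ := by
  rw [← Set.compl_Iic, measure_add_measure_compl measurableSet_Iic]

theorem tendsto_measure_Ioi_zero (m : Measure ℝ) [IsFiniteMeasure m] :
    Tendsto (fun A : ℝ => m (Set.Ioi A)) atTop (𝓝 0) := by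
  have h := tendsto_measure_iInter_atTop (μ := m) (s := fun A : ℝ => Set.Ioi A)
    (fun A => measurableSet_Ioi.nullMeasurableSet) (fun A B h => Set.Ioi_subset_Ioi h)
    ⟨0, measure_ne_top _ _⟩
  have h0 : ⋂ A : ℝ, Set.Ioi A = ∅ := by
    refine Set.eq_empty_of_forall_notMem fun x hx => ?_
    exact lt_irrefl x (Set.mem_iInter.1 hx x)
  rwa [h0, measure_empty] at h

theorem cell_restrict_Ioi {A c x : ℝ} (h : A ≤ x) :
    cell (m.restrict (Set.Ioi A)) c x = cell m c x :=
  Measure.restrict_eq_self _ fun _ hz => h.trans_lt hz.1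

theorem EvGe.restrict_Ioi {c : ℝ} (h : EvGe P (cell m c) k) (A : ℝ) :
    EvGe P (cell (m.restrict (Set.Ioi A)) c) k :=
  h.mono ((eventually_ge_atTop A).mono fun _ hx => (cell_restrict_Ioi hx).ge) le_rfl

/-- The pieces of `m ∗ m` with one summand below `A` already account for `2 m((-∞, A])`. An upper
bound of `2 m(ℝ)` leaves at most `2 m((A, ∞))` for the piece with both summands large. -/
theorem SubexpRef.of_conv (hP : LongTailRef P) [IsFiniteMeasure m] (h0 : m (Set.Iio 0) = 0)
    (h2 : EvGe P (cell m 1) 1)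
    (h3 : EvLe P (cell (m ∗ m) 1) (2 * m Set.univ)) : SubexpRef P m where
  longTail := hP
  small ε hε := by
    have hlim := (tendsto_measure_Ioi_zero m).add (tendsto_measure_Ioi_zero m)
    rw [add_zero] at hlim
    obtain ⟨A, hA⟩ := (hlim.eventually_lt_const (pos_iff_ne_zero.2 hε)).exists
    refine ⟨A, ?_⟩
    set a := m (Set.Iic A) with ha
    set b := m (Set.Ioi A) with hb
    have hab : a + b = m Set.univ := measure_Iic_add_Ioi m A
    have hatop : a ≠ ⊤ := measure_ne_top _ _
    set m' := m.restrict (Set.Iic A)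
    set m'' := m.restrict (Set.Ioi A)
    have hu : EvGe P (cell (m' ∗ m) 1) a := by
      simpa [m'] using h2.conv_of_bounded hP (ae_abs_le_restrict h0 A)
    have hv : EvGe P (cell (m' ∗ m'') 1) a := by
      simpa [m'] using (h2.restrict_Ioi A).conv_of_bounded hP (ae_abs_le_restrict h0 A)
    have hsum : EvLe P (fun x => cell (m' ∗ m) 1 x +
        (cell (m' ∗ m'') 1 x + cell (m'' ∗ m'') 1 x)) (a + (a + (b + b))) := by
      convert h3 using 1
      · funext x
        rw [conv_split m m A, cell_add_measure, Measure.conv_comm (m.restrict (Set.Ioi A)) m,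
          conv_split m (m.restrict (Set.Ioi A)) A, cell_add_measure]
      · rw [← hab]; ring
    exact ((hsum.cancel_left hP.ne_top hatop hu).cancel_left hP.ne_top hatop hv) ε hA
  lower := by
    refine ⟨2, by norm_num, ?_⟩
    filter_upwards [h2 2⁻¹ (by simp)] with y hy
    calc P y = 2 * (2⁻¹ * P y) := by
          rw [← mul_assoc, ENNReal.mul_inv_cancel (by norm_num) (by norm_num), one_mul]
      _ ≤ _ := by gcongr

theorem EvLe.setLIntegral (hP : LongTailRef P) (h : EvLe P u k) (c : ℝ) :
    EvLe P (fun x => ∫⁻ y in Set.Ioc x (x + c), u y) (k * ENNReal.ofReal c) := by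
  intro k' hk'
  rcases le_or_gt c 0 with hc | hc
  · filter_upwards with x
    rw [Set.Ioc_eq_empty (by linarith)]
    simp
  have hc0 : ENNReal.ofReal c ≠ 0 := by simpa using hc
  have hkc : k < k' / ENNReal.ofReal c := by
    rw [ENNReal.lt_div_iff_mul_lt (Or.inl hc0) (Or.inl ENNReal.ofReal_ne_top)]; exact hk'
  obtain ⟨l, hl, hlk⟩ := exists_between hkc
  obtain ⟨r, hr, -, hrl⟩ := exists_one_lt_mul_lt hlk
  obtain ⟨X, hX⟩ := eventually_atTop.1 (h l hl)
  filter_upwards [hP.shift c r hr, eventually_ge_atTop X] with x h1 h2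
  calc ∫⁻ y in Set.Ioc x (x + c), u y ≤ ∫⁻ _ in Set.Ioc x (x + c), r * l * P x := by
        refine setLIntegral_mono measurable_const fun y hy => ?_
        calc u y ≤ l * P y := hX _ (h2.trans hy.1.le)
          _ ≤ l * (r * P x) := by
              gcongr
              have := h1 (y - x) (by rw [abs_le]; constructor <;> linarith [hy.1, hy.2])
              rwa [add_sub_cancel] at this
          _ = r * l * P x := by ring
    _ = (r * l) * ENNReal.ofReal c * P x := by
        rw [setLIntegral_const, Real.volume_Ioc, add_sub_cancel_left]; ring
    _ ≤ (k' / ENNReal.ofReal c) * ENNReal.ofReal c * P x := by gcongr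
    _ = k' * P x := by rw [ENNReal.div_mul_cancel hc0 ENNReal.ofReal_ne_top]

theorem EvGe.setLIntegral (hP : LongTailRef P) (h : EvGe P u k) {c : ℝ} (hc : 0 < c) :
    EvGe P (fun x => ∫⁻ y in Set.Ioc x (x + c), u y) (k * ENNReal.ofReal c) := by
  intro k' hk'
  have hc0 : ENNReal.ofReal c ≠ 0 := by simpa using hc
  have hkc : k' / ENNReal.ofReal c < k := by
    rw [ENNReal.div_lt_iff (Or.inl hc0) (Or.inl ENNReal.ofReal_ne_top)]; exact hk'
  obtain ⟨r, hr, -, hrl⟩ := exists_one_lt_mul_lt hkc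
  obtain ⟨X, hX⟩ := eventually_atTop.1 (h _ hrl)
  filter_upwards [hP.shift_ge c hr, eventually_ge_atTop X] with x h1 h2
  calc k' * P x = ∫⁻ _ in Set.Ioc x (x + c), k' / ENNReal.ofReal c * P x := by
        rw [setLIntegral_const, Real.volume_Ioc, add_sub_cancel_left,
          mul_comm _ (ENNReal.ofReal c), ← mul_assoc,
          ENNReal.mul_div_cancel hc0 ENNReal.ofReal_ne_top]
    _ ≤ ∫⁻ y in Set.Ioc x (x + c), u y := by
        refine setLIntegral_mono' measurableSet_Ioc fun y hy => ?_
        calc k' / ENNReal.ofReal c * P x ≤ k' / ENNReal.ofReal c * (r * P y) := by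
              gcongr
              have := h1 (y - x) (by rw [abs_le]; constructor <;> linarith [hy.1, hy.2])
              rwa [add_sub_cancel] at this
          _ = r * (k' / ENNReal.ofReal c) * P y := by ring
          _ ≤ _ := hX _ (h2.trans hy.1.le)

/-- The convolution square of a density, with values in `ℝ≥0∞`. -/
def lconv (p : ℝ → ℝ) (x : ℝ) : ℝ≥0∞ := ∫⁻ u, ENNReal.ofReal (p (x - u)) * ENNReal.ofReal (p u)

theorem IsDensityOf.lconv_eq (hp : IsDensityOf p μ) (x : ℝ) :
    lconv p x = ∫⁻ u, ENNReal.ofReal (p (x - u)) ∂μ := by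
  have := hp.isProbDensity.measurable
  rw [hp.eq_withDensity, lintegral_withDensity_eq_lintegral_mul _ (by fun_prop) (by fun_prop),
    lconv]
  exact lintegral_congr fun u => mul_comm _ _

theorem IsDensityOf.isProbabilityMeasure (hp : IsDensityOf p μ) : IsProbabilityMeasure μ :=
  ⟨by rw [hp.eq_withDensity, withDensity_apply _ MeasurableSet.univ, setLIntegral_univ,
    hp.isProbDensity.lintegral_eq_one]⟩

theorem IsDensityOf.cell_eq (hp : IsDensityOf p μ) (c x : ℝ) :
    cell μ c x = ∫⁻ y in Set.Ioc x (x + c), ENNReal.ofReal (p y) := by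
  rw [cell, hp.eq_withDensity, withDensity_apply _ measurableSet_Ioc]

theorem IsDensityOf.cell_conv_eq (hp : IsDensityOf p μ) (c x : ℝ) :
    cell (μ ∗ μ) c x = ∫⁻ y in Set.Ioc x (x + c), lconv p y := by
  have := hp.isProbabilityMeasure
  have hpm := hp.isProbDensity.measurable
  rw [cell_conv]
  simp_rw [hp.lconv_eq]
  rw [lintegral_lintegral_swap (by fun_prop)]
  refine lintegral_congr fun y => ?_
  rw [hp.cell_eq, ← lintegral_indicator measurableSet_Ioc, ← lintegral_indicator measurableSet_Ioc,
    ← lintegral_sub_right_eq_self _ y]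
  refine lintegral_congr fun z => ?_
  by_cases h : z ∈ Set.Ioc x (x + c)
  · rw [Set.indicator_of_mem h, Set.indicator_of_mem
      (by constructor <;> [skip; skip] <;> linarith [h.1, h.2])]
  · rw [Set.indicator_of_notMem h, Set.indicator_of_notMem fun h' => h
      (by constructor <;> linarith [h'.1, h'.2])]

theorem EvLe.refl (P : ℝ → ℝ≥0∞) : EvLe P P 1 := EvLe.of_eventually (by simp)

theorem EvGe.refl (P : ℝ → ℝ≥0∞) : EvGe P P 1 := EvGe.of_eventually (by simp)

theorem IsDensityOf.evLe_cell (hp : IsDensityOf p μ) (hL : LongTailed p) (c : ℝ) :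
    EvLe (fun x => ENNReal.ofReal (p x)) (cell μ c) (ENNReal.ofReal c) := by
  have := (EvLe.refl (fun x => ENNReal.ofReal (p x))).setLIntegral hL.longTailRef c
  rw [one_mul] at this
  exact this.mono (Eventually.of_forall fun x => (hp.cell_eq c x).le) le_rfl

theorem IsDensityOf.evGe_cell (hp : IsDensityOf p μ) (hL : LongTailed p) {c : ℝ} (hc : 0 < c) :
    EvGe (fun x => ENNReal.ofReal (p x)) (cell μ c) (ENNReal.ofReal c) := by
  have := (EvGe.refl (fun x => ENNReal.ofReal (p x))).setLIntegral hL.longTailRef hc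
  rw [one_mul] at this
  exact this.mono (Eventually.of_forall fun x => (hp.cell_eq c x).ge) le_rfl

/-- The regions `u ≤ A` and `u ≥ x - A` are disjoint for `x > 2 A` and exchanged by `u ↦ x - u`;
each contributes `μ((-∞, A])`. -/
theorem IsDensityOf.lconv_ge (hp : IsDensityOf p μ) (hL : LongTailed p)
    (h0 : μ (Set.Iio 0) = 0) : EvGe (fun x => ENNReal.ofReal (p x)) (lconv p) 2 := by
  have hprob := hp.isProbabilityMeasure
  have hP := hL.longTailRef
  have hpm := hp.isProbDensity.measurable
  refine EvGe.of_forall_lt fun l hl => ?_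
  have hlim : Tendsto (fun A : ℝ => μ (Set.Iic A) + μ (Set.Iic A)) atTop (𝓝 2) := by
    have := (tendsto_measure_Iic_atTop μ).add (tendsto_measure_Iic_atTop μ)
    rwa [measure_univ, one_add_one_eq_two] at this
  obtain ⟨A, hA⟩ := (hlim.eventually_const_lt hl).exists
  have h1 := (EvGe.refl (fun x => ENNReal.ofReal (p x))).lintegral_sub hP (ae_abs_le_restrict h0 A)
  rw [Measure.restrict_apply_univ, mul_one] at h1
  refine (h1.add h1).mono ?_ hA.le
  filter_upwards [eventually_gt_atTop (2 * A)] with x hx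
  have h2 : ∫⁻ y in Set.Iic A, ENNReal.ofReal (p (x - y)) ∂μ
      = ∫⁻ y in Set.Iic A, ENNReal.ofReal (p (x - y)) * ENNReal.ofReal (p y) := by
    rw [hp.eq_withDensity, setLIntegral_withDensity_eq_setLIntegral_mul _ (by fun_prop)
      (by fun_prop) measurableSet_Iic]
    exact lintegral_congr fun u => by simp only [Pi.mul_apply]; exact mul_comm _ _
  have h3 : ∫⁻ y in Set.Iic A, ENNReal.ofReal (p (x - y)) * ENNReal.ofReal (p y)
      = ∫⁻ y in Set.Ici (x - A), ENNReal.ofReal (p (x - y)) * ENNReal.ofReal (p y) := by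
    rw [← lintegral_indicator measurableSet_Iic, ← lintegral_indicator measurableSet_Ici,
      ← lintegral_sub_left_eq_self _ x]
    refine lintegral_congr fun z => ?_
    by_cases h : x - z ≤ A
    · rw [Set.indicator_of_mem (show x - z ∈ Set.Iic A from h), Set.indicator_of_mem
        (show z ∈ Set.Ici (x - A) from by simp only [Set.mem_Ici]; linarith), sub_sub_cancel,
        mul_comm]
    · rw [Set.indicator_of_notMem (show x - z ∉ Set.Iic A from h), Set.indicator_of_notMem
        (show z ∉ Set.Ici (x - A) from by simp only [Set.mem_Ici]; linarith)]
  rw [h2]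
  nth_rw 2 [h3]
  rw [← lintegral_union measurableSet_Ici, lconv]
  · exact setLIntegral_le_lintegral _ _
  · rw [Set.disjoint_left]
    intro z hz hz'
    simp only [Set.mem_Iic, Set.mem_Ici] at hz hz'
    linarith

/-- The two end regions give at most `1` each. In the middle region long-tailedness replaces the
pointwise value of `p` by a unit cell, so that cell information controls a pointwise convolution. -/
theorem IsDensityOf.lconv_le (hp : IsDensityOf p μ) (hL : LongTailed p)
    (h0 : μ (Set.Iio 0) = 0) (hS : SubexpRef (fun x => ENNReal.ofReal (p x)) μ) :
    EvLe (fun x => ENNReal.ofReal (p x)) (lconv p) 2 := by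
  have hprob := hp.isProbabilityMeasure
  have hP := hL.longTailRef
  have hpm := hp.isProbDensity.measurable
  obtain ⟨Y, hY⟩ := eventually_atTop.1 (hp.evGe_cell hL one_pos 2⁻¹ (by simp))
  have hY' : ∀ y, Y ≤ y → ENNReal.ofReal (p y) ≤ 2 * cell μ 1 y := fun y hy => by
    calc ENNReal.ofReal (p y) = 2 * (2⁻¹ * ENNReal.ofReal (p y)) := by
          rw [← mul_assoc, ENNReal.mul_inv_cancel (by norm_num) (by norm_num), one_mul]
      _ ≤ _ := by gcongr; exact hY y hy
  intro k' hk'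
  obtain ⟨r, hr, hlt⟩ := ENNReal.lt_iff_exists_add_pos_lt.1 hk'
  -- Error budget in units of `r / 4`: one for each end region and two for the middle, where passing
  -- from `p` to cells costs a factor `2`.
  have hr4 : (r / 4 : ℝ≥0∞) ≠ 0 := by simp [hr.ne']
  obtain ⟨A₀, hA₀⟩ := hS.small (r / 4) hr4
  set A := max A₀ Y
  set μ' := μ.restrict (Set.Ioi A) with hμ'
  have hmid : ∀ᶠ x in atTop, cell (μ' ∗ μ') 1 x ≤ r / 4 * ENNReal.ofReal (p x) := by
    have hle : μ' ≤ μ.restrict (Set.Ioi A₀) :=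
      Measure.restrict_mono_set _ (Set.Ioi_subset_Ioi (le_max_left _ _))
    filter_upwards [hA₀] with x hx
    refine le_trans (cell_mono_measure ?_ 1 x) hx
    refine (conv_mono hle).trans ?_
    rw [Measure.conv_comm _ μ']
    exact conv_mono hle
  have h1 := (EvLe.refl (fun x => ENNReal.ofReal (p x))).lintegral_sub hP (ae_abs_le_restrict h0 A)
  rw [Measure.restrict_apply_univ, mul_one] at h1
  have hle1 : μ (Set.Iic A) < 1 + r / 4 :=
    (prob_le_one (μ := μ)).trans_lt (ENNReal.lt_add_right (by simp) hr4)
  filter_upwards [h1 _ hle1, hmid] with x hx1 hx2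
  let f : ℝ → ℝ≥0∞ := fun u => ENNReal.ofReal (p (x - u)) * ENNReal.ofReal (p u)
  have h2 : ∫⁻ y in Set.Iic A, ENNReal.ofReal (p (x - y)) ∂μ = ∫⁻ y in Set.Iic A, f y := by
    rw [hp.eq_withDensity, setLIntegral_withDensity_eq_setLIntegral_mul _ (by fun_prop)
      (by fun_prop) measurableSet_Iic]
    exact lintegral_congr fun u => by simp only [Pi.mul_apply, f]; exact mul_comm _ _
  have h3 : ∫⁻ y in Set.Iic A, f y = ∫⁻ y in Set.Ici (x - A), f y := by
    rw [← lintegral_indicator measurableSet_Iic, ← lintegral_indicator measurableSet_Ici,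
      ← lintegral_sub_left_eq_self _ x]
    refine lintegral_congr fun z => ?_
    by_cases h : x - z ≤ A
    · rw [Set.indicator_of_mem (show x - z ∈ Set.Iic A from h), Set.indicator_of_mem
        (show z ∈ Set.Ici (x - A) from by simp only [Set.mem_Ici]; linarith)]
      simp only [f]
      rw [sub_sub_cancel, mul_comm]
    · rw [Set.indicator_of_notMem (show x - z ∉ Set.Iic A from h), Set.indicator_of_notMem
        (show z ∉ Set.Ici (x - A) from by simp only [Set.mem_Ici]; linarith)]
  have h4 : ∫⁻ y in Set.Ioi A ∩ Set.Iio (x - A), f y ≤ 2 * cell (μ' ∗ μ') 1 x := by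
    calc ∫⁻ y in Set.Ioi A ∩ Set.Iio (x - A), f y
        ≤ ∫⁻ y in Set.Ioi A, ENNReal.ofReal (p y) * (2 * cell μ' 1 (x - y)) := by
          rw [← lintegral_indicator (measurableSet_Ioi.inter measurableSet_Iio),
            ← lintegral_indicator measurableSet_Ioi]
          refine lintegral_mono fun y => ?_
          by_cases hy : y ∈ Set.Ioi A ∩ Set.Iio (x - A)
          · rw [Set.indicator_of_mem hy, Set.indicator_of_mem hy.1]
            have hy2 : A ≤ x - y := by have := hy.2; simp only [Set.mem_Iio] at this; linarith
            simp only [f]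
            rw [mul_comm, hμ', cell_restrict_Ioi hy2]
            gcongr
            exact hY' _ ((le_max_right _ _).trans hy2)
          · rw [Set.indicator_of_notMem hy]
            exact zero_le
      _ = ∫⁻ y in Set.Ioi A, 2 * cell μ' 1 (x - y) ∂μ := by
          have := measurable_cell μ' 1
          conv_rhs => rw [hp.eq_withDensity]
          rw [setLIntegral_withDensity_eq_setLIntegral_mul _ (by fun_prop)
            (by fun_prop) measurableSet_Ioi]
          rfl
      _ = 2 * cell (μ' ∗ μ') 1 x := by
          have := measurable_cell μ' 1
          rw [lintegral_const_mul _ (by fun_prop), ← cell_conv]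
  have hcover : Set.univ ⊆
      (Set.Iic A ∪ Set.Ici (x - A)) ∪ (Set.Ioi A ∩ Set.Iio (x - A)) := by
    intro y _
    by_cases h5 : y ≤ A
    · exact Or.inl (Or.inl h5)
    by_cases h6 : x - A ≤ y
    · exact Or.inl (Or.inr h6)
    · exact Or.inr ⟨not_le.1 h5, not_le.1 h6⟩
  calc lconv p x = ∫⁻ y in Set.univ, f y := by rw [setLIntegral_univ]; rfl
    _ ≤ ∫⁻ y in (Set.Iic A ∪ Set.Ici (x - A)) ∪ (Set.Ioi A ∩ Set.Iio (x - A)), f y :=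
        lintegral_mono_set hcover
    _ ≤ ((∫⁻ y in Set.Iic A, f y) + ∫⁻ y in Set.Ici (x - A), f y)
        + ∫⁻ y in Set.Ioi A ∩ Set.Iio (x - A), f y :=
        (lintegral_union_le _ _ _).trans (add_le_add
          (lintegral_union_le f (Set.Iic A) (Set.Ici (x - A))) le_rfl)
    _ ≤ ((1 + r / 4) * ENNReal.ofReal (p x) + (1 + r / 4) * ENNReal.ofReal (p x))
        + 2 * (r / 4 * ENNReal.ofReal (p x)) := by
        rw [h2] at hx1
        rw [← h3]
        exact add_le_add (add_le_add hx1 hx1) (h4.trans (by gcongr))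
    _ = (2 + 4 * (r / 4)) * ENNReal.ofReal (p x) := by ring
    _ ≤ k' * ENNReal.ofReal (p x) := by
        rw [ENNReal.mul_div_cancel (by norm_num) (by norm_num)]
        gcongr

theorem densityConv_nonneg (hp : ∀ x, 0 ≤ p x) (x : ℝ) : 0 ≤ densityConv p p x :=
  integral_nonneg fun _ => mul_nonneg (hp _) (hp _)

theorem ofReal_densityConv (hp : ∀ x, 0 ≤ p x) {x : ℝ}
    (h : Integrable fun u => p (x - u) * p u) :
    ENNReal.ofReal (densityConv p p x) = lconv p x := by
  rw [densityConv, ofReal_integral_eq_lintegral_ofReal h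
    (Eventually.of_forall fun _ => mul_nonneg (hp _) (hp _)), lconv]
  exact lintegral_congr fun u => ENNReal.ofReal_mul (hp _)

theorem integrable_of_lconv_ne_top (hp : IsProbDensity p) {x : ℝ} (h : lconv p x ≠ ⊤) :
    Integrable fun u => p (x - u) * p u := by
  have hpm := hp.measurable
  refine ⟨by fun_prop, ?_⟩
  rw [hasFiniteIntegral_iff_ofReal
    (Eventually.of_forall fun _ => mul_nonneg (hp.nonneg _) (hp.nonneg _))]
  refine lt_of_le_of_lt (le_of_eq ?_) h.lt_top
  exact lintegral_congr fun u => ENNReal.ofReal_mul (hp.nonneg _)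

/-- A long-tailed density on the half line is subexponential iff its convolution square is
asymptotically at most twice the measure on unit cells. -/
theorem IsDensityOf.subexpDensity_iff (hp : IsDensityOf p μ) (hL : LongTailedDensity p)
    (h0 : μ (Set.Iio 0) = 0) :
    SubexpDensity p ↔ EvLe (fun x => ENNReal.ofReal (p x)) (cell (μ ∗ μ) 1) 2 := by
  have hprob := hp.isProbabilityMeasure
  have hP := hL.2.longTailRef
  have hd := hp.isProbDensity
  have htwo : ∀ x, ENNReal.ofReal (2 * p x) = 2 * ENNReal.ofReal (p x) := fun x => by
    rw [ENNReal.ofReal_mul (by norm_num)]; simp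
  constructor
  · rintro ⟨-, h⟩
    have h1 : EvLe (fun x => ENNReal.ofReal (p x)) (lconv p) 2 := by
      have h2 : EvLe (fun x => ENNReal.ofReal (p x)) (fun x => ENNReal.ofReal (2 * p x)) 2 :=
        EvLe.of_eventually (Eventually.of_forall fun x => (htwo x).le)
      have h3 := h.evLe.trans h2 (by simp) (by simp)
      rw [one_mul] at h3
      obtain ⟨X, hX⟩ := h.1
      refine h3.mono ?_ le_rfl
      filter_upwards [eventually_ge_atTop X] with x hx
      refine (ofReal_densityConv hd.nonneg ?_).ge
      -- Were the integrand not integrable, `densityConv` would take its default value `0`,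
      -- contradicting the positivity built into `AsympEquiv`.
      by_contra hni
      have := (hX x hx).1
      rw [densityConv, integral_undef hni] at this
      exact lt_irrefl _ this
    have := h1.setLIntegral hP 1
    rw [ENNReal.ofReal_one, mul_one] at this
    exact this.mono (Eventually.of_forall fun x => (hp.cell_conv_eq 1 x).le) le_rfl
  · intro h
    have hS : SubexpRef (fun x => ENNReal.ofReal (p x)) μ :=
      SubexpRef.of_conv hP h0 (by simpa using hp.evGe_cell hL.2 one_pos) (by simpa using h)
    have h1 := hp.lconv_le hL.2 h0 hS
    have h2 := hp.lconv_ge hL.2 h0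
    have heq : ∀ᶠ x in atTop, ENNReal.ofReal (densityConv p p x) = lconv p x := by
      filter_upwards [h1 3 (by norm_num)] with x hx
      refine ofReal_densityConv hd.nonneg (integrable_of_lconv_ne_top hd ?_)
      exact (hx.trans_lt (ENNReal.mul_lt_top (by simp) ENNReal.ofReal_lt_top)).ne
    refine ⟨hL, AsympEquiv.of_common (k := 2) (densityConv_nonneg hd.nonneg) hP.pos (by norm_num)
      (by norm_num) (h1.mono (heq.mono fun _ hx => hx.le) le_rfl)
      (h2.mono (heq.mono fun _ hx => hx.ge) le_rfl)
      (EvLe.of_eventually (Eventually.of_forall fun x => (htwo x).le))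
      (EvGe.of_eventually (Eventually.of_forall fun x => (htwo x).ge))⟩

end

section

/-! ### The Lévy measure of a subexponential distribution -/

variable {m n σ τ μ ν : Measure ℝ} {P u v : ℝ → ℝ≥0∞} {k l a b : ℝ≥0∞}

theorem null_Iio_of_le (h : m ≤ n) (hn : n (Set.Iio 0) = 0) : m (Set.Iio 0) = 0 :=
  le_antisymm ((h _).trans hn.le) (by simp)

theorem cell_mul_le_cell_conv [SFinite m] (hσ : σ (Set.Iio 0) = 0) (c η x : ℝ) :
    σ (Set.Iic η) * cell m c x ≤ cell (σ ∗ m) (c + η) x := by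
  rw [cell_conv, mul_comm, ← setLIntegral_const]
  refine le_trans (lintegral_mono_ae ?_) (setLIntegral_le_lintegral (Set.Iic η) _)
  filter_upwards [ae_restrict_of_ae (ae_nonneg hσ), ae_restrict_mem measurableSet_Iic] with y h0 h1
  simp only [Set.mem_Iic] at h1
  exact cell_mono _ (by linarith) (by linarith)

theorem cell_conv_le_mul_cell [SFinite m] (hσ : σ (Set.Iio 0) = 0) (c η x : ℝ) :
    cell (σ.restrict (Set.Iic η) ∗ m) c x ≤ σ (Set.Iic η) * cell m (c + η) (x - η) := by
  rw [cell_conv, mul_comm, ← setLIntegral_const]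
  refine lintegral_mono_ae ?_
  filter_upwards [ae_restrict_of_ae (ae_nonneg hσ), ae_restrict_mem measurableSet_Iic] with y h0 h1
  simp only [Set.mem_Iic] at h1
  exact cell_mono _ (by linarith) (by linarith)

theorem exists_nat_Iic_ne_zero [IsProbabilityMeasure σ] : ∃ N : ℕ, σ (Set.Iic (N : ℝ)) ≠ 0 := by
  have h := (tendsto_measure_Iic_atTop σ).comp tendsto_natCast_atTop_atTop
  rw [measure_univ] at h
  obtain ⟨N, hN⟩ := (h.eventually_const_lt (zero_lt_one)).exists
  exact ⟨N, hN.ne'⟩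

/-- Some `[0, N]` has positive `σ`-mass, and summands from it move a unit cell of `m` into a window
of length `1 + N` of the convolution. -/
theorem EvLe.of_conv [SFinite m] [IsProbabilityMeasure σ] (hσ : σ (Set.Iio 0) = 0)
    (h : ∀ N : ℕ, ∃ k : ℝ≥0∞, k ≠ ⊤ ∧ EvLe P (cell (σ ∗ m) (1 + N)) k) :
    ∃ k : ℝ≥0∞, k ≠ ⊤ ∧ EvLe P (cell m 1) k := by
  obtain ⟨N, hN⟩ := exists_nat_Iic_ne_zero (σ := σ)
  obtain ⟨k, hk, hk'⟩ := h N
  have hinv : (σ (Set.Iic (N : ℝ)))⁻¹ ≠ ⊤ := by simpa using hN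
  refine ⟨_, ENNReal.mul_ne_top hinv hk, (hk'.const_mul hinv).mono ?_ le_rfl⟩
  filter_upwards with x
  calc cell m 1 x = (σ (Set.Iic (N : ℝ)))⁻¹ * (σ (Set.Iic (N : ℝ)) * cell m 1 x) := by
        rw [← mul_assoc, ENNReal.inv_mul_cancel hN (measure_ne_top _ _), one_mul]
    _ ≤ _ := by
        gcongr
        exact cell_mul_le_cell_conv hσ _ _ _

theorem EvLe.dominated_of_conv (hP : LongTailRef P) [SFinite m] [IsProbabilityMeasure σ]
    (hσ : σ (Set.Iio 0) = 0) (hk : k ≠ ⊤) (h : EvLe P (cell (σ ∗ m) 1) k) : Dominated P m := by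
  obtain ⟨k', hk', h'⟩ := EvLe.of_conv hσ (fun N => ⟨(N + 1 : ℕ) * k,
    ENNReal.mul_ne_top (by simp) hk, h.cell_of_one hP (N + 1) (by push_cast; linarith)⟩)
  exact h'.dominated hk'

/-- Hypotheses on an infinitely divisible `μ` with Lévy measure `ν`, relative to `P`. -/
structure SubexpLevy (P : ℝ → ℝ≥0∞) (μ ν : Measure ℝ) : Prop where
  rep : HasLevyRepresentation μ 0 ν
  ref : SubexpRef P μ
  evLe : ∀ c, 0 < c → EvLe P (cell μ c) (ENNReal.ofReal c)
  evGe : ∀ c, 0 < c → EvGe P (cell μ c) (ENNReal.ofReal c)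

/-- Steutel's identity makes `x μ(dx)` a smoothing of `x ν(dx)`; undoing it crudely by
`EvLe.of_conv` costs only a constant. -/
theorem HasLevyRepresentation.dominated_levy (hμ : HasLevyRepresentation μ 0 ν)
    (hP : LongTailRef P) (hk : k ≠ ⊤) (h : EvLe P (cell μ 1) k) : Dominated P ν := by
  have := hμ.infinitelyDivisible.1
  have := hμ.isLevyMeasure.sigmaFinite
  have h1 := h.sizeBias
  rw [hμ.sb_eq] at h1
  obtain ⟨k', hk', h'⟩ := EvLe.of_conv hμ.neg_eq_zero (fun N => ⟨(N + 1 : ℕ) * k,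
    ENNReal.mul_ne_top (by simp) hk,
    h1.cell_of_one hP.id_mul (N + 1) (by push_cast; linarith)⟩)
  exact h'.of_sb.dominated hk'

/-- The bulk jumps are deconvolved exactly by the signed inverse `κ₁ - κ₂` of `π`, leaving only the
law `μ'` of jumps so small that `[0, η]` carries almost all its mass. Domination of `κ₁` and `κ₂` by
`π` makes both convolutions with `x μ(dx)` computable, and the difference of their total masses is
exactly `1`. -/
theorem SubexpLevy.exists_smoothing (h : SubexpLevy P μ ν) {η : ℝ} (hη : 0 < η) {r : ℝ≥0∞}
    (hr : 1 < r) (hrt : r ≠ ⊤) : ∃ μ' : Measure ℝ, IsProbabilityMeasure μ' ∧ μ' (Set.Iio 0) = 0 ∧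
      1 ≤ r * μ' (Set.Iic η) ∧ Dominated P μ' ∧ ∀ c, 0 < c →
        EvLe (fun x => ENNReal.ofReal x * P x) (cell (μ' ∗ sb ν) c) (ENNReal.ofReal c) ∧
        EvGe (fun x => ENNReal.ofReal x * P x) (cell (μ' ∗ sb ν) c) (ENNReal.ofReal c) := by
  have hμ := h.rep
  have hν := hμ.isLevyMeasure
  have hprob := hμ.infinitelyDivisible.1
  have := hν.sigmaFinite
  have hP := h.ref.longTail
  have hQ := hP.id_mul
  have hη0 : ENNReal.ofReal η ≠ 0 := by simpa using hη
  have hμdom : Dominated P μ := (h.evLe 1 one_pos).dominated (by simp)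
  have hlim : Tendsto (fun n : ℕ => r * (1 - sb ν (Set.Iic (1 / ((n : ℝ) + 1))) / ENNReal.ofReal η))
      atTop (𝓝 r) := by
    have h1 := ENNReal.Tendsto.div_const hν.sb_Iic_tendsto (Or.inr hη0)
    have h2 := ENNReal.Tendsto.sub (tendsto_const_nhds (x := (1 : ℝ≥0∞))) h1 (Or.inl (by simp))
    have h3 := ENNReal.Tendsto.const_mul h2 (Or.inr hrt)
    simpa using h3
  obtain ⟨n, hn⟩ := (hlim.eventually_const_lt hr).exists
  obtain ⟨μ', π, κ₁, κ₂, C, hC, hμ', hπ, hκ₁, hκ₂, hμ'0, hπ0, hmean, hconv, -, hinv, hle₁, hle₂,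
    hle⟩ := hμ.exists_decomposition (δ := 1 / ((n : ℝ) + 1)) (by positivity)
  have htail : μ' (Set.Ioi η) ≤ sb ν (Set.Iic (1 / ((n : ℝ) + 1))) / ENNReal.ofReal η := by
    refine le_trans ?_ (ENNReal.div_le_div_right hmean _)
    rw [sb_apply _ MeasurableSet.univ, setLIntegral_univ]
    refine le_trans (measure_mono fun x hx => ?_)
      (meas_ge_le_lintegral_div (f := fun x => ENNReal.ofReal x) (by fun_prop) hη0
        ENNReal.ofReal_ne_top)
    exact ENNReal.ofReal_le_ofReal (le_of_lt hx)
  have hπdom : Dominated P π := by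
    have h1 := h.evLe 1 one_pos
    rw [hconv] at h1
    exact h1.dominated_of_conv hP hμ'0 (by simp)
  have hκ₁dom := (hπdom.smul hC).mono hle₁
  have hκ₂dom := (hπdom.smul hC).mono hle₂
  have hCπ0 : (C • π) (Set.Iio 0) = 0 := by simp [hπ0]
  have hκ₁0 := null_Iio_of_le hle₁ hCπ0
  have hκ₂0 := null_Iio_of_le hle₂ hCπ0
  have hmass : κ₁ Set.univ = κ₂ Set.univ + 1 := by
    have := congrArg (fun m : Measure ℝ => m Set.univ) hinv
    simpa [conv_univ] using this
  have hμ'le : μ' ≤ C • μ := by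
    calc μ' = Measure.dirac 0 ∗ μ' := (Measure.dirac_zero_conv μ').symm
      _ ≤ (C • π) ∗ μ' := conv_mono hle
      _ = C • μ := by rw [Measure.conv_smul_left, Measure.conv_comm, ← hconv]
  -- Steutel's identity reads `x μ = π ∗ (μ' ∗ x ν)`, and `κ₁ ∗ π = κ₂ ∗ π + δ₀` strips off `π`.
  have hid : κ₁ ∗ sb μ = κ₂ ∗ sb μ + μ' ∗ sb ν := by
    have h1 : sb μ = π ∗ (μ' ∗ sb ν) := by
      rw [hμ.sb_eq, hconv, Measure.conv_comm μ' π, Measure.conv_assoc]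
    rw [h1, ← Measure.conv_assoc, hinv, add_conv', Measure.conv_assoc, Measure.dirac_zero_conv]
  refine ⟨μ', hμ', hμ'0, ?_, (hμdom.smul hC).mono hμ'le, fun c hc => ?_⟩
  · refine hn.le.trans ?_
    gcongr
    rw [tsub_le_iff_right, ← measure_univ (μ := μ'), ← measure_Iic_add_Ioi μ' η]
    gcongr
  · have hfin : ∀ A, sb μ (Set.Iic A) ≠ ⊤ := fun A => sb_Iic_ne_top μ A
    have hle1 := h.ref.conv_sb_evLe hκ₁dom hκ₁0 hμdom hfin (by simp) (h.evLe c hc).sizeBias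
    have hle2 := h.ref.conv_sb_evLe hκ₂dom hκ₂0 hμdom hfin (by simp) (h.evLe c hc).sizeBias
    have hge1 := (h.evGe c hc).sizeBias.conv hQ hκ₁0
    have hge2 := (h.evGe c hc).sizeBias.conv hQ hκ₂0
    have hfin2 : κ₂ Set.univ * ENNReal.ofReal c ≠ ⊤ :=
      ENNReal.mul_ne_top (measure_ne_top _ _) ENNReal.ofReal_ne_top
    rw [hid, hmass, add_mul, one_mul] at hle1 hge1
    exact ⟨hle1.cancel_left hQ.ne_top hfin2 hge2, hge1.cancel_left hQ.ne_top hfin2 hle2⟩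

theorem exists_pos_ofReal_add_lt {c : ℝ} (h : ENNReal.ofReal c < k) :
    ∃ η : ℝ, 0 < η ∧ ENNReal.ofReal (c + η) < k := by
  have hlim : Tendsto (fun η : ℝ => ENNReal.ofReal (c + η)) (𝓝[>] 0) (𝓝 (ENNReal.ofReal (c + 0))) :=
    (ENNReal.continuous_ofReal.tendsto _).comp
      ((tendsto_const_nhds.add tendsto_id).mono_left nhdsWithin_le_nhds)
  rw [add_zero] at hlim
  obtain ⟨η, h1, h2⟩ := ((hlim.eventually_lt_const h).and self_mem_nhdsWithin).exists
  exact ⟨η, h2, h1⟩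

theorem exists_pos_lt_ofReal_sub {c : ℝ} (hc : 0 < c) (h : k < ENNReal.ofReal c) :
    ∃ η : ℝ, 0 < η ∧ η < c ∧ k < ENNReal.ofReal (c - η) := by
  have hlim : Tendsto (fun η : ℝ => ENNReal.ofReal (c - η)) (𝓝[>] 0) (𝓝 (ENNReal.ofReal (c - 0))) :=
    (ENNReal.continuous_ofReal.tendsto _).comp
      ((tendsto_const_nhds.sub tendsto_id).mono_left nhdsWithin_le_nhds)
  rw [sub_zero] at hlim
  obtain ⟨η, h1, h2, h3⟩ := ((hlim.eventually_const_lt h).and (eventually_mem_nhdsWithin.and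
    (nhdsWithin_le_nhds (Iio_mem_nhds hc)))).exists
  exact ⟨η, h2, h3, h1⟩

/-- Summands of `μ'` in `[0, η]` shift cells by at most `η`, so widening the window to `c + η` loses
only the factor `r`; then `η → 0` and `r → 1`. -/
theorem SubexpLevy.sb_levy_evLe (h : SubexpLevy P μ ν) {c : ℝ} (hc : 0 < c) :
    EvLe (fun x => ENNReal.ofReal x * P x) (cell (sb ν) c) (ENNReal.ofReal c) := by
  have := h.rep.isLevyMeasure.sigmaFinite
  intro k' hk'
  obtain ⟨η, hη, hlt⟩ := exists_pos_ofReal_add_lt hk'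
  obtain ⟨r, hr, hrt, hrl⟩ := exists_one_lt_mul_lt hlt
  obtain ⟨μ', -, hμ'0, h1, -, h2⟩ := h.exists_smoothing hη hr hrt
  have h3 := (h2 (c + η) (by linarith)).1.const_mul hrt
  filter_upwards [h3 k' hrl] with x hx
  calc cell (sb ν) c x ≤ r * μ' (Set.Iic η) * cell (sb ν) c x := le_mul_of_one_le_left' h1
    _ = r * (μ' (Set.Iic η) * cell (sb ν) c x) := mul_assoc _ _ _
    _ ≤ r * cell (μ' ∗ sb ν) (c + η) x := by
        gcongr; exact cell_mul_le_cell_conv hμ'0 _ _ _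
    _ ≤ _ := hx

/-- Here the part of `μ'` beyond `η` must be subtracted. Its contribution is bounded by the upper
estimate already obtained, and the rest is absorbed by shrinking the window to `c - η`. -/
theorem SubexpLevy.sb_levy_evGe (h : SubexpLevy P μ ν) {c : ℝ} (hc : 0 < c) :
    EvGe (fun x => ENNReal.ofReal x * P x) (cell (sb ν) c) (ENNReal.ofReal c) := by
  have hσ := h.rep.isLevyMeasure.sigmaFinite
  have hμ := h.rep.infinitelyDivisible.1
  have hQ := h.ref.longTail.id_mul
  intro k' hk'
  obtain ⟨η, hη, hηc, hlt⟩ := exists_pos_lt_ofReal_sub hc hk'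
  obtain ⟨r, hr, hrt, hrl⟩ := exists_one_lt_mul_lt hlt
  obtain ⟨μ', hprob, hμ'0, h1, hdom, h2⟩ := h.exists_smoothing hη hr hrt
  set a := μ' (Set.Iic η)
  set s := μ' (Set.Ioi η)
  have has : s + a = 1 := by
    rw [add_comm, ← measure_univ (μ := μ'), ← measure_Iic_add_Ioi μ' η]
  have hle := h.ref.conv_sb_evLe (m₁ := μ'.restrict (Set.Ioi η))
    (hdom.mono Measure.restrict_le_self) (null_Iio_of_le Measure.restrict_le_self hμ'0)
    (h.rep.dominated_levy h.ref.longTail (by simp) (h.evLe 1 one_pos))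
    h.rep.isLevyMeasure.sb_Iic_ne_top ENNReal.ofReal_ne_top
    (h.sb_levy_evLe (c := c - η) (by linarith))
  rw [Measure.restrict_apply_univ] at hle
  have hge := (h2 (c - η) (by linarith)).2
  have hge' : EvGe (fun x => ENNReal.ofReal x * P x)
      (fun x => cell (μ'.restrict (Set.Ioi η) ∗ sb ν) (c - η) x + cell (sb ν) c (x - η))
      (s * ENNReal.ofReal (c - η) + a * ENNReal.ofReal (c - η)) := by
    rw [← add_mul, has, one_mul]
    refine hge.mono (Eventually.of_forall fun x => ?_) le_rfl
    rw [conv_split μ' _ η, cell_add_measure, add_comm]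
    gcongr
    have h3 := cell_conv_le_mul_cell (m := sb ν) hμ'0 (c - η) η x
    rw [sub_add_cancel] at h3
    exact h3.trans (mul_le_of_le_one_left' prob_le_one)
  have hsc_top : s * ENNReal.ofReal (c - η) ≠ ⊤ :=
    ENNReal.mul_ne_top (measure_ne_top _ _) ENNReal.ofReal_ne_top
  have hfin := (hge'.cancel_left hQ.ne_top hsc_top hle).shift hQ η
  simp only [add_sub_cancel_right] at hfin
  refine hfin k' ?_
  have hr0 : r ≠ 0 := (zero_lt_one.trans hr).ne'
  refine lt_of_mul_lt_mul_left' (a := r) (hrl.trans_le ?_)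
  rw [← mul_assoc]
  exact le_mul_of_one_le_left' h1

theorem SubexpLevy.levy_evLe (h : SubexpLevy P μ ν) {c : ℝ} (hc : 0 < c) :
    EvLe P (cell ν c) (ENNReal.ofReal c) := (h.sb_levy_evLe hc).of_sb

theorem SubexpLevy.levy_evGe (h : SubexpLevy P μ ν) {c : ℝ} (hc : 0 < c) :
    EvGe P (cell ν c) (ENNReal.ofReal c) := (h.sb_levy_evGe hc).of_sb

/-! ### Local subexponentiality of measures comparable with the reference function -/

/-- Size-biasing turns the square into `2 m ∗ (x m(dx))`, to which the two transfer results for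
convolutions apply. -/
theorem SubexpRef.conv_self [SFinite n] (hS : SubexpRef P n) [IsProbabilityMeasure m]
    (h0 : m (Set.Iio 0) = 0) (hk : k ≠ ⊤)
    (h1 : ∀ c, 0 < c → EvLe P (cell m c) (k * ENNReal.ofReal c))
    (h2 : ∀ c, 0 < c → EvGe P (cell m c) (k * ENNReal.ofReal c)) {c : ℝ} (hc : 0 < c) :
    EvLe P (cell (m ∗ m) c) (2 * (k * ENNReal.ofReal c)) ∧
      EvGe P (cell (m ∗ m) c) (2 * (k * ENNReal.ofReal c)) := by
  have hsb : ∀ x, cell (sb (m ∗ m)) c x = 2 * cell (m ∗ sb m) c x := fun x => by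
    rw [sb_conv h0 h0, Measure.conv_comm (sb m) m, cell_add_measure, two_mul]
  have hdom : Dominated P m := (h1 1 one_pos).dominated (by simp [hk])
  have hle := hS.conv_sb_evLe hdom h0 hdom (fun A => sb_Iic_ne_top m A)
    (ENNReal.mul_ne_top hk ENNReal.ofReal_ne_top) (h1 c hc).sizeBias
  have hge := (h2 c hc).sizeBias.conv hS.longTail.id_mul h0
  rw [measure_univ, one_mul] at hle hge
  refine ⟨EvLe.of_sb ((hle.const_mul (c := 2) (by norm_num)).mono ?_ le_rfl),
    EvGe.of_sb ((hge.const_mul (c := 2) (by norm_num)).mono ?_ le_rfl)⟩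
  · exact Eventually.of_forall fun x => (hsb x).le
  · exact Eventually.of_forall fun x => (hsb x).ge

theorem ofReal_intervalMass (m : Measure ℝ) [IsFiniteMeasure m] (c x : ℝ) :
    ENNReal.ofReal (intervalMass m c x) = cell m c x := ofReal_measureReal

theorem intervalMass_nonneg (m : Measure ℝ) (c x : ℝ) : 0 ≤ intervalMass m c x :=
  measureReal_nonneg

theorem measurable_intervalMass (m : Measure ℝ) [SFinite m] (c : ℝ) :
    Measurable (intervalMass m c) := (measurable_cell m c).ennreal_toReal

theorem memLDelta_of_ev (hP : LongTailRef P) [IsProbabilityMeasure m] (hk0 : k ≠ 0) (hk : k ≠ ⊤)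
    {c : ℝ} (h1 : EvLe P (cell m c) k) (h2 : EvGe P (cell m c) k) : MemLDelta c m := by
  refine ⟨inferInstance, measurable_intervalMass m c, intervalMass_nonneg m c, fun a => ?_⟩
  refine AsympEquiv.of_common (P := P) (k := k) (fun x => intervalMass_nonneg m c _) hP.pos hk0 hk
    ?_ ?_ ?_ ?_ <;> simp only [ofReal_intervalMass]
  exacts [h1.shift hP a, h2.shift hP a, h1, h2]

theorem memSLoc_of_ev [SFinite n] (hS : SubexpRef P n) [IsProbabilityMeasure m]
    (h0 : m (Set.Iio 0) = 0) (hk0 : k ≠ 0) (hk : k ≠ ⊤)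
    (h1 : ∀ c, 0 < c → EvLe P (cell m c) (k * ENNReal.ofReal c))
    (h2 : ∀ c, 0 < c → EvGe P (cell m c) (k * ENNReal.ofReal c)) : MemSLoc m := by
  intro c hc
  have hc0 : ENNReal.ofReal c ≠ 0 := by simpa using hc
  have hkc0 : k * ENNReal.ofReal c ≠ 0 := mul_ne_zero hk0 hc0
  have hkc : k * ENNReal.ofReal c ≠ ⊤ := ENNReal.mul_ne_top hk ENNReal.ofReal_ne_top
  refine ⟨memLDelta_of_ev hS.longTail hkc0 hkc (h1 c hc) (h2 c hc), ?_⟩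
  obtain ⟨h3, h4⟩ := hS.conv_self h0 hk h1 h2 hc
  have htwo : ∀ x, ENNReal.ofReal (2 * intervalMass m c x) = 2 * cell m c x := fun x => by
    rw [ENNReal.ofReal_mul (by norm_num), ofReal_intervalMass]; simp
  refine AsympEquiv.of_common (P := P) (k := 2 * (k * ENNReal.ofReal c))
    (fun x => intervalMass_nonneg _ c _) hS.longTail.pos (mul_ne_zero (by norm_num) hkc0)
    (ENNReal.mul_ne_top (by norm_num) hkc) ?_ ?_ ?_ ?_ <;>
    simp only [ofReal_intervalMass, htwo]
  exacts [h3, h4, (h1 c hc).const_mul (by norm_num), (h2 c hc).const_mul (by norm_num)]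

/-! ### The normalized Lévy measure -/

theorem cell_normalizedLevy {c x : ℝ} (hx : 1 ≤ x) :
    cell (normalizedLevy ν) c x = (ν (Set.Ioi 1))⁻¹ * cell ν c x := by
  rw [normalizedLevy, cell_smul, cell_restrict_Ioi hx]

theorem normalizedLevy_isProbabilityMeasure (h : IsLevyMeasure ν) (h0 : 0 < ν (Set.Ioi 1)) :
    IsProbabilityMeasure (normalizedLevy ν) :=
  ⟨by rw [normalizedLevy, Measure.smul_apply, Measure.restrict_apply_univ, smul_eq_mul,
    ENNReal.inv_mul_cancel h0.ne' (h.Ioi_lt_top one_pos).ne]⟩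

theorem normalizedLevy_null_Iio (h : IsLevyMeasure ν) : normalizedLevy ν (Set.Iio 0) = 0 := by
  rw [normalizedLevy, Measure.smul_apply,
    null_Iio_of_le Measure.restrict_le_self h.neg_eq_zero, smul_zero]

theorem SubexpLevy.memSLoc (h : SubexpLevy P μ ν) (h0 : 0 < ν (Set.Ioi 1)) :
    MemSLoc (normalizedLevy ν) := by
  have hν := h.rep.isLevyMeasure
  have := normalizedLevy_isProbabilityMeasure hν h0
  have := h.rep.infinitelyDivisible.1
  have hk0 : (ν (Set.Ioi 1))⁻¹ ≠ 0 := ENNReal.inv_ne_zero.2 (hν.Ioi_lt_top one_pos).ne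
  have hk : (ν (Set.Ioi 1))⁻¹ ≠ ⊤ := ENNReal.inv_ne_top.2 h0.ne'
  refine memSLoc_of_ev h.ref (normalizedLevy_null_Iio hν) hk0 hk (fun c hc => ?_) fun c hc => ?_
  · exact ((h.levy_evLe hc).const_mul hk).mono ((eventually_ge_atTop 1).mono
      fun x hx => (cell_normalizedLevy hx).le) le_rfl
  · exact ((h.levy_evGe hc).const_mul hk).mono ((eventually_ge_atTop 1).mono
      fun x hx => (cell_normalizedLevy hx).ge) le_rfl

end

section

/-! ### From local subexponentiality of the Lévy measure to the density -/

variable {m n σ τ μ ν : Measure ℝ} {P u v : ℝ → ℝ≥0∞} {k l a b : ℝ≥0∞} {p : ℝ → ℝ}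

theorem cell_conv_restrict_Iic [SFinite m] [SFinite σ] {B c x : ℝ} (hσ : σ (Set.Iio 0) = 0)
    (hx : x + c ≤ B) : cell (m.restrict (Set.Iic B) ∗ σ) c x = cell (m ∗ σ) c x := by
  rw [Measure.conv_comm, Measure.conv_comm m, cell_conv, cell_conv]
  refine lintegral_congr_ae ?_
  filter_upwards [ae_nonneg hσ] with y hy
  refine Measure.restrict_eq_self _ fun z hz => ?_
  simp only [Set.mem_Iic]
  linarith [hz.2]

/-- If `x m(dx) = m ∗ (x ν(dx))`, where `x ν(dx) = O(x P)` and `ν = O(P)`, then `m = O(P)`. -/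
theorem SubexpRef.dominated_of_sb_eq (hS : SubexpRef P n) [SFinite n] [IsProbabilityMeasure m]
    [SFinite ν] (h0 : m (Set.Iio 0) = 0) (hν : Dominated P ν)
    (hfin : ∀ A, sb ν (Set.Iic A) ≠ ⊤) (hk : k ≠ ⊤)
    (hle : EvLe (fun x => ENNReal.ofReal x * P x) (cell (sb ν) 1) k)
    (heq : sb m = m ∗ sb ν)
    (hshift : ∀ᶠ x in atTop, ∀ a, |a| ≤ 1 → cell m 1 (x + a) ≤ 8 * cell m 1 x) :
    Dominated P m := by
  have hP := hS.longTail
  have hQ := hP.id_mul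
  -- The induction step below first inflates the constant by `16 * 16`; `256 / 512` leaves half of
  -- `K` for the far part of the convolution.
  obtain ⟨A₀, hA₀⟩ := hS.mid hν hfin 1 (ε := 512⁻¹) (by simp)
  obtain ⟨Y, hY⟩ := eventually_atTop.1
    (hshift.and ((hP.shift_ge 1 (r := 2) (by norm_num)).and hP.pos))
  set A := max A₀ (Y + 1) with hA
  have hAY : Y ≤ A - 1 := by linarith [le_max_right A₀ (Y + 1)]
  obtain ⟨X, hX⟩ := hA₀ A (le_max_left _ _)
  have hlow := hle.conv_of_bounded hQ (ae_abs_le_restrict h0 A)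
  rw [Measure.restrict_apply_univ] at hlow
  have hlt : m (Set.Iic A) * k < k + 1 := by
    refine lt_of_le_of_lt ?_ (ENNReal.lt_add_right hk one_ne_zero)
    exact mul_le_of_le_one_left' prob_le_one
  obtain ⟨X', hX'⟩ := eventually_atTop.1 ((hlow _ hlt).and (eventually_gt_atTop 0))
  -- The bootstrap invariant: domination with constant `K` up to `X`. The aim is to advance `X` with
  -- `K` unchanged.
  let S : ℝ≥0∞ → ℝ → Prop := fun K X => ∀ y, A - 1 ≤ y → y ≤ X → cell m 1 y ≤ K * P y
  have hmono : ∀ {K K' X}, K ≤ K' → S K X → S K' X := fun hK h y h1 h2 =>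
    (h y h1 h2).trans (by gcongr)
  -- A crude advance by regularity alone: `8` for the cells of `m` and `2` for `P`.
  have hgrow : ∀ K X, A - 1 ≤ X → S K X → S (16 * K) (X + 1) := by
    intro K X hX h y h1 h2
    rcases le_or_gt y X with hy | hy
    · exact hmono (le_mul_of_one_le_left' (by norm_num)) h y h1 hy
    · have hab : |y - X| ≤ 1 := by rw [abs_le]; constructor <;> linarith
      obtain ⟨h3, h4, -⟩ := hY X (by linarith)
      have h5 := h3 _ hab
      have h6 := h4 _ hab
      rw [add_sub_cancel] at h5 h6
      calc cell m 1 y ≤ 8 * cell m 1 X := h5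
        _ ≤ 8 * (K * (2 * P y)) := by
            gcongr
            exact (h X hX le_rfl).trans (by gcongr)
        _ = 16 * K * P y := by ring
  have hbase : ∀ j : ℕ, ∃ K : ℝ≥0∞, K ≠ ⊤ ∧ S K (A - 1 + j) := by
    intro j
    induction j with
    | zero =>
      refine ⟨(P (A - 1))⁻¹, by simpa using (hY _ hAY).2.2, fun y h1 h2 => ?_⟩
      have : y = A - 1 := le_antisymm (by simpa using h2) h1
      rw [this, ENNReal.inv_mul_cancel (hY _ hAY).2.2 (hP.ne_top _)]
      exact prob_le_one
    | succ j ih =>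
      obtain ⟨K, hK, h⟩ := ih
      refine ⟨16 * K, ENNReal.mul_ne_top (by simp) hK, ?_⟩
      have := hgrow K _ (by simp) h
      rwa [Nat.cast_succ, ← add_assoc]
  obtain ⟨j₀, hj₀⟩ := exists_nat_ge (max X X' - (A - 1))
  obtain ⟨K₀, hK₀, hSK₀⟩ := hbase j₀
  set K := max K₀ (2 * (k + 1)) with hKdef
  have hK : K ≠ ⊤ := by
    rw [hKdef]
    exact (max_lt hK₀.lt_top (ENNReal.mul_lt_top (by simp) (by simp [hk.lt_top]))).ne
  -- Feeding the crude bound up to `Z + 2` into the identity for `x m(dx)` returns the original `K`: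
  -- the near part costs at most `k + 1 ≤ K / 2`, the far part `K / 2`.
  have hstep : ∀ Z, A - 1 ≤ Z → max X X' ≤ Z → S K Z → S K (Z + 1) := by
    intro Z hAZ hZ h x h1 h2
    rcases le_or_gt x Z with hx | hx
    · exact h x h1 hx
    have hx0 := hX' x (((le_max_right _ _).trans hZ).trans hx.le)
    have hxX := ((le_max_left _ _).trans hZ).trans hx.le
    have h3 := hgrow _ _ (by linarith) (hgrow _ _ hAZ h)
    -- Nothing is known about `m` past `Z + 2`, but a cell ending by then only sees the truncated
    -- measure, since `sb ν` has no mass on the negatives.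
    have h4 := hX (16 * (16 * K)) (m.restrict (Set.Iic (Z + 1 + 1))) inferInstance
      (fun y hy => by
        rcases le_or_gt y (Z + 1 + 1) with hyZ | hyZ
        · exact (cell_mono_measure Measure.restrict_le_self _ _).trans (h3 y hy hyZ)
        · rw [cell, Measure.restrict_apply measurableSet_Ioc]
          have : Set.Ioc y (y + 1) ∩ Set.Iic (Z + 1 + 1) = ∅ := by
            ext z
            simp only [Set.mem_inter_iff, Set.mem_Ioc, Set.mem_Iic, Set.mem_empty_iff_false,
              iff_false]
            rintro ⟨⟨h5, -⟩, h6⟩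
            linarith
          simp [this]) x hxX
    rw [Measure.restrict_restrict measurableSet_Ioi, Set.inter_comm,
      ← Measure.restrict_restrict measurableSet_Iic,
      cell_conv_restrict_Iic (sb_null_Iio ν) (by linarith)] at h4
    refine (ENNReal.mul_le_mul_iff_right (a := ENNReal.ofReal x) (by simpa using hx0.2)
      ENNReal.ofReal_ne_top).1 ?_
    have hKhalf : (16 * (16 * K)) * 512⁻¹ = K / 2 := by
      rw [ENNReal.div_eq_inv_mul, show (512 : ℝ≥0∞) = 256 * 2 by norm_num,
        ENNReal.mul_inv (by simp) (by simp),
        show (16 : ℝ≥0∞) * (16 * K) * (256⁻¹ * 2⁻¹) = 256 * 256⁻¹ * (2⁻¹ * K) by ring,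
        ENNReal.mul_inv_cancel (by simp) (by simp), one_mul]
    have hk2 : k + 1 ≤ K / 2 := by
      rw [ENNReal.le_div_iff_mul_le (by simp) (by simp), mul_comm]
      exact le_max_right _ _
    calc ENNReal.ofReal x * cell m 1 x ≤ cell (sb m) 1 x := le_cell_sb _ _ _
      _ = cell (m.restrict (Set.Iic A) ∗ sb ν) 1 x + cell (m.restrict (Set.Ioi A) ∗ sb ν) 1 x := by
          rw [heq, conv_split m _ A, cell_add_measure]
      _ ≤ (k + 1) * (ENNReal.ofReal x * P x) + K / 2 * (ENNReal.ofReal x * P x) := by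
          rw [← hKhalf]
          exact add_le_add hx0.1 h4
      _ ≤ K / 2 * (ENNReal.ofReal x * P x) + K / 2 * (ENNReal.ofReal x * P x) := by gcongr
      _ = (K / 2 + K / 2) * (ENNReal.ofReal x * P x) := by ring
      _ = ENNReal.ofReal x * (K * P x) := by rw [ENNReal.add_halves]; ring
  have hall : ∀ i : ℕ, S K (A - 1 + j₀ + i) := by
    intro i
    induction i with
    | zero => simpa using hmono (le_max_left _ _) hSK₀
    | succ i ih =>
      have hi : (0 : ℝ) ≤ i := by positivity
      have hj : (0 : ℝ) ≤ j₀ := by positivity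
      have := hstep _ (by linarith) (by linarith) ih
      rwa [Nat.cast_succ, ← add_assoc]
  refine ⟨K, hK, ?_⟩
  filter_upwards [eventually_ge_atTop (A - 1)] with y hy
  obtain ⟨i, hi⟩ := exists_nat_ge (y - (A - 1) - j₀)
  exact hall i y hy (by linarith)

theorem cell_shift_le (hP : LongTailRef P) (h1 : EvLe P (cell m 1) 1) (h2 : EvGe P (cell m 1) 1) :
    ∀ᶠ x in atTop, ∀ a, |a| ≤ 1 → cell m 1 (x + a) ≤ 8 * cell m 1 x := by
  obtain ⟨X, hX⟩ := eventually_atTop.1 ((h1 2 (by norm_num)).and (h2 2⁻¹ (by simp)))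
  filter_upwards [eventually_ge_atTop (X + 1), hP.shift 1 2 (by norm_num)] with x hx h3 a ha
  calc cell m 1 (x + a) ≤ 2 * P (x + a) := (hX _ (by linarith [neg_le_of_abs_le ha])).1
    _ ≤ 2 * (2 * P x) := by gcongr; exact h3 a ha
    _ = 4 * P x := by ring
    _ = 8 * (2⁻¹ * P x) := by
        rw [show (8 : ℝ≥0∞) = 4 * 2 by norm_num, mul_assoc, ← mul_assoc 2 2⁻¹,
          ENNReal.mul_inv_cancel (by norm_num) (by norm_num), one_mul]
    _ ≤ _ := by gcongr; exact (hX _ (by linarith)).2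

theorem LongTailed.longTailRef_cell [IsFiniteMeasure m] {c : ℝ}
    (h : LongTailed (intervalMass m c)) : LongTailRef (cell m c) := by
  have := h.longTailRef
  simp only [ofReal_intervalMass] at this
  exact this

theorem ofReal_intervalMass_levy (h : IsLevyMeasure ν) (c : ℝ) {x : ℝ} (hx : 0 < x) :
    ENNReal.ofReal (intervalMass ν c x) = cell ν c x :=
  ofReal_measureReal ((measure_mono Set.Ioc_subset_Ioi_self).trans_lt (h.Ioi_lt_top hx)).ne

theorem cell_levy_eq (h : IsLevyMeasure ν) (h0 : 0 < ν (Set.Ioi 1)) {c x : ℝ} (hx : 1 ≤ x) :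
    cell ν c x = ν (Set.Ioi 1) * cell (normalizedLevy ν) c x := by
  rw [cell_normalizedLevy hx, ← mul_assoc, ENNReal.mul_inv_cancel h0.ne'
    (h.Ioi_lt_top one_pos).ne, one_mul]

/-- The reference function is the unit cell of `ν₍₁₎`. Once the bootstrap gives `μ = O(P)`,
Steutel's identity evaluates `x μ(dx)` as `μ(ℝ) = 1` times `x ν(dx)` on cells; long-tailedness of
`p` returns to the density. -/
theorem HasLevyRepresentation.asympEquiv_of_memSLoc (hμ : HasLevyRepresentation μ 0 ν)
    (h0 : 0 < ν (Set.Ioi 1)) (hp : IsDensityOf p μ) (hL : LongTailed p)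
    (hS : MemSLoc (normalizedLevy ν)) : AsympEquiv p (intervalMass ν 1) := by
  have hν := hμ.isLevyMeasure
  have hσ := hν.sigmaFinite
  have hprob := hμ.infinitelyDivisible.1
  set ρ := normalizedLevy ν with hρ
  set M := ν (Set.Ioi 1) with hM
  have hMtop : M ≠ ⊤ := (hν.Ioi_lt_top one_pos).ne
  obtain ⟨⟨hρp, hρL⟩, hρS⟩ := hS 1 one_pos
  set P := cell ρ 1 with hPdef
  have hP : LongTailRef P := hρL.longTailRef_cell
  have hρS' : EvLe P (cell (ρ ∗ ρ) 1) 2 := by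
    have h1 := hρS.evLe
    simp only [ofReal_intervalMass] at h1
    have h2 : EvLe P (fun x => ENNReal.ofReal (2 * intervalMass ρ 1 x)) 2 := by
      refine EvLe.of_eventually (Eventually.of_forall fun x => le_of_eq ?_)
      rw [ENNReal.ofReal_mul (by norm_num), ofReal_intervalMass]
      simp [hPdef]
    simpa using h1.trans h2 (by simp) (by simp)
  have href : SubexpRef P ρ :=
    SubexpRef.of_conv hP (normalizedLevy_null_Iio hν) (EvGe.refl P) (by simpa using hρS')
  have hν1 : EvLe P (cell ν 1) M :=
    EvLe.of_eventually ((eventually_ge_atTop 1).mono fun x hx => (cell_levy_eq hν h0 hx).le)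
  have hν2 : EvGe P (cell ν 1) M :=
    EvGe.of_eventually ((eventually_ge_atTop 1).mono fun x hx => (cell_levy_eq hν h0 hx).ge)
  have hp1 : EvLe (fun x => ENNReal.ofReal (p x)) (cell μ 1) 1 := by
    simpa using hp.evLe_cell hL 1
  have hp2 : EvGe (fun x => ENNReal.ofReal (p x)) (cell μ 1) 1 := by
    simpa using hp.evGe_cell hL one_pos
  have hνdom := hν1.dominated hMtop
  have hμdom : Dominated P μ := href.dominated_of_sb_eq hμ.neg_eq_zero hνdom hν.sb_Iic_ne_top
    hMtop hν1.sizeBias hμ.sb_eq (cell_shift_le hL.longTailRef hp1 hp2)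
  have hle := href.conv_sb_evLe hμdom hμ.neg_eq_zero hνdom hν.sb_Iic_ne_top hMtop hν1.sizeBias
  have hge := hν2.sizeBias.conv hP.id_mul hμ.neg_eq_zero
  rw [measure_univ, one_mul, ← hμ.sb_eq] at hle hge
  have hMtop' : M⁻¹ ≠ ⊤ := by simpa using h0.ne'
  have hfin1 : EvLe P (fun x => ENNReal.ofReal (p x)) M := by
    simpa using hp2.inv.trans hle.of_sb (by simp) hMtop
  have hfin2 : EvGe P (fun x => ENNReal.ofReal (p x)) M := by
    simpa using (hge.of_sb.inv.trans hp1 hMtop' (by simp)).inv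
  have hev : ∀ᶠ x in atTop, ENNReal.ofReal (intervalMass ν 1 x) = cell ν 1 x :=
    (eventually_gt_atTop 0).mono fun x hx => ofReal_intervalMass_levy hν 1 hx
  exact AsympEquiv.of_common hp.isProbDensity.nonneg hP.pos h0.ne' hMtop hfin1 hfin2
    (hν1.mono (hev.mono fun _ h => h.le) le_rfl) (hν2.mono (hev.mono fun _ h => h.ge) le_rfl)

end

section

variable {P u v : ℝ → ℝ≥0∞} {k l : ℝ≥0∞} {m n μ ν : Measure ℝ} {p : ℝ → ℝ}

/-! ### Heavy tails force the constant `2` -/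

theorem exists_one_lt_mul_pow_sub_le {s t : ℝ≥0∞} (hs : s ≠ ⊤) (ht : t ≠ 0) (B : ℕ) :
    ∃ e : ℝ≥0∞, 1 < e ∧ e ≠ ⊤ ∧ s * (e ^ B - 1) ≤ t := by
  have : (𝓝[>] (1 : ℝ≥0∞)).NeBot := nhdsGT_neBot_of_exists_gt ⟨⊤, by simp⟩
  have h : Tendsto (fun e : ℝ≥0∞ => s * (e ^ B - 1)) (𝓝 1) (𝓝 (s * (1 ^ B - 1))) :=
    ENNReal.Tendsto.const_mul (ENNReal.Tendsto.sub ((ENNReal.continuous_pow B).tendsto 1)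
      tendsto_const_nhds (by simp)) (by simp [hs])
  simp only [one_pow, tsub_self, mul_zero] at h
  have hm : ∀ᶠ e : ℝ≥0∞ in 𝓝[>] 1, 1 < e := self_mem_nhdsWithin
  have htop : ∀ᶠ e : ℝ≥0∞ in 𝓝[>] 1, e < ⊤ :=
    nhdsWithin_le_nhds (Iio_mem_nhds (by simp : (1 : ℝ≥0∞) < ⊤))
  obtain ⟨e, h1, h2, h3⟩ := (((h.mono_left nhdsWithin_le_nhds).eventually_le_const
    (pos_iff_ne_zero.2 ht)).and (hm.and htop)).exists
  exact ⟨e, h2, h3.ne, h1⟩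

theorem exists_mem_Ioc_of_mul_le {Φ : ℕ → ℝ≥0∞} {q t : ℝ≥0∞} (h0 : Φ 0 ≤ t)
    (hq : ∀ j, Φ (j + 1) ≤ q * Φ j) (h : ∃ j, t < Φ j) : ∃ j, t < Φ j ∧ Φ j ≤ q * t := by
  classical
  refine ⟨Nat.find h, Nat.find_spec h, ?_⟩
  obtain ⟨i, hi⟩ : ∃ i, Nat.find h = i + 1 := Nat.exists_eq_succ_of_ne_zero fun h' => by
    have := Nat.find_spec h
    rw [h'] at this
    exact absurd this h0.not_gt
  have h1 : Φ i ≤ t := not_lt.1 (Nat.find_min h (by omega))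
  rw [hi]
  exact (hq i).trans (by gcongr)

theorem exists_lt_tsum_min {a : ℕ → ℝ≥0∞} {e q t : ℝ≥0∞} (he : e ≠ ⊤) (hq : 1 < q)
    (h : ∑' i, e ^ i * a i = ⊤) (ht : t ≠ ⊤) : ∃ j : ℕ, t < ∑' i, min (e ^ i) (q ^ j) * a i := by
  rw [ENNReal.tsum_eq_iSup_sum] at h
  obtain ⟨F, hF⟩ := lt_iSup_iff.1 (h ▸ ht.lt_top)
  have hlim : Tendsto (fun j : ℕ => q ^ j) atTop (𝓝 ⊤) :=
    ENNReal.tendsto_pow_atTop_nhds_top_iff.2 hq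
  have hev : ∀ᶠ j in atTop, ∀ i ∈ F, e ^ i ≤ q ^ j := by
    rw [Filter.eventually_all_finset]
    exact fun i _ => hlim.eventually_const_le (ENNReal.pow_ne_top he).lt_top
  obtain ⟨j, hj⟩ := hev.exists
  refine ⟨j, hF.trans_le ?_⟩
  refine le_trans (Finset.sum_le_sum fun i hi => ?_) (ENNReal.sum_le_tsum F)
  rw [min_eq_left (hj i hi)]

/-- Test with a truncated exponential `G` whose excess `D = ∑ (G - 1) a` is small but positive.
Submultiplicativity bounds the excess under `b` by `2 D + D ^ 2`, whereas `b ≥ s' a` far out makes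
it at least about `s' D`. Heavy tails let `G` be so flat at first that indices below `B` are
negligible; dividing by `D` gives `s' ≤ 2` up to a multiple of `δ`. -/
theorem le_two_of_submultiplicative {a b : ℕ → ℝ≥0∞} (ha : ∑' i, a i = 1) (hb1 : ∑' i, b i = 1)
    (hb : ∀ f : ℕ → ℝ≥0∞, Monotone f → (∀ i j, f (i + j) ≤ f i * f j) →
      ∑' i, f i * b i ≤ (∑' i, f i * a i) * ∑' i, f i * a i)
    (hheavy : ∀ e : ℝ≥0∞, 1 < e → e ≠ ⊤ → ∑' i, e ^ i * a i = ⊤)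
    {t : ℝ≥0∞} (hs : ∀ s, s < t → ∃ B, ∀ i, B ≤ i → s * a i ≤ b i) : t ≤ 2 := by
  refine le_of_forall_lt fun s hst => ?_
  by_contra hs2
  obtain ⟨s', hss', hs't⟩ := exists_between hst
  obtain ⟨r, hr, hlt⟩ := ENNReal.lt_iff_exists_add_pos_lt.1 ((not_lt.1 hs2).trans_lt hss')
  set δ : ℝ≥0∞ := r / 4 with hδ
  have hδ0 : δ ≠ 0 := by simp [hδ, hr.ne']
  have hδt : δ ≠ ⊤ := ENNReal.div_ne_top (by simp) (by simp)
  have h4 : 4 * δ = r := ENNReal.mul_div_cancel (by simp) (by simp)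
  have hs't' : s' ≠ ⊤ := (lt_top_of_lt hs't).ne
  obtain ⟨B, hB⟩ := hs s' hs't
  obtain ⟨e, he1, het, heB⟩ := exists_one_lt_mul_pow_sub_le hs't' (mul_ne_zero hδ0 hδ0) B
  -- Raising the cap from `q ^ j` to `q ^ (j + 1)` multiplies the mean of `G` by at most `q`, so the
  -- first mean exceeding `1 + δ` is still at most `1 + 2 * δ`.
  set q : ℝ≥0∞ := (1 + 2 * δ) / (1 + δ) with hq
  have h1δ0 : 1 + δ ≠ 0 := by simp
  have h1δt : 1 + δ ≠ ⊤ := by simp [hδt]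
  have hqm : q * (1 + δ) = 1 + 2 * δ := ENNReal.div_mul_cancel h1δ0 h1δt
  have hq1 : 1 < q := by
    rw [hq, ENNReal.lt_div_iff_mul_lt (Or.inl h1δ0) (Or.inl h1δt), one_mul, two_mul, ← add_assoc]
    exact ENNReal.lt_add_right h1δt hδ0
  obtain ⟨j, hj1, hj2⟩ := exists_mem_Ioc_of_mul_le
    (Φ := fun j => ∑' i, min (e ^ i) (q ^ j) * a i) (q := q) (t := 1 + δ)
    (by
      have : ∀ i, min (e ^ i) (q ^ 0) = 1 := fun i => by
        rw [pow_zero]; exact min_eq_right (one_le_pow₀ he1.le)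
      simp only [this, one_mul, ha]
      exact le_self_add)
    (fun j => by
      rw [← ENNReal.tsum_mul_left]
      refine ENNReal.tsum_le_tsum fun i => ?_
      rw [← mul_assoc]
      gcongr
      rw [pow_succ', mul_min]
      exact min_le_min (le_mul_of_one_le_left zero_le hq1.le) le_rfl)
    (exists_lt_tsum_min het hq1 (hheavy e he1 het) h1δt)
  rw [hqm] at hj2
  set G : ℕ → ℝ≥0∞ := fun i => min (e ^ i) (q ^ j) with hG
  have hG1 : ∀ i, 1 ≤ G i := fun i => le_min (one_le_pow₀ he1.le) (one_le_pow₀ hq1.le)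
  have hGmul : ∀ i i', G (i + i') ≤ G i * G i' := fun i i' => by
    have h1 := hG1 i
    have h2 := hG1 i'
    rcases le_total (e ^ i) (q ^ j) with h | h
    · rcases le_total (e ^ i') (q ^ j) with h' | h'
      · calc G (i + i') ≤ e ^ (i + i') := min_le_left _ _
          _ = G i * G i' := by rw [hG]; simp only [min_eq_left h, min_eq_left h', pow_add]
      · calc G (i + i') ≤ q ^ j := min_le_right _ _
          _ = G i' := (min_eq_right h').symm
          _ ≤ _ := le_mul_of_one_le_left zero_le h1
    · calc G (i + i') ≤ q ^ j := min_le_right _ _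
        _ = G i := (min_eq_right h).symm
        _ ≤ _ := le_mul_of_one_le_right zero_le h2
  have hGmono : Monotone G := fun i i' h => min_le_min (pow_le_pow_right₀ he1.le h) le_rfl
  set W : ℕ → ℝ≥0∞ := fun i => G i - 1 with hW
  have hGW : ∀ c : ℕ → ℝ≥0∞, ∑' i, c i = 1 → ∑' i, G i * c i = 1 + ∑' i, W i * c i := by
    intro c hc
    rw [← hc, ← ENNReal.tsum_add]
    refine tsum_congr fun i => ?_
    rw [hW]
    nth_rw 2 [← one_mul (c i)]
    rw [← add_mul, add_tsub_cancel_of_le (hG1 i)]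
  set D := ∑' i, W i * a i with hD
  have hDa := hGW a ha
  have hj1' : δ < D := (ENNReal.add_lt_add_iff_left (by simp : (1 : ℝ≥0∞) ≠ ⊤)).1 (hDa ▸ hj1)
  have hj2' : D ≤ 2 * δ := (ENNReal.add_le_add_iff_left (by simp : (1 : ℝ≥0∞) ≠ ⊤)).1 (hDa ▸ hj2)
  have hDt : D ≠ ⊤ := (hj2'.trans_lt (by simp [ENNReal.mul_lt_top, hδt.lt_top])).ne
  have hsum : s' * D ≤ δ * δ + ∑' i, W i * b i := by
    calc s' * D = ∑' i, s' * (W i * a i) := ENNReal.tsum_mul_left.symm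
      _ ≤ ∑' i, (δ * δ * a i + W i * b i) := by
          refine ENNReal.tsum_le_tsum fun i => ?_
          rcases le_or_gt B i with hi | hi
          · calc s' * (W i * a i) = W i * (s' * a i) := by ring
              _ ≤ W i * b i := by gcongr; exact hB i hi
              _ ≤ _ := le_add_self
          · refine le_trans ?_ le_self_add
            rw [← mul_assoc]
            refine mul_le_mul' (le_trans (mul_le_mul' le_rfl (tsub_le_tsub_right ?_ 1)) heB) le_rfl
            exact (min_le_left _ _).trans (pow_le_pow_right₀ he1.le hi.le)
      _ = _ := by rw [ENNReal.tsum_add, ENNReal.tsum_mul_left, ha, mul_one]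
  have hfin : 1 + s' * D ≤ 1 + (2 + 3 * δ) * D := by
    calc 1 + s' * D ≤ δ * δ + (1 + ∑' i, W i * b i) := by
          refine (add_le_add_right hsum 1).trans (le_of_eq (by ring))
      _ ≤ δ * δ + (1 + D) * (1 + D) := by
          rw [← hGW b hb1, ← hDa]; gcongr; exact hb G hGmono hGmul
      _ = 1 + (2 * D + δ * δ + D * D) := by ring
      _ ≤ 1 + (2 * D + δ * D + 2 * δ * D) := by gcongr
      _ = _ := by ring
  have h5 : s' * D ≤ (2 + 3 * δ) * D :=
    (ENNReal.add_le_add_iff_left (by simp : (1 : ℝ≥0∞) ≠ ⊤)).1 hfin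
  have h6 : s' ≤ 2 + 3 * δ :=
    (ENNReal.mul_le_mul_iff_left (zero_le.trans_lt hj1').ne' hDt).1 h5
  refine absurd (hlt.trans_le h6) (not_lt.2 ?_)
  rw [← h4]
  gcongr
  norm_num

theorem lintegral_natCeil (m : Measure ℝ) (f : ℕ → ℝ≥0∞) :
    ∫⁻ x, f ⌈x⌉₊ ∂m = ∑' i, f i * m.map Nat.ceil {i} := by
  rw [← lintegral_map (f := f) (measurable_of_countable f) Nat.measurable_ceil,
    lintegral_countable']

theorem map_natCeil_succ (m : Measure ℝ) (i : ℕ) :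
    m.map Nat.ceil {i + 1} = cell m 1 i := by
  rw [Measure.map_apply Nat.measurable_ceil (measurableSet_singleton _),
    Nat.preimage_ceil_of_ne_zero (by omega), cell]
  simp

/-- Rounding up discretizes `μ` into unit cells, and `⌈x + y⌉ ≤ ⌈x⌉ + ⌈y⌉` keeps the convolution
inequality for monotone submultiplicative test functions. -/
theorem EvGe.le_two_of_conv [IsProbabilityMeasure μ] {t : ℝ≥0∞} (hP : LongTailRef P)
    (h1 : EvLe P (cell μ 1) 1) (h2 : EvGe P (cell μ 1) 1) (h : EvGe P (cell (μ ∗ μ) 1) t) :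
    t ≤ 2 := by
  have hs : ∀ m : Measure ℝ, IsProbabilityMeasure m → ∑' i, m.map Nat.ceil {i} = 1 :=
    fun m _ => by
      have := lintegral_natCeil m 1
      simpa using this.symm
  refine le_two_of_submultiplicative (a := fun i => μ.map Nat.ceil {i})
    (b := fun i => (μ ∗ μ).map Nat.ceil {i}) (hs μ inferInstance) (hs _ inferInstance) ?_ ?_ ?_
  · intro f hf hmul
    have hfm : Measurable fun x : ℝ => f ⌈x⌉₊ :=
      (measurable_of_countable f).comp Nat.measurable_ceil
    rw [← lintegral_natCeil, ← lintegral_natCeil, Measure.lintegral_conv hfm,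
      ← lintegral_mul_const _ hfm]
    refine lintegral_mono fun x => ?_
    dsimp only
    rw [← lintegral_const_mul _ hfm]
    exact lintegral_mono fun y => (hf (Nat.ceil_add_le x y)).trans (hmul _ _)
  -- Long-tailedness makes consecutive cells comparable up to a factor `e`, so the terms `e ^ i`
  -- times the cell mass are eventually nondecreasing and nonzero: no exponential moment is finite.
  · intro e he1 het
    have h3 : EvLe (fun x => cell μ 1 (x + 1)) (cell μ 1) 1 := by
      simpa using h1.trans (h2.shift hP 1).inv (by simp) (by simp)
    have hpos : ∀ᶠ x in atTop, cell μ 1 x ≠ 0 := by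
      filter_upwards [h2 2⁻¹ (by simp), hP.pos] with x hx hx'
      exact (lt_of_lt_of_le (pos_iff_ne_zero.2 (mul_ne_zero (by simp) hx')) hx).ne'
    obtain ⟨N, hN⟩ := eventually_atTop.1
      (tendsto_natCast_atTop_atTop.eventually ((h3 e he1).and hpos))
    set c : ℕ → ℝ≥0∞ := fun i => e ^ i * cell μ 1 i with hc
    have hmono : ∀ i, c N ≤ c (N + i) := fun i => by
      induction i with
      | zero => rfl
      | succ i ih =>
        refine ih.trans ?_
        have := (hN (N + i) (by omega)).1
        calc c (N + i) ≤ e ^ (N + i) * (e * cell μ 1 ((N + i : ℕ) + 1)) := by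
              simp only [hc]; gcongr
          _ = c (N + (i + 1)) := by
              rw [hc, ← add_assoc]
              push_cast
              rw [pow_succ, mul_assoc]
    have hcN : c N ≠ 0 := mul_ne_zero (pow_ne_zero _ (zero_lt_one.trans he1).ne') (hN N le_rfl).2
    rw [eq_top_iff, ← ENNReal.tsum_const_eq_top_of_ne_zero (α := ℕ) hcN]
    calc ∑' _ : ℕ, c N ≤ ∑' i, e ^ (N + i + 1) * μ.map Nat.ceil {N + i + 1} := by
          refine ENNReal.tsum_le_tsum fun i => (hmono i).trans ?_
          rw [map_natCeil_succ, hc]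
          dsimp only
          exact mul_le_mul' (pow_le_pow_right₀ he1.le (Nat.le_succ _)) le_rfl
      _ ≤ _ := ENNReal.tsum_comp_le_tsum_of_injective (f := fun i : ℕ => N + i + 1)
          (fun i j hij => by simpa using hij) (fun i => e ^ i * μ.map Nat.ceil {i})
  · intro s hst
    have h3 : EvGe (cell μ 1) (cell (μ ∗ μ) 1) t := by
      have ht0 : t ≠ 0 := (zero_le.trans_lt hst).ne'
      simpa using (h1.trans h.inv (by simp) (by simpa using ht0)).inv
    obtain ⟨B, hB⟩ := eventually_atTop.1 (tendsto_natCast_atTop_atTop.eventually (h3 s hst))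
    refine ⟨B + 1, fun i hi => ?_⟩
    obtain ⟨i, rfl⟩ := Nat.exists_eq_succ_of_ne_zero (by omega : i ≠ 0)
    simp only [Nat.succ_eq_add_one, map_natCeil_succ]
    exact hB i (by omega)

end

section

variable {P Q R u v : ℝ → ℝ≥0∞} {k l : ℝ≥0∞} {m n σ μ ν : Measure ℝ} {p : ℝ → ℝ}

/-! ### Comparison on short intervals -/

theorem EvLe.cell_nat_mul (hP : LongTailRef P) {c : ℝ} (hc : 0 ≤ c) (h : EvLe P (cell m c) k)
    (N : ℕ) : EvLe P (cell m (N * c)) (N * k) := by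
  induction N with
  | zero => exact EvLe.of_eventually (by simp [cell_zero])
  | succ N ih =>
    refine (ih.add (h.shift hP (N * c))).mono (Eventually.of_forall fun x => ?_)
      (by push_cast; rw [add_mul, one_mul])
    rw [Nat.cast_succ, add_mul, one_mul, cell_add m (by positivity) hc]

theorem EvGe.cell_nat_mul (hP : LongTailRef P) {c : ℝ} (hc : 0 ≤ c) (h : EvGe P (cell m c) k)
    (N : ℕ) : EvGe P (cell m (N * c)) (N * k) := by
  induction N with
  | zero => exact EvGe.of_eventually (by simp [cell_zero])
  | succ N ih =>
    refine (ih.add (h.shift hP (N * c))).mono (Eventually.of_forall fun x => ?_)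
      (by push_cast; rw [add_mul, one_mul])
    rw [Nat.cast_succ, add_mul, one_mul, cell_add m (by positivity) hc]

theorem exists_cell_conv_restrict_le [SFinite m] [SFinite n] [SFinite σ] {c d : ℝ} (hc : 0 < c)
    (hd : 0 ≤ d) (h : EvLe (cell n c) (cell m c) k) (hkl : k < l) :
    ∃ B, ∀ x, cell (m.restrict (Set.Ioi B) ∗ σ) d x ≤ l * cell (n ∗ σ) (d + c) x := by
  obtain ⟨B, hB⟩ := eventually_atTop.1 (h l hkl)
  refine ⟨B + c, fun x => ?_⟩
  refine (cell_conv_le_of_cell_le hc hd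
    (cell_restrict_le fun y hy => hB y (by linarith)) x).trans ?_
  gcongr
  exact cell_mono_measure (conv_mono Measure.restrict_le_self) _ _

theorem EvGe.trans {a b : ℝ≥0∞} (h : EvGe P u a) (h' : EvGe R P b) (ha : a ≠ 0) (hb : b ≠ 0) :
    EvGe R u (a * b) := by
  have := (h'.inv.trans h.inv (by simpa) (by simpa)).inv
  rwa [ENNReal.mul_inv (by simp [ha]) (by simp [hb]), inv_inv, inv_inv, mul_comm] at this

theorem EvLe.ratio {a b : ℝ≥0∞} (h : EvLe P u a) (h' : EvGe P v b) (ha : a ≠ ⊤) (hb : b ≠ 0) :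
    EvLe v u (a / b) := by
  rw [ENNReal.div_eq_inv_mul, mul_comm]
  exact h.trans h'.inv ha (by simpa)

theorem natCast_mul_one_div_succ (N : ℕ) : ((N + 1 : ℕ) : ℝ) * (1 / (N + 1)) = 1 := by
  push_cast
  field_simp

/-- A unit cell splits into `N + 1` short cells that are asymptotically equal by long-tailedness at
the short scale. -/
theorem EvLe.cell_one_div (h : EvLe P (cell m 1) k) (hk : k ≠ ⊤) {N : ℕ}
    (hR : LongTailRef (cell m (1 / (N + 1)))) :
    EvLe P (cell m (1 / (N + 1))) (k * ENNReal.ofReal (1 / (N + 1))) := by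
  have h1 := (EvGe.refl _).cell_nat_mul hR (by positivity) (N + 1)
  rw [natCast_mul_one_div_succ, mul_one] at h1
  have h2 := h1.inv.trans h (by simp) hk
  convert h2 using 1
  rw [mul_comm, one_div, ENNReal.ofReal_inv_of_pos (by positivity)]
  congr 2
  exact_mod_cast ENNReal.ofReal_natCast (N + 1)

theorem EvGe.cell_one_div (h : EvGe P (cell m 1) k) (hk : k ≠ 0) {N : ℕ}
    (hR : LongTailRef (cell m (1 / (N + 1)))) :
    EvGe P (cell m (1 / (N + 1))) (k * ENNReal.ofReal (1 / (N + 1))) := by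
  have h1 := (EvLe.refl _).cell_nat_mul hR (by positivity) (N + 1)
  rw [natCast_mul_one_div_succ, mul_one] at h1
  have h2 := h1.inv.trans h (by simp) hk
  convert h2 using 1
  rw [mul_comm, one_div, ENNReal.ofReal_inv_of_pos (by positivity)]
  congr 2
  exact_mod_cast ENNReal.ofReal_natCast (N + 1)

/-- Replacing `m` by `k n` on cells of length `1 / (N + 1)` beyond some `B` widens the window of the
convolution by just that length; `N → ∞` removes the loss, and the part of `m` below `B` is
negligible against `Q`. -/
theorem EvLe.cell_conv_of_ratio [SFinite m] [SFinite n] [SFinite σ]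
    (hQ : ∀ c, 0 < c → EvLe Q (cell (n ∗ σ) c) (ENNReal.ofReal c))
    (h0 : ∀ B, EvLe Q (cell (m.restrict (Set.Iic B) ∗ σ) 1) 0)
    (hr : ∀ N : ℕ, EvLe (cell n (1 / (N + 1))) (cell m (1 / (N + 1))) k) :
    EvLe Q (cell (m ∗ σ) 1) k := by
  refine EvLe.of_forall_gt fun l hl => ?_
  intro l' hl'
  obtain ⟨l₁, hl₁, hl₁'⟩ := exists_between hl'
  have hlim : Tendsto (fun N : ℕ => l * ENNReal.ofReal (1 + 1 / (N + 1))) atTop (𝓝 l) := by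
    have h1 : Tendsto (fun N : ℕ => (1 : ℝ) + 1 / (N + 1)) atTop (𝓝 (1 + 0)) :=
      tendsto_const_nhds.add tendsto_one_div_add_atTop_nhds_zero_nat
    have h2 := ENNReal.Tendsto.const_mul (a := l) (ENNReal.tendsto_ofReal h1) (by simp)
    simpa using h2
  obtain ⟨N, hN⟩ := (hlim.eventually_le_const hl₁).exists
  have hc : (0 : ℝ) < 1 / (N + 1) := by positivity
  obtain ⟨B, hB⟩ := exists_cell_conv_restrict_le (σ := σ) hc zero_le_one (hr N) hl
  have h3 : EvLe Q (cell (m.restrict (Set.Ioi B) ∗ σ) 1) l₁ :=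
    ((hQ _ (by positivity : 0 < 1 + 1 / ((N : ℝ) + 1))).const_mul (lt_top_of_lt hl').ne).mono
      (Eventually.of_forall hB) hN
  have h4 := (h0 B).add h3
  rw [zero_add] at h4
  rw [conv_split m σ B]
  exact h4 l' hl₁'

theorem EvGe.cell_conv_of_ratio [SFinite m] [SFinite n] [SFinite σ] (hQt : ∀ x, Q x ≠ ⊤)
    (hQ : ∀ c, 0 < c → EvGe Q (cell (m ∗ σ) c) (ENNReal.ofReal c))
    (h0 : ∀ B, EvLe Q (cell (m.restrict (Set.Iic B) ∗ σ) 1) 0)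
    (hr : ∀ N : ℕ, EvLe (cell n (1 / (N + 1))) (cell m (1 / (N + 1))) k) :
    EvGe Q (cell (n ∗ σ) 1) k⁻¹ := by
  refine EvGe.of_forall_lt fun l hl => ?_
  intro l' hl'
  obtain ⟨l₁, hl₁, hl₁'⟩ := exists_between hl'
  have hl0 : l ≠ 0 := (zero_le.trans_lt hl').ne'
  have hlt : l ≠ ⊤ := (lt_top_of_lt hl).ne
  have hlim : Tendsto (fun N : ℕ => l * ENNReal.ofReal (1 - 1 / (N + 1))) atTop (𝓝 l) := by
    have h1 : Tendsto (fun N : ℕ => (1 : ℝ) - 1 / (N + 1)) atTop (𝓝 (1 - 0)) :=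
      tendsto_const_nhds.sub tendsto_one_div_add_atTop_nhds_zero_nat
    have h2 := ENNReal.Tendsto.const_mul (a := l) (ENNReal.tendsto_ofReal h1) (by simp)
    simpa using h2
  obtain ⟨N, hN, hN1⟩ := ((hlim.eventually_const_le hl₁').and (eventually_ge_atTop 1)).exists
  have hc : (0 : ℝ) < 1 / (N + 1) := by positivity
  have hd : (0 : ℝ) < 1 - 1 / (N + 1) := by
    have : (1 : ℝ) ≤ N := by exact_mod_cast hN1
    rw [sub_pos, div_lt_one (by positivity)]
    linarith
  obtain ⟨B, hB⟩ := exists_cell_conv_restrict_le (σ := σ) hc hd.le (hr N)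
    (ENNReal.lt_inv_iff_lt_inv.1 hl)
  have h3 : EvGe Q (cell (m.restrict (Set.Ioi B) ∗ σ) (1 - 1 / (N + 1)))
      (ENNReal.ofReal (1 - 1 / (N + 1))) := by
    have h4 := hQ _ hd
    rw [conv_split m σ B] at h4
    refine EvGe.cancel_left hQt (a := 0) (by simp) (by rwa [zero_add]) ((h0 B).mono ?_ le_rfl)
    exact Eventually.of_forall fun x => cell_mono _ le_rfl (by linarith)
  refine ((h3.const_mul hlt).mono (Eventually.of_forall fun x => ?_) hN) l' hl₁
  calc l * cell (m.restrict (Set.Ioi B) ∗ σ) (1 - 1 / (N + 1)) x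
      ≤ l * (l⁻¹ * cell (n ∗ σ) (1 - 1 / (N + 1) + 1 / (N + 1)) x) := by gcongr; exact hB x
    _ = cell (n ∗ σ) 1 x := by
      rw [← mul_assoc, ENNReal.mul_inv_cancel hl0 hlt, one_mul, sub_add_cancel]

theorem EvLe.restrict_Iic_conv_zero (hP : LongTailRef P) [IsFiniteMeasure μ] {c : ℝ}
    (hm : m (Set.Iio 0) = 0) (hfin : ∀ B, m (Set.Iic B) ≠ ⊤) (h : EvLe P (cell μ c) k)
    (hk : k ≠ ⊤) (B : ℝ) :
    EvLe (fun x => ENNReal.ofReal x * P x) (cell (m.restrict (Set.Iic B) ∗ μ) c) 0 := by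
  have : IsFiniteMeasure (m.restrict (Set.Iic B)) :=
    ⟨by rw [Measure.restrict_apply_univ]; exact (hfin B).lt_top⟩
  exact (h.conv_of_bounded hP (ae_abs_le_restrict hm B)).id_mul_zero
    (ENNReal.mul_ne_top (measure_ne_top _ _) hk)

/-- In `x (μ ∗ μ) = 2 (x μ) ∗ μ` the factor `x μ` is exchanged for `k⁻¹ x ν` far out, and `(x ν) ∗ μ
= x μ` closes the computation without any bound on the region where both summands are large. -/
theorem HasLevyRepresentation.cell_conv_self (hμ : HasLevyRepresentation μ 0 ν)
    (hP : LongTailRef P) (hk0 : k ≠ 0) (hk : k ≠ ⊤)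
    (hμ1 : ∀ c, 0 < c → EvLe P (cell μ c) (ENNReal.ofReal c))
    (hμ2 : ∀ c, 0 < c → EvGe P (cell μ c) (ENNReal.ofReal c))
    (hν1 : ∀ N : ℕ, EvLe P (cell ν (1 / (N + 1))) (k * ENNReal.ofReal (1 / (N + 1))))
    (hν2 : ∀ N : ℕ, EvGe P (cell ν (1 / (N + 1))) (k * ENNReal.ofReal (1 / (N + 1)))) :
    EvLe P (cell (μ ∗ μ) 1) (2 * k⁻¹) ∧ EvGe P (cell (μ ∗ μ) 1) (2 * k⁻¹) := by
  have hν := hμ.isLevyMeasure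
  have hσ := hν.sigmaFinite
  have hprob := hμ.infinitelyDivisible.1
  have hsb : sb ν ∗ μ = sb μ := by rw [hμ.sb_eq, Measure.conv_comm]
  have htwo : sb (μ ∗ μ) = (2 : ℝ≥0∞) • (sb μ ∗ μ) := by
    rw [sb_conv hμ.neg_eq_zero hμ.neg_eq_zero, Measure.conv_comm μ (sb μ), two_smul]
  have hpos : ∀ N : ℕ, ENNReal.ofReal (1 / ((N : ℝ) + 1)) ≠ 0 := fun N => by
    rw [ENNReal.ofReal_ne_zero_iff]; positivity
  have hr1 : ∀ N : ℕ, EvLe (cell (sb ν) (1 / (N + 1))) (cell (sb μ) (1 / (N + 1))) k⁻¹ := by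
    intro N
    have := (hμ1 (1 / ((N : ℝ) + 1)) (by positivity)).sizeBias.ratio (hν2 N).sizeBias (by simp)
      (mul_ne_zero hk0 (hpos N))
    convert this using 1
    rw [ENNReal.div_eq_inv_mul, ENNReal.mul_inv (Or.inl hk0) (Or.inl hk), mul_assoc,
      ENNReal.inv_mul_cancel (hpos N) (by simp), mul_one]
  have hr2 : ∀ N : ℕ, EvLe (cell (sb μ) (1 / (N + 1))) (cell (sb ν) (1 / (N + 1))) k := fun N => by
    have := (hν1 N).sizeBias.ratio (hμ2 (1 / ((N : ℝ) + 1)) (by positivity)).sizeBias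
      (ENNReal.mul_ne_top hk (by simp)) (hpos N)
    convert this using 1
    rw [mul_div_assoc, ENNReal.div_self (hpos N) (by simp), mul_one]
  have h1 : EvLe (fun x => ENNReal.ofReal x * P x) (cell (sb μ ∗ μ) 1) k⁻¹ :=
    EvLe.cell_conv_of_ratio (fun c hc => hsb ▸ (hμ1 c hc).sizeBias)
      ((hμ1 1 one_pos).restrict_Iic_conv_zero hP (sb_null_Iio μ) (sb_Iic_ne_top μ) (by simp)) hr1
  have h2 : EvGe (fun x => ENNReal.ofReal x * P x) (cell (sb μ ∗ μ) 1) k⁻¹ :=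
    EvGe.cell_conv_of_ratio hP.id_mul.ne_top (fun c hc => hsb ▸ (hμ2 c hc).sizeBias)
      ((hμ1 1 one_pos).restrict_Iic_conv_zero hP (sb_null_Iio ν) hν.sb_Iic_ne_top (by simp)) hr2
  refine ⟨EvLe.of_sb ?_, EvGe.of_sb ?_⟩
  · rw [htwo]; exact h1.const_mul (by simp)
  · rw [htwo]; exact h2.const_mul (by simp)

end

section

variable {P Q R u v : ℝ → ℝ≥0∞} {k l : ℝ≥0∞} {m n σ μ ν : Measure ℝ} {p : ℝ → ℝ}

/-! ### The equivalences -/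

theorem LongTailRef.longTailed_of_ev (hR : LongTailRef R) (hk0 : k ≠ 0) (hk : k ≠ ⊤)
    (hm : Measurable p) (h0 : ∀ x, 0 ≤ p x) (h1 : EvLe R (fun x => ENNReal.ofReal (p x)) k)
    (h2 : EvGe R (fun x => ENNReal.ofReal (p x)) k) : LongTailed p where
  measurable := hm
  nonneg := h0
  shift a := AsympEquiv.of_common (fun _ => h0 _) hR.pos hk0 hk (h1.shift hR a) (h2.shift hR a)
    h1 h2

/-- Long-tailedness of `p` is inherited from the unit cells of `ν₍₁₎`. The constant `C` is not known
in advance: the convolution square is first found to be asymptotic to `2 C p`, and only then is `C`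
limited by heaviness of the tail. -/
theorem HasLevyRepresentation.subexpDensity_of_asympEquiv (hμ : HasLevyRepresentation μ 0 ν)
    (h0 : 0 < ν (Set.Ioi 1)) (hp : IsDensityOf p μ) (hL : MemLLoc (normalizedLevy ν)) {C : ℝ}
    (hC : 0 < C) (h : AsympEquiv p (fun x => C * intervalMass ν 1 x)) : SubexpDensity p := by
  have hν := hμ.isLevyMeasure
  have hσ := hν.sigmaFinite
  have hprob := hμ.infinitelyDivisible.1
  have hd := hp.isProbDensity
  set M := ν (Set.Ioi 1) with hM
  have hMt : M ≠ ⊤ := (hν.Ioi_lt_top one_pos).ne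
  set κ := ENNReal.ofReal C with hκ
  have hκ0 : κ ≠ 0 := by simpa [hκ] using hC
  have hκt : κ ≠ ⊤ := ENNReal.ofReal_ne_top
  have hρ : IsProbabilityMeasure (normalizedLevy ν) := (hL 1 one_pos).1
  have hR : ∀ c, 0 < c → LongTailRef (cell (normalizedLevy ν) c) := fun c hc =>
    (hL c hc).2.longTailRef_cell
  have hR1 := hR 1 one_pos
  have hev : ∀ᶠ x in atTop, ENNReal.ofReal (C * intervalMass ν 1 x) =
      κ * (M * cell (normalizedLevy ν) 1 x) := by
    filter_upwards [eventually_ge_atTop 1] with x hx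
    rw [ENNReal.ofReal_mul hC.le, ofReal_intervalMass_levy hν 1 (by linarith),
      cell_levy_eq hν h0 hx]
  have hκM0 : κ * M ≠ 0 := mul_ne_zero hκ0 h0.ne'
  have hκMt : κ * M ≠ ⊤ := ENNReal.mul_ne_top hκt hMt
  have hg1 : EvLe (cell (normalizedLevy ν) 1) (fun x => ENNReal.ofReal (C * intervalMass ν 1 x))
      (κ * M) := EvLe.of_eventually (hev.mono fun x hx => by rw [hx, mul_assoc])
  have hg2 : EvGe (cell (normalizedLevy ν) 1) (fun x => ENNReal.ofReal (C * intervalMass ν 1 x))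
      (κ * M) := EvGe.of_eventually (hev.mono fun x hx => by rw [hx, mul_assoc])
  have hp1 : EvLe (cell (normalizedLevy ν) 1) (fun x => ENNReal.ofReal (p x)) (κ * M) := by
    simpa using h.evLe.trans hg1 (by simp) hκMt
  have hp2 : EvGe (cell (normalizedLevy ν) 1) (fun x => ENNReal.ofReal (p x)) (κ * M) := by
    simpa using h.evGe.trans hg2 (by simp) hκM0
  have hLT : LongTailed p := hR1.longTailed_of_ev hκM0 hκMt hd.measurable hd.nonneg hp1 hp2
  have hcell : ∀ N : ℕ, ∀ᶠ x in atTop, cell ν (1 / (N + 1)) x =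
      M * cell (normalizedLevy ν) (1 / (N + 1)) x := fun N =>
    (eventually_ge_atTop 1).mono fun x hx => cell_levy_eq hν h0 hx
  have hMκ : M * (κ * M)⁻¹ = κ⁻¹ := by
    rw [ENNReal.mul_inv (Or.inl hκ0) (Or.inl hκt), mul_left_comm,
      ENNReal.mul_inv_cancel h0.ne' hMt, mul_one]
  have hν1 : ∀ N : ℕ, EvLe (fun x => ENNReal.ofReal (p x)) (cell ν (1 / (N + 1)))
      (κ⁻¹ * ENNReal.ofReal (1 / (N + 1))) := fun N => by
    have h1 := (hp2.inv.cell_one_div (m := normalizedLevy ν) (by simpa using hκM0)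
      (hR (1 / ((N : ℝ) + 1)) (by positivity))).const_mul hMt
    rw [← mul_assoc, hMκ] at h1
    exact h1.mono ((hcell N).mono fun _ hx => hx.le) le_rfl
  have hν2 : ∀ N : ℕ, EvGe (fun x => ENNReal.ofReal (p x)) (cell ν (1 / (N + 1)))
      (κ⁻¹ * ENNReal.ofReal (1 / (N + 1))) := fun N => by
    have h1 := (hp1.inv.cell_one_div (m := normalizedLevy ν) (by simpa using hκMt)
      (hR (1 / ((N : ℝ) + 1)) (by positivity))).const_mul hMt
    rw [← mul_assoc, hMκ] at h1
    exact h1.mono ((hcell N).mono fun _ hx => hx.ge) le_rfl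
  obtain ⟨h1, h2⟩ := hμ.cell_conv_self hLT.longTailRef (by simpa using hκt) (by simpa using hκ0)
    (fun c _ => hp.evLe_cell hLT c) (fun c hc => hp.evGe_cell hLT hc) hν1 hν2
  -- This amounts to `C ≤ 1`; the upper bound alone meets the criterion for subexponentiality, so `C
  -- ≥ 1` is not needed.
  have h3 := EvGe.le_two_of_conv hLT.longTailRef (by simpa using hp.evLe_cell hLT 1)
    (by simpa using hp.evGe_cell hLT one_pos) h2
  exact (hp.subexpDensity_iff ⟨hd, hLT⟩ hμ.neg_eq_zero).2
    (h1.mono (Eventually.of_forall fun _ => le_rfl) h3)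

theorem IsDensityOf.subexpLevy (hp : IsDensityOf p μ) (hS : SubexpDensity p)
    (hμ : HasLevyRepresentation μ 0 ν) : SubexpLevy (fun x => ENNReal.ofReal (p x)) μ ν := by
  have hprob := hμ.infinitelyDivisible.1
  have hL := hS.1.2
  refine ⟨hμ, SubexpRef.of_conv hL.longTailRef hμ.neg_eq_zero
    (by simpa using hp.evGe_cell hL one_pos) ?_, fun c _ => hp.evLe_cell hL c,
    fun c hc => hp.evGe_cell hL hc⟩
  simpa using (hp.subexpDensity_iff hS.1 hμ.neg_eq_zero).1 hS

theorem SubexpLevy.asympEquiv (h : SubexpLevy (fun x => ENNReal.ofReal (p x)) μ ν)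
    (hp : IsDensityOf p μ) : AsympEquiv p (intervalMass ν 1) := by
  have hev : ∀ᶠ x in atTop, ENNReal.ofReal (intervalMass ν 1 x) = cell ν 1 x :=
    (eventually_gt_atTop 0).mono fun x hx => ofReal_intervalMass_levy h.rep.isLevyMeasure 1 hx
  exact AsympEquiv.of_common hp.isProbDensity.nonneg h.ref.longTail.pos one_ne_zero (by simp)
    (EvLe.refl _) (EvGe.refl _)
    ((h.levy_evLe one_pos).mono (hev.mono fun _ h => h.le) (by simp))
    ((h.levy_evGe one_pos).mono (hev.mono fun _ h => h.ge) (by simp))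

end

end SubexpDensity

end

theorem proposition1p1 (μ ν : Measure ℝ) (p : ℝ → ℝ)
    (hμ : SubexpDensity.HasLevyRepresentation μ 0 ν)
    (hν : ∀ c : ℝ, 0 < c → 0 < ν (Set.Ioi c))
    (hp : SubexpDensity.IsDensityOf p μ) :
    (SubexpDensity.LongTailedDensity p →
      (SubexpDensity.SubexpDensity p ↔
        SubexpDensity.MemSLoc (SubexpDensity.normalizedLevy ν))) ∧
    List.TFAE [
      SubexpDensity.SubexpDensity p,
      SubexpDensity.MemLLoc (SubexpDensity.normalizedLevy ν) ∧
        SubexpDensity.AsympEquiv p (SubexpDensity.intervalMass ν 1),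
      SubexpDensity.MemLLoc (SubexpDensity.normalizedLevy ν) ∧
        ∃ C : ℝ, 0 < C ∧
          SubexpDensity.AsympEquiv p (fun x => C * SubexpDensity.intervalMass ν 1 x)] := by
  have h0 := hν 1 one_pos
  have hone : ∀ h : SubexpDensity.AsympEquiv p (SubexpDensity.intervalMass ν 1),
      SubexpDensity.AsympEquiv p (fun x => 1 * SubexpDensity.intervalMass ν 1 x) := fun h => by
    simpa only [one_mul] using h
  refine ⟨fun hL => ⟨fun hS => (hp.subexpLevy hS hμ).memSLoc h0, fun hS => ?_⟩, ?_⟩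
  -- Local subexponentiality of `ν₍₁₎` serves to get `p(x) ∼ ν((x, x + 1])`; the rest is the
  -- implication from (c) to (a) with `C = 1`.
  · exact hμ.subexpDensity_of_asympEquiv h0 hp (fun c hc => (hS c hc).1) one_pos
      (hone (hμ.asympEquiv_of_memSLoc h0 hp hL.2 hS))
  · tfae_have 1 → 2 := fun hS =>
      ⟨fun c hc => ((hp.subexpLevy hS hμ).memSLoc h0 c hc).1, (hp.subexpLevy hS hμ).asympEquiv hp⟩
    tfae_have 2 → 3 := fun h => ⟨h.1, 1, one_pos, hone h.2⟩
    tfae_have 3 → 1 := fun ⟨hL, _, hC, h⟩ => hμ.subexpDensity_of_asympEquiv h0 hp hL hC h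
    tfae_finish
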